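/- Let $n\ge 1$, $0<p<1$ and let $\Phi:\mathbb R^n\to\mathbb C$ be locally integrable on $\mathbb R^n\setminus\{0\}$. The Hausdorff operator is $$H_\Phi f(x)=\int_{\mathbb R^n}\Phi(y)\,f\!\left(\frac{x}{|y|}\right)dy .$$ Its natural domain $\mathrm{Dom}(H_\Phi)$ is the set of measurable $f:\mathbb R^n\to\mathbb C$ for which this integral converges absolutely for almost every $x$; it contains $C_c^\infty(\mathbb R^n\setminus\{0\})$. We write $H_\Phi=0$ if $H_\Phi f=0$ a.e. for every $f\in\mathrm{Dom}(H_\Phi)$. Let $X$ be one of the following spaces. * $L^p=L^p(\mathbb R^n)$. * The local Hardy space $h^p=\{u\in\mathscr S':\|u\|_{h^p}=\|\sup_{0<t<1}|\psi_t*u|\|_{L^p}<\infty\}$, where $\psi\in\mathscr S$ is any fixed function with $\int\psi\ne0$, and $\psi_t(x)=t^{-n}\psi(x/t)$. * The modulation space $M^{p,p}=\{u\in\mathscr S':\|u\|_{M^{p,p}}=(\sum_{k\in\mathbb Z^n}\|\mathscr F^{-1}\sigma_k\mathscr F u\|_{L^p}^p)^{1/p}<\infty\}$, where $\sigma_k(\xi)=\eta(\xi-k)/\sum_{l\in\mathbb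 Z^n}\eta(\xi-l)$ and $\eta:\mathbb R^n\to[0,1]$ is any fixed smooth function with $\eta=1$ for $|\xi|_\infty\le\frac12$ and $\eta=0$ for $|\xi|_\infty\ge\frac34$. * The Besov space $B^{p,p}=\{u\in\mathscr S':\|u\|_{B^{p,p}}=(\sum_{j\ge0}\|\Delta_ju\|_{L^p}^p)^{1/p}<\infty\}$ or the Triebel–Lizorkin space $F^{p,p}=\{u\in\mathscr S':\|u\|_{F^{p,p}}=\|(\sum_{j\ge0}|\Delta_ju|^p)^{1/p}\|_{L^p}<\infty\}$. Here $\Delta_j=\mathscr F^{-1}\phi_j\mathscr F$, $\phi_0=\varphi$, $\phi_j(\xi)=\varphi(2^{-j}\xi)-\varphi(2^{1-j}\xi)$ for $j\ge1$, and $\varphi$ is any fixed real-valued smooth function that vanishes for $|\xi|\ge\frac32$ and equals $1$ for $|\xi|\le\frac43$. Let $\mathcal D$ be any class of functions with $C_c^\infty(\mathbb R^n\setminus\{0\})\subset\mathcal D\subset\mathrm{Dom}(H_\Phi)$ (for instance either of the two extremes). Say that $H_\Phi$ is bounded on $X$ if there is a constant $C<\infty$ such that $H_\Phi f\in X$ and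 $\|H_\Phi f\|_X\le C\|f\|_X$ for all $f\in\mathcal D\cap X$; for the spaces $X\subset\mathscr S'$, a locally integrable function belongs to $X$ if, as a distribution, it is (the restriction to $C_c^\infty(\mathbb R^n)$ of) an element of $X$. Then, for each of the five choices $X=L^p,\ h^p,\ M^{p,p},\ B^{p,p},\ F^{p,p}$, $$H_\Phi\ \text{is bounded on}\ X\iff H_\Phi=0 .$$ -/

import Mathlib

open MeasureTheory SchwartzMap FourierTransform
open scoped ENNReal NNReal ContDiff

noncomputable section

namespace Hausdorff

/-- Euclidean space `ℝⁿ`. -/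
abbrev E (n : ℕ) : Type := EuclideanSpace ℝ (Fin n)

/-! ### The Hausdorff operator -/

/-- `H_Φ f (x) = ∫ Φ(y) f(x / |y|) dy`. -/
def hausdorff {n : ℕ} (Φ f : E n → ℂ) (x : E n) : ℂ :=
  ∫ y, Φ y * f (‖y‖⁻¹ • x)

/-- The natural (maximal) domain of `H_Φ`: the measurable functions `f` for which the integral
defining `H_Φ f (x)` converges absolutely for almost every `x`. -/
def naturalDomain {n : ℕ} (Φ : E n → ℂ) : Set (E n → ℂ) :=
  {f | AEStronglyMeasurable f volume ∧
    ∀ᵐ x : E n, Integrable (fun y : E n => Φ y * f (‖y‖⁻¹ • x)) volume}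

/-- `C_c^∞(ℝⁿ ∖ {0})`: smooth functions with compact support away from the origin. -/
def testFunctions (n : ℕ) : Set (E n → ℂ) :=
  {f | ContDiff ℝ ∞ f ∧ HasCompactSupport f ∧ (0 : E n) ∉ tsupport f}

/-- `H_Φ = 0`: the operator vanishes on its whole natural domain. -/
def IsZeroOperator {n : ℕ} (Φ : E n → ℂ) : Prop :=
  ∀ f ∈ naturalDomain Φ, hausdorff Φ f =ᵐ[volume] 0

/-! ### Tempered distributions: convolution, dilation, functions as distributions -/

/-- `(scale c ψ)(x) = ψ(c x)` for `c ≠ 0`. -/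
def scale {n : ℕ} (c : ℝ) (hc : c ≠ 0) (ψ : 𝓢(E n, ℂ)) : 𝓢(E n, ℂ) :=
  compCLMOfContinuousLinearEquiv ℂ
    (ContinuousLinearEquiv.smulLeft (R₁ := ℝ) (M₁ := E n) (Units.mk0 c hc)) ψ

theorem scale_apply {n : ℕ} (c : ℝ) (hc : c ≠ 0) (ψ : 𝓢(E n, ℂ)) (x : E n) :
    scale c hc ψ x = ψ (c • x) := rfl

/-- The Schwartz function `y ↦ ψ(x - y)`. -/
def reflectAt {n : ℕ} (ψ : 𝓢(E n, ℂ)) (x : E n) : 𝓢(E n, ℂ) :=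
  compSubConstCLM ℂ x
    (compCLMOfContinuousLinearEquiv ℂ (ContinuousLinearEquiv.neg ℝ (M := E n)) ψ)

theorem reflectAt_apply {n : ℕ} (ψ : 𝓢(E n, ℂ)) (x y : E n) :
    reflectAt ψ x y = ψ (x - y) := by
  change ψ (-(y - x)) = _
  rw [neg_sub]

/-- The convolution `ψ ∗ u` of a Schwartz function and a tempered distribution, which is the
function `x ↦ ⟨u, ψ(x - ·)⟩`. -/
def conv {n : ℕ} (ψ : 𝓢(E n, ℂ)) (u : 𝓢'(E n, ℂ)) (x : E n) : ℂ :=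
  u (reflectAt ψ x)

/-- The Fourier multiplier `𝓕⁻¹ m 𝓕 u` with a Schwartz symbol `m`. It is the function
`(𝓕⁻¹ m) ∗ u`, that is, `x ↦ ⟨𝓕 u, m exp(2 π i ⟨x, ·⟩)⟩`. -/
def multiplier {n : ℕ} (m : 𝓢(E n, ℂ)) (u : 𝓢'(E n, ℂ)) : E n → ℂ :=
  conv (𝓕⁻ m) u

/-- The tempered distribution `u` is given by the locally integrable function `g`. -/
def Represents {n : ℕ} (g : E n → ℂ) (u : 𝓢'(E n, ℂ)) : Prop :=
  LocallyIntegrable g volume ∧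
    ∀ χ : 𝓢(E n, ℂ), HasCompactSupport χ → u χ = ∫ x, g x * χ x

/-! ### Local Hardy spaces -/

/-- `ψ_t(x) = t⁻ⁿ ψ(x / t)`, for `t > 0`. -/
def approxId {n : ℕ} (ψ : 𝓢(E n, ℂ)) (t : ℝ) (ht : 0 < t) : 𝓢(E n, ℂ) :=
  (((t ^ n)⁻¹ : ℝ) : ℂ) • scale t⁻¹ (inv_ne_zero ht.ne') ψ

/-- `‖u‖_{h^p} = ‖ sup_{0 < t < 1} |ψ_t ∗ u| ‖_{L^p}`; it is finite exactly on `h^p`. -/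
def localHardyNorm {n : ℕ} (ψ : 𝓢(E n, ℂ)) (p : ℝ) (u : 𝓢'(E n, ℂ)) : ℝ≥0∞ :=
  eLpNorm (fun x => ⨆ t : Set.Ioo (0 : ℝ) 1, ‖conv (approxId ψ t t.2.1) u x‖ₑ)
    (ENNReal.ofReal p) volume

/-! ### Besov and Triebel–Lizorkin spaces -/

/-- A smooth function supported in `{|ξ| < 3/2}` that equals `1` on `{|ξ| ≤ 4/3}`. -/
structure DyadicCutoff (n : ℕ) where
  toFun : E n → ℝ
  smooth : ContDiff ℝ ∞ toFun
  support_subset : Function.support toFun ⊆ Metric.ball 0 (3 / 2)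
  eq_one : ∀ ξ : E n, ‖ξ‖ ≤ 4 / 3 → toFun ξ = 1

/-- The cutoff as a (complex valued) Schwartz function. -/
def DyadicCutoff.toSchwartz {n : ℕ} (φ : DyadicCutoff n) : 𝓢(E n, ℂ) :=
  HasCompactSupport.toSchwartzMap (f := fun ξ => (φ.toFun ξ : ℂ))
    (HasCompactSupport.of_support_subset_isCompact (isCompact_closedBall (0 : E n) (3 / 2)) (by
      intro ξ hξ
      refine Metric.ball_subset_closedBall (φ.support_subset ?_)
      simpa using hξ))
    (Complex.ofRealCLM.contDiff.comp φ.smooth)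

/-- The dyadic decomposition: `φ₀ = φ` and `φ_j(ξ) = φ(2⁻ʲ ξ) - φ(2 · 2⁻ʲ ξ)` for `j ≥ 1`. -/
def DyadicCutoff.piece {n : ℕ} (φ : DyadicCutoff n) (j : ℕ) : 𝓢(E n, ℂ) :=
  if j = 0 then φ.toSchwartz
  else scale ((2 : ℝ) ^ j)⁻¹ (by positivity) φ.toSchwartz -
    scale (2 * ((2 : ℝ) ^ j)⁻¹) (by positivity) φ.toSchwartz

/-- The Littlewood–Paley operator `Δ_j = 𝓕⁻¹ φ_j 𝓕`. -/
def DyadicCutoff.block {n : ℕ} (φ : DyadicCutoff n) (j : ℕ) (u : 𝓢'(E n, ℂ)) : E n → ℂ :=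
  multiplier (φ.piece j) u

/-- `‖u‖_{B^{p,q}} = (∑_j ‖Δ_j u‖_{L^p}^q)^{1/q}` for `0 < p, q < ∞`. -/
def besovNorm {n : ℕ} (φ : DyadicCutoff n) (p q : ℝ) (u : 𝓢'(E n, ℂ)) : ℝ≥0∞ :=
  (∑' j : ℕ, eLpNorm (φ.block j u) (ENNReal.ofReal p) volume ^ q) ^ (1 / q)

/-- `‖u‖_{F^{p,q}} = ‖ (∑_j |Δ_j u|^q)^{1/q} ‖_{L^p}` for `0 < p, q < ∞`. -/
def triebelLizorkinNorm {n : ℕ} (φ : DyadicCutoff n) (p q : ℝ) (u : 𝓢'(E n, ℂ)) : ℝ≥0∞ :=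
  eLpNorm (fun x => (∑' j : ℕ, ‖φ.block j u x‖ₑ ^ q) ^ (1 / q)) (ENNReal.ofReal p) volume

/-! ### Modulation spaces -/

/-- A point of `ℤⁿ` as a point of `ℝⁿ`. -/
def latticePoint {n : ℕ} (k : Fin n → ℤ) : E n :=
  WithLp.toLp 2 (fun i => (k i : ℝ))

/-- A smooth function `ℝⁿ → [0,1]` with value `1` where `|ξ|_∞ ≤ 1/2` and `0` where
`|ξ|_∞ ≥ 3/4`. -/
structure UniformCutoff (n : ℕ) where
  toFun : E n → ℝ
  smooth : ContDiff ℝ ∞ toFun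
  mem_Icc : ∀ ξ, toFun ξ ∈ Set.Icc (0 : ℝ) 1
  eq_one : ∀ ξ : E n, (∀ i, |ξ i| ≤ 1 / 2) → toFun ξ = 1
  eq_zero : ∀ ξ : E n, (∃ i, 3 / 4 ≤ |ξ i|) → toFun ξ = 0

namespace UniformCutoff

variable {n : ℕ} (η : UniformCutoff n)

/-- `∑_{l ∈ ℤⁿ} η(ξ - l)`; the sum is locally finite. -/
def total (ξ : E n) : ℝ := ∑' l : Fin n → ℤ, η.toFun (ξ - latticePoint l)

/-- `σ(ξ) = η(ξ) / ∑_l η(ξ - l)`. -/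
def window (ξ : E n) : ℝ := η.toFun ξ / η.total ξ

/-- A finite set of lattice points that carries the sum for all points near `ξ₀`. -/
def nearby (ξ₀ : E n) : Finset (Fin n → ℤ) :=
  Fintype.piFinset fun i => Finset.Icc ⌊ξ₀ i - 2⌋ ⌈ξ₀ i + 2⌉

theorem eq_zero_of_notMem_nearby {ξ₀ ξ : E n} (h : ξ ∈ Metric.ball ξ₀ 1) {l : Fin n → ℤ}
    (hl : l ∉ nearby ξ₀) : η.toFun (ξ - latticePoint l) = 0 := by
  apply η.eq_zero
  by_contra! hcon
  apply hl
  simp only [nearby, Fintype.mem_piFinset, Finset.mem_Icc]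
  intro i
  have h1 : |ξ i - l i| < 3 / 4 := by simpa [latticePoint] using hcon i
  have h2 : |ξ i - ξ₀ i| < 1 := by
    have := PiLp.norm_apply_le (ξ - ξ₀) i
    have h3 : ‖ξ - ξ₀‖ < 1 := by simpa [dist_eq_norm] using h
    simp only [PiLp.sub_apply, Real.norm_eq_abs] at this
    linarith
  rw [abs_lt] at h1 h2
  constructor
  · have := Int.floor_le (ξ₀ i - 2)
    have h4 : ((⌊ξ₀ i - 2⌋ : ℤ) : ℝ) ≤ (l i : ℝ) := by linarith
    exact_mod_cast h4
  · have := Int.le_ceil (ξ₀ i + 2)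
    have h4 : (l i : ℝ) ≤ ((⌈ξ₀ i + 2⌉ : ℤ) : ℝ) := by linarith
    exact_mod_cast h4

theorem total_eq_sum {ξ₀ ξ : E n} (h : ξ ∈ Metric.ball ξ₀ 1) :
    η.total ξ = ∑ l ∈ nearby ξ₀, η.toFun (ξ - latticePoint l) :=
  tsum_eq_sum fun _ hl => η.eq_zero_of_notMem_nearby h hl

theorem contDiff_total : ContDiff ℝ ∞ η.total := by
  rw [contDiff_iff_contDiffAt]
  intro ξ₀
  have h : ContDiff ℝ ∞ fun ξ => ∑ l ∈ nearby ξ₀, η.toFun (ξ - latticePoint l) :=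
    ContDiff.sum fun l _ => η.smooth.comp (contDiff_id.sub contDiff_const)
  refine h.contDiffAt.congr_of_eventuallyEq ?_
  filter_upwards [Metric.ball_mem_nhds ξ₀ one_pos] with ξ hξ
  exact η.total_eq_sum hξ

theorem one_le_total (ξ : E n) : 1 ≤ η.total ξ := by
  let k : Fin n → ℤ := fun i => round (ξ i)
  have hk : η.toFun (ξ - latticePoint k) = 1 := by
    apply η.eq_one
    intro i
    simpa [latticePoint, k] using abs_sub_round (ξ i)
  have hmem : k ∈ nearby ξ := by
    by_contra hcon
    have := η.eq_zero_of_notMem_nearby (Metric.mem_ball_self one_pos) hcon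
    linarith
  rw [η.total_eq_sum (Metric.mem_ball_self one_pos), ← hk]
  exact Finset.single_le_sum (f := fun l => η.toFun (ξ - latticePoint l))
    (fun l _ => (η.mem_Icc _).1) hmem

theorem contDiff_window : ContDiff ℝ ∞ η.window :=
  η.smooth.div η.contDiff_total fun ξ => by
    have := η.one_le_total ξ
    linarith

theorem hasCompactSupport_window : HasCompactSupport η.window := by
  have hK : IsCompact
      ((EuclideanSpace.equiv (Fin n) ℝ).symm '' Set.Icc (fun _ => (-1 : ℝ)) (fun _ => 1)) :=
    isCompact_Icc.image (EuclideanSpace.equiv (Fin n) ℝ).symm.continuous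
  refine HasCompactSupport.of_support_subset_isCompact hK ?_
  intro ξ hξ
  have h0 : η.toFun ξ ≠ 0 := fun h => hξ (by simp [window, h])
  have hb : ∀ i, |ξ i| < 3 / 4 := by
    by_contra! hcon
    exact h0 (η.eq_zero ξ hcon)
  refine ⟨EuclideanSpace.equiv (Fin n) ℝ ξ, ⟨fun i => ?_, fun i => ?_⟩, by simp⟩
  · have := (abs_lt.mp (hb i)).1
    change (-1 : ℝ) ≤ ξ i
    linarith
  · have := (abs_lt.mp (hb i)).2
    change ξ i ≤ (1 : ℝ)
    linarith

/-- `σ` as a (complex valued) Schwartz function. -/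
def windowSchwartz : 𝓢(E n, ℂ) :=
  HasCompactSupport.toSchwartzMap (f := fun ξ => (η.window ξ : ℂ))
    (η.hasCompactSupport_window.comp_left (g := fun r : ℝ => (r : ℂ)) Complex.ofReal_zero)
    (Complex.ofRealCLM.contDiff.comp η.contDiff_window)

/-- The uniform decomposition `σ_k(ξ) = σ(ξ - k)`, `k ∈ ℤⁿ`. -/
def piece (k : Fin n → ℤ) : 𝓢(E n, ℂ) :=
  compSubConstCLM ℂ (latticePoint k) η.windowSchwartz

/-- The frequency-uniform decomposition operator `□_k = 𝓕⁻¹ σ_k 𝓕`. -/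
def block (k : Fin n → ℤ) (u : 𝓢'(E n, ℂ)) : E n → ℂ :=
  multiplier (η.piece k) u

end UniformCutoff

/-- `‖u‖_{M^{p,q}} = (∑_k ‖□_k u‖_{L^p}^q)^{1/q}` for `0 < p, q < ∞`. -/
def modulationNorm {n : ℕ} (η : UniformCutoff n) (p q : ℝ) (u : 𝓢'(E n, ℂ)) : ℝ≥0∞ :=
  (∑' k : Fin n → ℤ, eLpNorm (η.block k u) (ENNReal.ofReal p) volume ^ q) ^ (1 / q)

/-! ### Boundedness -/

/-- `H_Φ`, considered on the functions in `𝒟`, is bounded on `L^p`. -/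
def BoundedOnLp {n : ℕ} (p : ℝ) (Φ : E n → ℂ) (𝒟 : Set (E n → ℂ)) : Prop :=
  ∃ C : ℝ≥0, ∀ f ∈ 𝒟, MemLp f (ENNReal.ofReal p) volume →
    MemLp (hausdorff Φ f) (ENNReal.ofReal p) volume ∧
      eLpNorm (hausdorff Φ f) (ENNReal.ofReal p) volume ≤
        C * eLpNorm f (ENNReal.ofReal p) volume

/-- `H_Φ`, considered on the functions in `𝒟`, is bounded on the space
`X = {u ∈ 𝓢' : N u < ∞}` with quasi-norm `N`: if `f ∈ 𝒟` belongs to `X`, then so does `H_Φ f`,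
with `‖H_Φ f‖_X ≤ C ‖f‖_X`. Functions are identified with the distributions they represent. -/
def BoundedOn {n : ℕ} (N : 𝓢'(E n, ℂ) → ℝ≥0∞) (Φ : E n → ℂ) (𝒟 : Set (E n → ℂ)) : Prop :=
  ∃ C : ℝ≥0, ∀ f ∈ 𝒟, ∀ u : 𝓢'(E n, ℂ), Represents f u → N u < ⊤ →
    ∃ v : 𝓢'(E n, ℂ), Represents (hausdorff Φ f) v ∧ N v < ⊤ ∧ N v ≤ C * N u

end Hausdorff

end

noncomputable section

namespace Hausdorff

open Set Filter Topology
open scoped BoundedContinuousFunction LineDeriv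

/-! ### The radial density of `Φ` -/

/-! If `H_Φ = 0`, boundedness holds with constant `0`. The converse rests on a scaling mismatch that
exists only for `p < 1`.

In polar coordinates `H_Φ f(x) = ∫ g(r) f(x/r) dr`, where `g` is the radial density of `Φ`, so it
suffices to show `g = 0` a.e. (`isZeroOperator_of_radialDensity_ae_zero`). Test on a fixed bump
translated to `N e₀`. At points `x` with `x₀ = N s` and bounded transverse coordinates, `H_Φ` of
this bump equals `∫ g(r) β(N s / r - N) dr`, where `β` is the one-dimensional bump. The kernel lives
on `|r - s| ≤ 4 s / N` and has mass comparable to `s / N`, so at Lebesgue points `N` times this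
integral is at least `s |g(s)| - o(1)` in modulus (`ae_profile_lower_bound`). The region of such `x`
has length of order `N` in the direction `e₀`, so the `p`-th power of the `L^p` quasi-norm is at
least a constant times `N^{1-p} ∫ |N H_Φ f|^p ds`. The bumps are translates of each other, so
boundedness keeps this below a constant; since `p < 1`, the integral tends to `0`, and Fatou's lemma
gives `g = 0` (`isZeroOperator_of_bumpAt_bounded`).

For the other spaces only three properties of the quasi-norm matter (`isZeroOperator_of_boundedOn`):
it is finite on Schwartz functions, it is translation invariant on them, and it dominates the `L^p`
quasi-norm of a function continuous off the origin. The last point needs the pointwise values of the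
function to be recovered from the distribution (`tendsto_conv_approxId`). For `h^p` this is
immediate. For `B^{p,p}` and `F^{p,p}` the Littlewood–Paley partial sums are an approximate identity
and `ℓ^p ⊂ ℓ^1` finishes. For `M^{p,p}` one regularizes the sum of the pieces and passes to the
limit by domination; the majorant is a Nikolskii-type bound, uniform in frequency, proved by
`enorm_le_of_reproducing`. -/

/-- `r^{n-1} ∫_{S^{n-1}} Φ(r ζ) dζ`, the density of `Φ dy` with respect to `|y|`. -/
def radialDensity {n : ℕ} (Φ : E n → ℂ) (r : ℝ) : ℂ :=
  (r ^ (n - 1) : ℝ) • ∫ ζ : Metric.sphere (0 : E n) 1, Φ (r • (ζ : E n)) ∂(volume.toSphere)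

/-- For fixed `x` the factor `f(x/|y|)` is radial in `y`, so the angular integration falls on `Φ`
alone. Only the product is assumed integrable: `Φ` need not be integrable near `0` or at infinity,
and this form applies to every `f` in the natural domain. -/
theorem polar_integrable_and_integral {n : ℕ} [Nontrivial (E n)] {Φ : E n → ℂ} {h : ℝ → ℂ}
    (hi : Integrable (fun y => Φ y * h ‖y‖)) :
    IntegrableOn (fun r => radialDensity Φ r * h r) (Ioi 0) ∧
      ∫ y, Φ y * h ‖y‖ = ∫ r in Ioi (0 : ℝ), radialDensity Φ r * h r := by
  have hmp := (volume : Measure (E n)).measurePreserving_homeomorphUnitSphereProd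
  have hemb := (homeomorphUnitSphereProd (E n)).measurableEmbedding
  set G : Metric.sphere (0 : E n) 1 × Ioi (0 : ℝ) → ℂ :=
    fun q => Φ ((q.2 : ℝ) • (q.1 : E n)) * h q.2 with hG
  have hcomp : G ∘ homeomorphUnitSphereProd (E n) = fun y : ({0}ᶜ : Set (E n)) =>
      Φ y * h ‖(y : E n)‖ := by
    ext y
    have hy : ‖(y : E n)‖ ≠ 0 := norm_ne_zero_iff.2 y.2
    simp [hG, smul_smul, hy]
  have hGi : Integrable G (volume.toSphere.prod
      (Measure.volumeIoiPow (Module.finrank ℝ (E n) - 1))) := by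
    rw [← hmp.integrable_comp_emb hemb, hcomp]
    have := (integrableOn_iff_comap_subtypeVal (μ := volume) (s := ({0}ᶜ : Set (E n)))
      (f := fun y => Φ y * h ‖y‖) (measurableSet_singleton _).compl).1 hi.integrableOn
    exact this
  have hGint : ∫ y, Φ y * h ‖y‖ = ∫ q, G q ∂(volume.toSphere.prod
      (Measure.volumeIoiPow (Module.finrank ℝ (E n) - 1))) := by
    rw [← hmp.integral_comp hemb]
    change _ = ∫ y, (G ∘ homeomorphUnitSphereProd (E n)) y ∂_
    rw [hcomp, integral_subtype_comap (measurableSet_singleton _).compl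
      (fun y : E n => Φ y * h ‖y‖), restrict_compl_singleton]
  have hinner : ∀ r : Ioi (0 : ℝ), ∫ ζ, G (ζ, r) ∂(volume.toSphere) =
      (∫ ζ : Metric.sphere (0 : E n) 1, Φ ((r : ℝ) • (ζ : E n)) ∂(volume.toSphere)) * h r := by
    intro r
    simp only [hG]
    rw [integral_mul_const]
  have hdim : Module.finrank ℝ (E n) = n := by simp
  rw [hdim] at hGi hGint
  have hi2 := hGi.integral_prod_right
  rw [integral_prod_symm _ hGi] at hGint
  simp only [hinner] at hi2 hGint
  constructor
  · rw [integrableOn_iff_comap_subtypeVal measurableSet_Ioi]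
    rw [Measure.volumeIoiPow, integrable_withDensity_iff_integrable_smul' (by fun_prop) (by simp)]
      at hi2
    refine hi2.congr (Eventually.of_forall ?_)
    rintro ⟨r, hr : 0 < r⟩
    have : 0 ≤ r ^ (n - 1) := by positivity
    simp [radialDensity, ENNReal.toReal_ofReal this, mul_assoc]
  · rw [hGint]
    simp only [Measure.volumeIoiPow, ENNReal.ofReal]
    rw [integral_withDensity_eq_integral_smul (by fun_prop)]
    rw [integral_subtype_comap measurableSet_Ioi fun a : ℝ ↦ Real.toNNReal (a ^ (n - 1)) •
      ((∫ ζ : Metric.sphere (0 : E n) 1, Φ (a • (ζ : E n)) ∂(volume.toSphere)) * h a)]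
    refine setIntegral_congr_fun measurableSet_Ioi fun r hr => ?_
    have : 0 ≤ r ^ (n - 1) := pow_nonneg (le_of_lt hr) _
    simp only [radialDensity, NNReal.smul_def, Real.coe_toNNReal _ this, smul_mul_assoc]

/-- If the radial density vanishes almost everywhere, then so does the operator. -/
theorem isZeroOperator_of_radialDensity_ae_zero {n : ℕ} [Nontrivial (E n)] {Φ : E n → ℂ}
    (h0 : ∀ᵐ r ∂(volume.restrict (Ioi (0 : ℝ))), radialDensity Φ r = 0) : IsZeroOperator Φ := by
  rintro f ⟨-, hf⟩
  filter_upwards [hf] with x hx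
  have := (polar_integrable_and_integral (h := fun r => f (r⁻¹ • x)) hx).2
  change ∫ y, Φ y * f (‖y‖⁻¹ • x) = 0
  rw [this]
  refine (integral_congr_ae ?_).trans (integral_zero _ _)
  filter_upwards [h0] with r hr
  simp [hr]

/-! ### The one-dimensional profile -/

/-- A smooth bump on the line: `1` on `[-1, 1]` and `0` outside `(-2, 2)`. -/
def lineBump : ContDiffBump (0 : ℝ) := ⟨1, 2, one_pos, one_lt_two⟩

theorem lineBump_eq_one {t : ℝ} (ht : |t| ≤ 1) : lineBump t = 1 :=
  lineBump.one_of_mem_closedBall (by simpa [lineBump] using ht)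

theorem lineBump_eq_zero {t : ℝ} (ht : 2 ≤ |t|) : lineBump t = 0 :=
  lineBump.zero_of_le_dist (by simpa [lineBump] using ht)

/-- Being nonzero means `|R s / r - R| < 2`, that is `(R - 2) r < R s < (R + 2) r`. As `R ≥ 4`, this
forces `r < 2 s`, and then `R |r - s| < 2 r < 4 s`. For `r ≤ 0` the argument is at most `-R`,
outside the support. -/
theorem lineBump_support {s r R : ℝ} (hs : 0 < s) (hR : 4 ≤ R)
    (h : lineBump (R * s * r⁻¹ - R) ≠ 0) : 0 < r ∧ |r - s| ≤ 4 * s / R ∧ s / 4 ≤ r ∧ r ≤ 4 * s := by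
  have h2 : |R * s * r⁻¹ - R| < 2 := by
    by_contra hc
    exact h (lineBump_eq_zero (not_lt.1 hc))
  obtain ⟨h3, h4⟩ := abs_lt.1 h2
  have hr : 0 < r := by
    by_contra hr
    have : r⁻¹ ≤ 0 := inv_nonpos.2 (not_lt.1 hr)
    have : R * s * r⁻¹ ≤ 0 := mul_nonpos_of_nonneg_of_nonpos (by positivity) this
    linarith
  refine ⟨hr, ?_⟩
  have h5 : R * s < (R + 2) * r := by
    have : R * s * r⁻¹ < R + 2 := by linarith
    rwa [← div_eq_mul_inv, div_lt_iff₀ hr] at this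
  have h6 : (R - 2) * r < R * s := by
    have : R - 2 < R * s * r⁻¹ := by linarith
    rwa [← div_eq_mul_inv, lt_div_iff₀ hr] at this
  have h7 : r < 2 * s := by nlinarith
  refine ⟨?_, by nlinarith, by linarith⟩
  rw [abs_le, neg_le, le_div_iff₀ (by linarith), le_div_iff₀ (by linarith)]
  constructor <;> nlinarith

/-- On `[s, s + s/R]` the argument of the bump stays in `[-1, 0]`, so the bump is `1` on an interval
of length `s / R`. -/
theorem lineBump_mass {s R : ℝ} (hs : 0 < s) (hR : 4 ≤ R) :
    s ≤ R * ∫ r in Metric.closedBall s (4 * s / R), lineBump (R * s * r⁻¹ - R) := by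
  have hR0 : 0 < R := by linarith
  have hsub : Icc s (s + s / R) ⊆ Metric.closedBall s (4 * s / R) := by
    intro r hr
    rw [Metric.mem_closedBall, Real.dist_eq, abs_of_nonneg (by linarith [hr.1])]
    have : s / R ≤ 4 * s / R := by gcongr; linarith
    linarith [hr.2]
  have hm : Measurable fun r : ℝ => lineBump (R * s * r⁻¹ - R) :=
    lineBump.continuous.measurable.comp (by fun_prop)
  have hint : IntegrableOn (fun r : ℝ => lineBump (R * s * r⁻¹ - R))
      (Metric.closedBall s (4 * s / R)) := by
    refine Measure.integrableOn_of_bounded (M := 1) measure_closedBall_lt_top.ne hm.aestronglyMeasurable ?_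
    exact Eventually.of_forall fun r => by
      rw [Real.norm_of_nonneg lineBump.nonneg]; exact lineBump.le_one
  have h1 : ∫ r in Icc s (s + s / R), (1 : ℝ) ≤
      ∫ r in Metric.closedBall s (4 * s / R), lineBump (R * s * r⁻¹ - R) := by
    calc ∫ r in Icc s (s + s / R), (1 : ℝ)
        = ∫ r in Icc s (s + s / R), lineBump (R * s * r⁻¹ - R) := by
          refine setIntegral_congr_fun measurableSet_Icc fun r hr => ?_
          have hr0 : 0 < r := hs.trans_le hr.1
          refine (lineBump_eq_one ?_).symm
          have e1 : R * s * r⁻¹ ≤ R := by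
            rw [← div_eq_mul_inv, div_le_iff₀ hr0]
            exact mul_le_mul_of_nonneg_left hr.1 hR0.le
          have e2 : R - 1 ≤ R * s * r⁻¹ := by
            rw [← div_eq_mul_inv, le_div_iff₀ hr0]
            have h3 : R * r ≤ R * s + s := by
              have := mul_le_mul_of_nonneg_left hr.2 hR0.le
              rw [mul_add, mul_div_cancel₀ _ hR0.ne'] at this
              exact this
            linarith [hr.1]
          rw [abs_le]; constructor <;> linarith
      _ ≤ _ := setIntegral_mono_set hint (Eventually.of_forall fun r => lineBump.nonneg)
          hsub.eventuallyLE
  have h2 : ∫ r in Icc s (s + s / R), (1 : ℝ) = s / R := by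
    have : 0 ≤ s / R := by positivity
    simp [this]
  rw [h2] at h1
  calc s = R * (s / R) := by field_simp
    _ ≤ _ := by gcongr

/-- At a Lebesgue point `s`, replace `g` by `g(s)` on the ball of radius `4 s / N`: the main term is
at least `s |g(s)|` by `lineBump_mass`, and since the ball has length `8 s / N`, the error is at
most `8 s` times the mean oscillation of `g` over it. -/
theorem ae_profile_lower_bound {g : ℝ → ℂ} (hg : LocallyIntegrable g) :
    ∀ᵐ s : ℝ, 0 < s → ∃ e : ℕ → ℝ, Tendsto e atTop (𝓝 0) ∧ ∀ N : ℕ, 4 ≤ N →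
      s * ‖g s‖ - e N ≤ ‖(N : ℂ) * ∫ r, g r * lineBump (N * s * r⁻¹ - N)‖ := by
  -- The balls are centred at `s` itself, so eccentricity `0` is enough.
  filter_upwards [IsUnifLocDoublingMeasure.ae_tendsto_average_norm_sub volume hg 0] with s hL hs
  set δ : ℕ → ℝ := fun N => 4 * s / N
  have hδ : Tendsto δ atTop (𝓝[>] 0) := by
    rw [tendsto_nhdsWithin_iff]
    constructor
    · exact tendsto_const_div_atTop_nhds_zero_nat _
    · filter_upwards [eventually_gt_atTop 0] with N hN
      have : (0 : ℝ) < N := by exact_mod_cast hN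
      exact div_pos (by linarith) this
  have hlim := hL (fun _ => s) δ hδ (Eventually.of_forall fun _ => by simp)
  refine ⟨fun N => 8 * s * ⨍ r in Metric.closedBall s (δ N), ‖g r - g s‖, by
    simpa using hlim.const_mul (8 * s), fun N hN => ?_⟩
  have hN4 : (4 : ℝ) ≤ N := by exact_mod_cast hN
  have hN0 : (0 : ℝ) < N := by linarith
  set B := Metric.closedBall s (δ N)
  have hm : Measurable fun r : ℝ => lineBump (N * s * r⁻¹ - N) :=
    lineBump.continuous.measurable.comp (by fun_prop)
  have hgB : IntegrableOn g B := hg.integrableOn_isCompact (isCompact_closedBall _ _)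
  have hdB : IntegrableOn (fun r => g r - g s) B :=
    hgB.sub (integrableOn_const measure_closedBall_lt_top.ne)
  have hbd : ∀ r : ℝ, ‖((lineBump (N * s * r⁻¹ - N) : ℝ) : ℂ)‖ ≤ 1 := fun r => by
    rw [Complex.norm_real, Real.norm_of_nonneg lineBump.nonneg]; exact lineBump.le_one
  have hmC : AEStronglyMeasurable (fun r : ℝ => ((lineBump (N * s * r⁻¹ - N) : ℝ) : ℂ))
      (volume.restrict B) := (Complex.measurable_ofReal.comp hm).aestronglyMeasurable
  have i1 : IntegrableOn (fun r => (g r - g s) * (lineBump (N * s * r⁻¹ - N) : ℝ)) B :=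
    hdB.mul_bdd (c := 1) hmC (Eventually.of_forall hbd)
  have i2 : IntegrableOn (fun r => g s * (lineBump (N * s * r⁻¹ - N) : ℝ)) B :=
    (integrableOn_const (μ := volume) (C := g s) (s := B) measure_closedBall_lt_top.ne).mul_bdd
      (c := 1) hmC
      (Eventually.of_forall hbd)
  have hset : ∫ r, g r * (lineBump (N * s * r⁻¹ - N) : ℝ) =
      ∫ r in B, g r * (lineBump (N * s * r⁻¹ - N) : ℝ) := by
    refine (setIntegral_eq_integral_of_forall_compl_eq_zero fun r hr => ?_).symm
    by_contra hc
    have hne : lineBump (N * s * r⁻¹ - N) ≠ 0 := fun h => hc (by simp [h])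
    exact hr (by simpa [B, δ, Real.dist_eq] using (lineBump_support hs hN4 hne).2.1)
  have hsplit : ∫ r in B, g r * (lineBump (N * s * r⁻¹ - N) : ℝ) =
      (∫ r in B, (g r - g s) * (lineBump (N * s * r⁻¹ - N) : ℝ)) +
        g s * ((∫ r in B, lineBump (N * s * r⁻¹ - N) : ℝ) : ℂ) := by
    rw [← integral_complex_ofReal, ← integral_const_mul, ← integral_add i1 i2]
    congr 1 with r
    ring
  have hmass := lineBump_mass hs hN4
  have herr : ‖(N : ℂ) * ∫ r in B, (g r - g s) * (lineBump (N * s * r⁻¹ - N) : ℝ)‖ ≤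
      8 * s * ⨍ r in B, ‖g r - g s‖ := by
    have h1 : ‖∫ r in B, (g r - g s) * (lineBump (N * s * r⁻¹ - N) : ℝ)‖ ≤
        ∫ r in B, ‖g r - g s‖ := by
      refine norm_integral_le_of_norm_le hdB.norm (Eventually.of_forall fun r => ?_)
      rw [norm_mul]
      exact mul_le_of_le_one_right (norm_nonneg _) (hbd r)
    have h2 : ∫ r in B, ‖g r - g s‖ = (8 * s / N) * ⨍ r in B, ‖g r - g s‖ := by
      have hv : volume.real B = 8 * s / N := by
        have : (0 : ℝ) ≤ 4 * s / N := by positivity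
        simp only [B, δ]
        rw [Real.volume_real_closedBall this]
        ring
      rw [setAverage_eq, hv, smul_eq_mul, ← mul_assoc, mul_inv_cancel₀ (by positivity), one_mul]
    rw [norm_mul, Complex.norm_natCast]
    calc (N : ℝ) * _ ≤ N * ((8 * s / N) * ⨍ r in B, ‖g r - g s‖) := by
          rw [← h2]; gcongr
      _ = _ := by field_simp
  have hmain : s * ‖g s‖ ≤
      ‖(N : ℂ) * (g s * ((∫ r in B, lineBump (N * s * r⁻¹ - N) : ℝ) : ℂ))‖ := by
    rw [norm_mul, norm_mul, Complex.norm_natCast, Complex.norm_real]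
    have := le_abs_self (∫ r in B, lineBump (N * s * r⁻¹ - N))
    calc s * ‖g s‖ ≤ (N * ∫ r in B, lineBump (N * s * r⁻¹ - N)) * ‖g s‖ := by gcongr
      _ ≤ (N * |∫ r in B, lineBump (N * s * r⁻¹ - N)|) * ‖g s‖ := by gcongr
      _ = _ := by rw [Real.norm_eq_abs]; ring
  rw [hset, hsplit, mul_add]
  have := norm_sub_le_norm_add ((N : ℂ) * (g s * ((∫ r in B, lineBump (N * s * r⁻¹ - N) : ℝ) : ℂ)))
    ((N : ℂ) * ∫ r in B, (g r - g s) * (lineBump (N * s * r⁻¹ - N) : ℝ))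
  rw [add_comm] at this
  linarith

/-- By Fatou, `liminf |K_N(s)|^p = 0` for almost every `s`; where `g(s) ≠ 0`, the profile bound
keeps this liminf above `(s |g(s)| / 2)^p`. -/
theorem ae_zero_of_profile_small {g : ℝ → ℂ} (hg : LocallyIntegrable g) {a b p : ℝ} (ha : 0 < a)
    (hp : 0 < p) {K : ℕ → ℝ → ℂ}
    (hK : ∀ N : ℕ, 4 ≤ N → ∀ s ∈ Ioo a b,
      K N s = (N : ℂ) * ∫ r, g r * lineBump (N * s * r⁻¹ - N))
    (hKm : ∀ N, AEStronglyMeasurable (K N) (volume.restrict (Ioo a b)))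
    (hlim : Tendsto (fun N => ∫⁻ s in Ioo a b, ‖K N s‖ₑ ^ p) atTop (𝓝 0)) :
    ∀ᵐ s ∂(volume.restrict (Ioo a b)), g s = 0 := by
  have hF : ∫⁻ s in Ioo a b, liminf (fun N => ‖K N s‖ₑ ^ p) atTop = 0 := by
    refine le_antisymm ?_ zero_le
    refine (lintegral_liminf_le' fun N => (hKm N).enorm.pow_const p).trans ?_
    rw [hlim.liminf_eq]
  have hm : AEMeasurable (fun s => liminf (fun N => ‖K N s‖ₑ ^ p) atTop)
      (volume.restrict (Ioo a b)) := by
    have hKm' := fun N => (hKm N).enorm.pow_const p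
    refine ⟨fun s => liminf (fun N => (hKm' N).mk _ s) atTop,
      Measurable.liminf fun N => (hKm' N).measurable_mk, ?_⟩
    filter_upwards [ae_all_iff.2 fun N => (hKm' N).ae_eq_mk] with s hs
    simp only [hs]
  have h0 := (lintegral_eq_zero_iff' hm).1 hF
  filter_upwards [h0, ae_restrict_of_ae (ae_profile_lower_bound hg),
    ae_restrict_mem measurableSet_Ioo] with s hs hlow hsm
  by_contra hne
  have hs0 : 0 < s := ha.trans hsm.1
  obtain ⟨e, he, hle⟩ := hlow hs0
  set δ := s * ‖g s‖ / 2
  have hδ : 0 < δ := by have := norm_pos_iff.2 hne; positivity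
  have hev : ∀ᶠ N in atTop, ENNReal.ofReal δ ^ p ≤ ‖K N s‖ₑ ^ p := by
    filter_upwards [he.eventually_lt_const hδ, eventually_ge_atTop 4] with N h1 h2
    have h3 := hle N h2
    rw [← hK N h2 s hsm] at h3
    have h4 : δ ≤ ‖K N s‖ := by
      have : s * ‖g s‖ = 2 * δ := by simp only [δ]; ring
      linarith
    gcongr
    rw [← ofReal_norm]
    exact ENNReal.ofReal_le_ofReal h4
  have hl : ENNReal.ofReal δ ^ p ≤ liminf (fun N => ‖K N s‖ₑ ^ p) atTop :=
    le_liminf_of_le (by isBoundedDefault) hev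
  rw [hs] at hl
  have : 0 < ENNReal.ofReal δ ^ p := ENNReal.rpow_pos (ENNReal.ofReal_pos.2 hδ) (by simp)
  exact absurd hl (not_le.2 this)

/-! ### The operator on test functions -/

theorem aestronglyMeasurable_of_locallyIntegrableOn_compl_zero {n : ℕ} [Nontrivial (E n)]
    {Φ : E n → ℂ} (hΦ : LocallyIntegrableOn Φ {0}ᶜ volume) : AEStronglyMeasurable Φ volume := by
  have := hΦ.aestronglyMeasurable
  rwa [restrict_compl_singleton] at this

/-- The support of `f` lies in an annulus, so for `c ≤ |x| ≤ d` only the `y` in a fixed compact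
annulus away from `0` contribute, and there `Φ` is integrable. The majorant is uniform in `x`, as
dominated convergence requires. -/
theorem exists_integrable_bound {n : ℕ} {Φ f : E n → ℂ}
    (hΦ : LocallyIntegrableOn Φ {0}ᶜ volume) (hf : f ∈ testFunctions n) {c d : ℝ} (hc : 0 < c) :
    ∃ B : E n → ℝ, Integrable B ∧ ∀ x : E n, c ≤ ‖x‖ → ‖x‖ ≤ d → ∀ y,
      ‖Φ y * f (‖y‖⁻¹ • x)‖ ≤ B y := by
  obtain ⟨hsm, hcs, h0⟩ := hf
  obtain ⟨A, hA⟩ := hcs.exists_bound_of_continuous hsm.continuous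
  obtain ⟨M, hM⟩ := hcs.isBounded.exists_norm_le
  -- `m` is the inner radius of the annulus; the outer one is taken as `|M| + 1` to have a positive
  -- number in every case.
  obtain ⟨m, hm, hball⟩ := Metric.mem_nhds_iff.1 ((isClosed_tsupport f).isOpen_compl.mem_nhds h0)
  set S : Set (E n) := {y | c / (|M| + 1) ≤ ‖y‖ ∧ ‖y‖ ≤ d / m}
  have hSc : IsClosed S :=
    (isClosed_le continuous_const continuous_norm).inter
      (isClosed_le continuous_norm continuous_const)
  have hSk : IsCompact S :=
    (isCompact_closedBall (0 : E n) (d / m)).of_isClosed_subset hSc fun y hy => by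
      simpa using hy.2
  have hS0 : S ⊆ {0}ᶜ := by
    rintro y hy rfl
    have := hy.1
    rw [norm_zero] at this
    have : 0 < c / (|M| + 1) := by positivity
    linarith
  have hΦS : IntegrableOn Φ S := (hΦ.mono_set hS0).integrableOn_isCompact hSk
  refine ⟨S.indicator fun y => ‖Φ y‖ * A, ?_, ?_⟩
  · exact (integrable_indicator_iff hSc.measurableSet).2 (hΦS.norm.mul_const A)
  · intro x hx1 hx2 y
    by_cases hy : y ∈ S
    · rw [indicator_of_mem hy, norm_mul]
      gcongr
      exact hA _
    · rw [indicator_of_notMem hy]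
      have hz : f (‖y‖⁻¹ • x) = 0 := by
        by_contra hne
        apply hy
        have hts : ‖y‖⁻¹ • x ∈ tsupport f := subset_tsupport f hne
        have h1 := hM _ hts
        have h2 : m ≤ ‖‖y‖⁻¹ • x‖ := by
          by_contra hlt
          exact hball (by simpa using not_le.1 hlt) hts
        rw [norm_smul, norm_inv, norm_norm] at h1 h2
        have hy0 : 0 < ‖y‖ := by
          rcases (norm_nonneg y).eq_or_lt with h | h
          · rw [← h] at h2; simp at h2; linarith
          · exact h
        rw [← div_eq_inv_mul] at h1 h2
        have h3 : ‖x‖ ≤ (|M| + 1) * ‖y‖ := by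
          have := (div_le_iff₀ hy0).1 h1
          have h4 : M * ‖y‖ ≤ (|M| + 1) * ‖y‖ := by
            gcongr
            linarith [le_abs_self M]
          linarith
        have h5 : m * ‖y‖ ≤ ‖x‖ := (le_div_iff₀ hy0).1 h2
        constructor
        · rw [div_le_iff₀ (by positivity)]
          linarith
        · rw [le_div_iff₀ hm]
          linarith
      simp [hz]

theorem aestronglyMeasurable_integrand {n : ℕ} [Nontrivial (E n)] {Φ f : E n → ℂ}
    (hΦ : LocallyIntegrableOn Φ {0}ᶜ volume) (hf : f ∈ testFunctions n) (x : E n) :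
    AEStronglyMeasurable (fun y => Φ y * f (‖y‖⁻¹ • x)) volume := by
  refine (aestronglyMeasurable_of_locallyIntegrableOn_compl_zero hΦ).mul ?_
  have : Measurable fun y : E n => ‖y‖⁻¹ • x := by fun_prop
  exact (hf.1.continuous.measurable.comp this).aestronglyMeasurable

theorem integrable_integrand {n : ℕ} [Nontrivial (E n)] {Φ f : E n → ℂ}
    (hΦ : LocallyIntegrableOn Φ {0}ᶜ volume) (hf : f ∈ testFunctions n) {x : E n} (hx : x ≠ 0) :
    Integrable (fun y => Φ y * f (‖y‖⁻¹ • x)) := by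
  obtain ⟨B, hB, hle⟩ := exists_integrable_bound hΦ hf (c := ‖x‖) (d := ‖x‖) (norm_pos_iff.2 hx)
  exact hB.mono' (aestronglyMeasurable_integrand hΦ hf x)
    (Eventually.of_forall fun y => hle x le_rfl le_rfl y)

/-- Continuity off the origin is what allows pointwise values of `H_Φ f` to be read off from the
distribution that it represents. -/
theorem continuousAt_hausdorff {n : ℕ} [Nontrivial (E n)] {Φ f : E n → ℂ}
    (hΦ : LocallyIntegrableOn Φ {0}ᶜ volume) (hf : f ∈ testFunctions n) {x : E n} (hx : x ≠ 0) :
    ContinuousAt (hausdorff Φ f) x := by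
  have hx0 : 0 < ‖x‖ := norm_pos_iff.2 hx
  obtain ⟨B, hB, hle⟩ := exists_integrable_bound hΦ hf (c := ‖x‖ / 2) (d := 2 * ‖x‖) (by positivity)
  refine continuousAt_of_dominated (bound := B)
    (Eventually.of_forall fun z => aestronglyMeasurable_integrand hΦ hf z) ?_ hB ?_
  · have h1 := continuous_norm.continuousAt.eventually_const_lt (show ‖x‖ / 2 < ‖x‖ by linarith)
    have h2 := continuous_norm.continuousAt.eventually_lt_const (show ‖x‖ < 2 * ‖x‖ by linarith)
    filter_upwards [h1, h2] with z hz1 hz2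
    exact Eventually.of_forall fun y => hle z hz1.le hz2.le y
  · refine Eventually.of_forall fun y => ContinuousAt.mul continuousAt_const ?_
    exact hf.1.continuous.continuousAt.comp (continuous_const_smul _).continuousAt

/-! ### The test bumps -/

theorem hasCompactSupport_prod_lineBump (n : ℕ) :
    HasCompactSupport fun x : E n => ∏ i, ((lineBump (x i) : ℝ) : ℂ) := by
  have hK : IsCompact
      ((EuclideanSpace.equiv (Fin n) ℝ).symm '' Set.Icc (fun _ => (-2 : ℝ)) (fun _ => 2)) :=
    isCompact_Icc.image (EuclideanSpace.equiv (Fin n) ℝ).symm.continuous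
  refine HasCompactSupport.of_support_subset_isCompact hK fun x hx => ?_
  have hb : ∀ i, |x i| < 2 := by
    by_contra! hcon
    obtain ⟨i, hi⟩ := hcon
    exact hx (Finset.prod_eq_zero (Finset.mem_univ i) (by simp [lineBump_eq_zero hi]))
  exact ⟨EuclideanSpace.equiv (Fin n) ℝ x, ⟨fun i => (abs_lt.mp (hb i)).1.le,
    fun i => (abs_lt.mp (hb i)).2.le⟩, by simp⟩

/-- A smooth bump with support in the cube `|x|_∞ ≤ 2`. -/
def boxBump (n : ℕ) : 𝓢(E n, ℂ) :=
  HasCompactSupport.toSchwartzMap (f := fun x : E n => ∏ i, ((lineBump (x i) : ℝ) : ℂ))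
    (hasCompactSupport_prod_lineBump n) (by
      refine contDiff_prod fun i _ => Complex.ofRealCLM.contDiff.comp ?_
      exact lineBump.contDiff.comp (EuclideanSpace.proj (𝕜 := ℝ) i).contDiff)

theorem boxBump_apply (n : ℕ) (x : E n) : boxBump n x = ∏ i, ((lineBump (x i) : ℝ) : ℂ) := rfl

/-- The bump moved to the point `R e₀`. -/
def bumpAt (m : ℕ) (R : ℝ) : 𝓢(E (m + 1), ℂ) :=
  compSubConstCLM ℂ (EuclideanSpace.single 0 R) (boxBump (m + 1))

theorem bumpAt_apply (m : ℕ) (R : ℝ) (x : E (m + 1)) :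
    bumpAt m R x = ((lineBump (x 0 - R) : ℝ) : ℂ) * ∏ i : Fin m, ((lineBump (x i.succ) : ℝ) : ℂ) := by
  rw [bumpAt, compSubConstCLM_apply, boxBump_apply, Fin.prod_univ_succ]
  simp

theorem bumpAt_mem_testFunctions (m : ℕ) {R : ℝ} (hR : 4 ≤ R) :
    (bumpAt m R : E (m + 1) → ℂ) ∈ testFunctions (m + 1) := by
  refine ⟨(bumpAt m R).smooth ⊤, ?_, ?_⟩
  · exact (hasCompactSupport_prod_lineBump (m + 1)).comp_homeomorph
      (Homeomorph.subRight (EuclideanSpace.single 0 R))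
  · rw [notMem_tsupport_iff_eventuallyEq]
    have hc : ContinuousAt (fun x : E (m + 1) => |x 0|) 0 := by fun_prop
    filter_upwards [hc.eventually_lt_const (show |(0 : E (m + 1)) 0| < 1 by simp)] with x hx
    rw [bumpAt_apply, lineBump_eq_zero]
    · simp
    · rw [abs_sub_comm, le_abs]
      left
      linarith [le_abs_self (x 0)]

/-- When the first factor is nonzero, `c a R ≤ c x₀ < R + 2 ≤ 2 R`, hence `c a / 2 ≤ 1` and the
transverse factors all equal `1`. On this box the bump thus depends on `x₀` only. -/
theorem bumpAt_smul_eq {m : ℕ} {R a c : ℝ} (hR : 4 ≤ R) {x : E (m + 1)}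
    (hx0 : a * R ≤ x 0) (hx : ∀ i : Fin m, |x i.succ| ≤ a / 2) (hc : 0 ≤ c) :
    bumpAt m R (c • x) = ((lineBump (x 0 * c - R) : ℝ) : ℂ) := by
  rw [bumpAt_apply]
  by_cases h : lineBump (x 0 * c - R) = 0
  · simp [mul_comm c, h]
  have h2 : |x 0 * c - R| < 2 := by
    by_contra hc
    exact h (lineBump_eq_zero (not_lt.1 hc))
  have h3 : c * (a / 2) ≤ 1 := by
    have h4 : x 0 * c < R + 2 := by linarith [(abs_lt.1 h2).2]
    have h5 : a * R * c ≤ x 0 * c := by gcongr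
    by_contra hlt
    have : R * 1 < R * (c * (a / 2)) := by
      have : 0 < R := by linarith
      gcongr
      exact not_le.1 hlt
    nlinarith
  have h4 : ∀ i : Fin m, lineBump ((c • x) i.succ) = 1 := fun i => by
    refine lineBump_eq_one ?_
    rw [PiLp.smul_apply, smul_eq_mul, abs_mul, abs_of_nonneg hc]
    exact (mul_le_mul_of_nonneg_left (hx i) hc).trans h3
  rw [Finset.prod_congr rfl fun i _ => by rw [h4 i]]
  simp [mul_comm c]

theorem hausdorff_bumpAt {m : ℕ} {Φ : E (m + 1) → ℂ} {R a : ℝ} (hR : 4 ≤ R)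
    {x : E (m + 1)} (hx0 : a * R ≤ x 0) (hx : ∀ i : Fin m, |x i.succ| ≤ a / 2) :
    hausdorff Φ (bumpAt m R) x = ∫ y, Φ y * ((lineBump (x 0 * ‖y‖⁻¹ - R) : ℝ) : ℂ) := by
  unfold hausdorff
  congr 1 with y
  rw [bumpAt_smul_eq hR hx0 hx (by positivity)]

theorem integrable_mul_lineBump {m : ℕ} {Φ : E (m + 1) → ℂ}
    (hΦ : LocallyIntegrableOn Φ {0}ᶜ volume) {R t : ℝ} (hR : 4 ≤ R) (ht : 0 < t) :
    Integrable fun y => Φ y * ((lineBump (t * ‖y‖⁻¹ - R) : ℝ) : ℂ) := by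
  have hx : (EuclideanSpace.single 0 t : E (m + 1)) ≠ 0 := by simp [ht.ne']
  refine (integrable_integrand hΦ (bumpAt_mem_testFunctions m hR) hx).congr
    (Eventually.of_forall fun y => ?_)
  have hR0 : 0 < R := by linarith
  have := bumpAt_smul_eq (m := m) (R := R) (a := t / R) (c := ‖y‖⁻¹) hR
    (x := EuclideanSpace.single 0 t) (by simp [hR0.ne']) (by intro i; simp; positivity)
    (by positivity)
  simp only [this]
  simp

theorem profile_eq_integral_radialDensity {m : ℕ} {Φ : E (m + 1) → ℂ}
    (hΦ : LocallyIntegrableOn Φ {0}ᶜ volume) {R t : ℝ} (hR : 4 ≤ R) (ht : 0 < t) :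
    ∫ y, Φ y * ((lineBump (t * ‖y‖⁻¹ - R) : ℝ) : ℂ) =
      ∫ r in Ioi (0 : ℝ), radialDensity Φ r * ((lineBump (t * r⁻¹ - R) : ℝ) : ℂ) :=
  (polar_integrable_and_integral (h := fun r => ((lineBump (t * r⁻¹ - R) : ℝ) : ℂ))
    (integrable_mul_lineBump hΦ hR ht)).2

/-- Apply polar coordinates to `Φ` cut off to the annulus `a ≤ |y| ≤ b`, which is compact and avoids
the origin. -/
theorem integrableOn_radialDensity {n : ℕ} [Nontrivial (E n)] {Φ : E n → ℂ}
    (hΦ : LocallyIntegrableOn Φ {0}ᶜ volume) {a b : ℝ} (ha : 0 < a) :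
    IntegrableOn (radialDensity Φ) (Icc a b) := by
  set S : Set (E n) := {y | a ≤ ‖y‖ ∧ ‖y‖ ≤ b}
  have hSc : IsClosed S :=
    (isClosed_le continuous_const continuous_norm).inter
      (isClosed_le continuous_norm continuous_const)
  have hSk : IsCompact S :=
    (isCompact_closedBall (0 : E n) b).of_isClosed_subset hSc fun y hy => by simpa using hy.2
  have hS0 : S ⊆ {0}ᶜ := by
    rintro y hy rfl
    have := hy.1
    rw [norm_zero] at this
    linarith
  have hΦS : IntegrableOn Φ S := (hΦ.mono_set hS0).integrableOn_isCompact hSk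
  have hi : Integrable fun y => Φ y * (Icc a b).indicator (fun _ => (1 : ℂ)) ‖y‖ := by
    refine ((integrable_indicator_iff hSc.measurableSet).2 hΦS).congr
      (Eventually.of_forall fun y => ?_)
    by_cases hy : y ∈ S
    · have : ‖y‖ ∈ Icc a b := hy
      simp [hy, this]
    · have : ‖y‖ ∉ Icc a b := hy
      simp [hy, this]
  have h := (polar_integrable_and_integral hi).1
  have h2 : IntegrableOn (fun r => radialDensity Φ r * (Icc a b).indicator (fun _ => (1 : ℂ)) r)
      (Icc a b) := h.mono_set fun r hr => ha.trans_le hr.1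
  refine h2.congr_fun (fun r hr => ?_) measurableSet_Icc
  simp [hr]

/-! ### The scaling argument: uniformly bounded images of the bumps force the operator to vanish. -/

theorem lintegral_prod_box {m : ℕ} (F : ℝ → ℝ≥0∞) (hF : AEMeasurable F) (c : ℝ) :
    ∫⁻ x : E (m + 1), F (x 0) * {z : E (m + 1) | ∀ i : Fin m, |z i.succ| ≤ c}.indicator 1 x =
      (∫⁻ t, F t) * volume {z : Fin m → ℝ | ∀ i, |z i| ≤ c} := by
  have h1 := (EuclideanSpace.volume_preserving_symm_measurableEquiv_toLp (Fin (m + 1)))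
  have h2 := volume_preserving_piFinSuccAbove (fun _ : Fin (m + 1) => ℝ) 0
  have hS : MeasurableSet {z : Fin m → ℝ | ∀ i, |z i| ≤ c} := by
    have : {z : Fin m → ℝ | ∀ i, |z i| ≤ c} = ⋂ i, {z | |z i| ≤ c} := by ext; simp
    rw [this]
    exact MeasurableSet.iInter fun i => measurableSet_le (by fun_prop) measurable_const
  have h3 := lintegral_prod_mul (μ := (volume : Measure ℝ)) (ν := (volume : Measure (Fin m → ℝ)))
    hF (g := {z : Fin m → ℝ | ∀ i, |z i| ≤ c}.indicator 1)
    ((measurable_one.indicator hS).aemeasurable)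
  rw [lintegral_indicator_one hS] at h3
  rw [← h3]
  have h4 := (h2.comp h1).lintegral_comp_emb
    ((MeasurableEquiv.measurableEmbedding _).comp (MeasurableEquiv.measurableEmbedding _))
    (fun z : ℝ × (Fin m → ℝ) => F z.1 * {z : Fin m → ℝ | ∀ i, |z i| ≤ c}.indicator 1 z.2)
  refine Eq.trans ?_ h4
  rfl

/-- On the box `a N < x₀ < b N`, `|x_i| ≤ a / 2` the image of the bump is a function of `x₀` alone.
Tonelli, `x₀ = N s` and `K_N(s) = N H_Φ f(N s e₀)` turn the bound into `V ∫ |K_N|^p ≤ N^{p-1} C^p`,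
which tends to `0`. -/
theorem isZeroOperator_of_bumpAt_bounded {m : ℕ} {p : ℝ} (hp0 : 0 < p) (hp1 : p < 1)
    {Φ : E (m + 1) → ℂ} (hΦ : LocallyIntegrableOn Φ {0}ᶜ volume) {C : ℝ≥0∞} (hC : C ≠ ⊤)
    (h : ∀ N : ℕ, 4 ≤ N → eLpNorm (hausdorff Φ (bumpAt m N)) (ENNReal.ofReal p) volume ≤ C) :
    IsZeroOperator Φ := by
  refine isZeroOperator_of_radialDensity_ae_zero ?_
  suffices hab : ∀ k : ℕ, ∀ᵐ s ∂(volume.restrict (Ioo ((k + 1 : ℝ)⁻¹) (k + 1 : ℝ))),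
      radialDensity Φ s = 0 by
    have hU : Ioi (0 : ℝ) = ⋃ k : ℕ, Ioo ((k + 1 : ℝ)⁻¹) (k + 1 : ℝ) := by
      ext s
      simp only [mem_Ioi, mem_iUnion, mem_Ioo]
      constructor
      · intro hs
        obtain ⟨k, hk⟩ := exists_nat_gt (max s s⁻¹)
        refine ⟨k, ?_, ?_⟩
        · rw [inv_lt_comm₀ (by positivity) hs]
          linarith [le_max_right s s⁻¹]
        · linarith [le_max_left s s⁻¹]
      · rintro ⟨k, hk, -⟩
        exact lt_trans (by positivity) hk
    rw [hU, ae_restrict_iUnion_iff]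
    exact hab
  intro k
  set a : ℝ := (k + 1 : ℝ)⁻¹
  set b : ℝ := (k + 1 : ℝ)
  have ha : 0 < a := by positivity
  -- For `s ∈ (a, b)` the kernel only sees `r ∈ [s/4, 4s]`, so truncating to `[a/4, 4b]` leaves the
  -- profile unchanged and makes the density integrable on the whole line.
  set g : ℝ → ℂ := (Icc (a / 4) (4 * b)).indicator (radialDensity Φ)
  have hg : Integrable g :=
    (integrable_indicator_iff measurableSet_Icc).2 (integrableOn_radialDensity hΦ (by positivity))
  set V : ℝ≥0∞ := volume {z : Fin m → ℝ | ∀ i, |z i| ≤ a / 2} with hV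
  set K : ℕ → ℝ → ℂ := fun N s =>
    (N : ℂ) * hausdorff Φ (bumpAt m N) (EuclideanSpace.single 0 (N * s)) with hKdef
  have hKeq : ∀ N : ℕ, 4 ≤ N → ∀ s, 0 < s → hausdorff Φ (bumpAt m N)
      (EuclideanSpace.single 0 (N * s)) =
      ∫ y, Φ y * ((lineBump (N * s * ‖y‖⁻¹ - N) : ℝ) : ℂ) := by
    intro N hN s hs
    have hN4 : (4 : ℝ) ≤ N := by exact_mod_cast hN
    have := hausdorff_bumpAt (Φ := Φ) (a := s) (x := EuclideanSpace.single 0 (N * s)) hN4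
      (by simp [mul_comm]) (by intro i; simp; positivity)
    simpa using this
  have hcont : ∀ N : ℕ, 4 ≤ N → ContinuousOn (K N) (Ioi 0) := by
    intro N hN s hs
    have hN4 : (4 : ℝ) ≤ N := by exact_mod_cast hN
    refine ContinuousAt.continuousWithinAt (ContinuousAt.mul continuousAt_const ?_)
    have hne : (EuclideanSpace.single 0 (N * s) : E (m + 1)) ≠ 0 := by
      have : (0 : ℝ) < N * s := mul_pos (by linarith) hs
      simpa using this.ne'
    refine ContinuousAt.comp (f := fun s : ℝ => (EuclideanSpace.single 0 (N * s) : E (m + 1)))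
      (continuousAt_hausdorff hΦ (bumpAt_mem_testFunctions m hN4) hne) ?_
    have : (fun s : ℝ => (EuclideanSpace.single 0 (N * s) : E (m + 1))) =
        fun s : ℝ => ((N : ℝ) * s) • (EuclideanSpace.single 0 1 : E (m + 1)) := by
      ext s i
      simp
    rw [this]
    fun_prop
  have hsubset : Ioo a b ⊆ Ioi 0 := fun s hs => ha.trans hs.1
  -- The exponent `p - 1` combines `N^p`, from the factor `N` in `K N`, with `N⁻¹`, from the
  -- substitution `t = N s`.
  have hbound : ∀ N : ℕ, 4 ≤ N → V * ∫⁻ s in Ioo a b, ‖K N s‖ₑ ^ p ≤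
      ENNReal.ofReal ((N : ℝ) ^ (p - 1)) * C ^ p := by
    intro N hN
    have hN4 : (4 : ℝ) ≤ N := by exact_mod_cast hN
    have hN0 : (0 : ℝ) < N := by linarith
    set F : ℝ → ℝ≥0∞ := fun t => (Ioo (a * N) (b * N)).indicator (fun t =>
      ‖hausdorff Φ (bumpAt m N) (EuclideanSpace.single 0 t)‖ₑ ^ p) t with hF
    have hFcomp : ∀ s, F (N * s) = (Ioo a b).indicator (fun s =>
        ‖hausdorff Φ (bumpAt m N) (EuclideanSpace.single 0 (N * s))‖ₑ ^ p) s := by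
      intro s
      have hiff : (N * s ∈ Ioo (a * N) (b * N)) ↔ s ∈ Ioo a b := by
        rw [mem_Ioo, mem_Ioo, mul_comm a, mul_comm b, mul_lt_mul_iff_right₀ hN0,
          mul_lt_mul_iff_right₀ hN0]
      simp only [hF, indicator, hiff]
    have hKF : ∀ s ∈ Ioo a b, ‖K N s‖ₑ ^ p = ENNReal.ofReal ((N : ℝ) ^ p) * F (N * s) := by
      intro s hs
      rw [hFcomp, indicator_of_mem hs]
      simp only [hKdef]
      rw [enorm_mul, ENNReal.mul_rpow_of_nonneg _ _ hp0.le, ← ofReal_norm (N : ℂ),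
        Complex.norm_natCast, ENNReal.ofReal_rpow_of_pos hN0]
    -- Measurability is known for `K N` through its continuity, and is carried over to `F` by the
    -- dilation `t ↦ t / N`, which preserves null sets.
    have hFm : AEMeasurable F := by
      have hFm1 : AEMeasurable (fun s => F (N * s)) := by
        refine AEMeasurable.congr (f := (Ioo a b).indicator fun s =>
          ENNReal.ofReal ((N : ℝ) ^ p)⁻¹ * ‖K N s‖ₑ ^ p) ?_ (Eventually.of_forall fun s => ?_)
        · rw [aemeasurable_indicator_iff measurableSet_Ioo]
          exact ((((hcont N hN).mono hsubset).aestronglyMeasurable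
            measurableSet_Ioo).enorm.pow_const p).const_mul _
        · by_cases hs : s ∈ Ioo a b
          · have hpos : (0 : ℝ) < (N : ℝ) ^ p := by positivity
            rw [indicator_of_mem hs, hKF s hs, ← mul_assoc, ← ENNReal.ofReal_mul (by positivity),
              inv_mul_cancel₀ hpos.ne', ENNReal.ofReal_one, one_mul]
          · simp only [hFcomp, indicator_of_notMem hs]
      have hq : Measure.QuasiMeasurePreserving (fun t : ℝ => (N : ℝ)⁻¹ * t) volume volume := by
        refine ⟨by fun_prop, ?_⟩
        rw [Real.map_volume_mul_left (by positivity)]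
        exact Measure.smul_absolutelyContinuous
      have := hFm1.comp_quasiMeasurePreserving hq
      refine this.congr (Eventually.of_forall fun t => ?_)
      simp [hN0.ne']
    have hscale : ∫⁻ s, F (N * s) = ENNReal.ofReal ((N : ℝ)⁻¹) * ∫⁻ t, F t := by
      have hmap := Real.map_volume_mul_left hN0.ne'
      have : ∫⁻ s, F (N * s) = ∫⁻ t, F t ∂(Measure.map (fun s : ℝ => (N : ℝ) * s) volume) := by
        exact ((Homeomorph.mulLeft₀ (N : ℝ) hN0.ne').measurableEmbedding.lintegral_map F).symm
      rw [this, hmap, lintegral_smul_measure, abs_of_pos (by positivity), smul_eq_mul]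
    have hbox : (∫⁻ t, F t) * V ≤ C ^ p := by
      rw [hV, ← lintegral_prod_box F hFm (a / 2)]
      refine le_trans (lintegral_mono fun x => ?_)
        (show ∫⁻ x, ‖hausdorff Φ (bumpAt m N) x‖ₑ ^ p ≤ C ^ p from ?_)
      · by_cases hx : x ∈ {z : E (m + 1) | ∀ i : Fin m, |z i.succ| ≤ a / 2}
        · by_cases hx0 : x 0 ∈ Ioo (a * N) (b * N)
          · have e1 := hausdorff_bumpAt (Φ := Φ) hN4 hx0.1.le hx
            have e2 := hausdorff_bumpAt (Φ := Φ) (x := EuclideanSpace.single 0 (x 0)) hN4 (a := a)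
              (by simpa using hx0.1.le) (by intro i; simp; positivity)
            simp only [PiLp.single_apply, if_true] at e2
            simp only [hF, indicator_of_mem hx, indicator_of_mem hx0, Pi.one_apply, mul_one]
            rw [e1, e2]
          · simp only [hF, indicator_of_notMem hx0, zero_mul, zero_le]
        · simp only [indicator_of_notMem hx, mul_zero, zero_le]
      · have h1 := h N hN
        rw [eLpNorm_eq_lintegral_rpow_enorm_toReal (by simpa using hp0) (by simp),
          ENNReal.toReal_ofReal hp0.le] at h1
        have := ENNReal.rpow_le_rpow h1 hp0.le
        rwa [← ENNReal.rpow_mul, one_div, inv_mul_cancel₀ hp0.ne', ENNReal.rpow_one] at this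
    have hint : ∫⁻ s in Ioo a b, ‖K N s‖ₑ ^ p =
        ENNReal.ofReal ((N : ℝ) ^ (p - 1)) * ∫⁻ t, F t := by
      rw [setLIntegral_congr_fun measurableSet_Ioo hKF, lintegral_const_mul' _ _ (by simp)]
      have : ∫⁻ s in Ioo a b, F (N * s) = ∫⁻ s, F (N * s) := by
        rw [← lintegral_indicator measurableSet_Ioo]
        congr 1 with s
        by_cases hs : s ∈ Ioo a b
        · simp [hs]
        · rw [indicator_of_notMem hs, hFcomp, indicator_of_notMem hs]
      rw [this, hscale, ← mul_assoc, ← ENNReal.ofReal_mul (by positivity),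
        Real.rpow_sub_one hN0.ne', div_eq_mul_inv]
    rw [hint, mul_left_comm, mul_comm V]
    gcongr
  have hVeq : V = ENNReal.ofReal a ^ m := by
    have : {z : Fin m → ℝ | ∀ i, |z i| ≤ a / 2} =
        Icc (fun _ => -(a / 2)) (fun _ => a / 2) := by
      ext z
      simp only [mem_ofPred_eq, mem_Icc, Pi.le_def, abs_le, forall_and]
    rw [hV, this, Real.volume_Icc_pi]
    simp
  have hVpos : V ≠ 0 := by
    rw [hVeq]
    exact pow_ne_zero _ (by simpa using ha)
  have hVtop : V ≠ ⊤ := by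
    rw [hVeq]
    exact ENNReal.pow_ne_top ENNReal.ofReal_ne_top
  -- For `N < 4` the bump may touch the origin and nothing is known about its image; the value `0`
  -- there does not affect the limit.
  have key := ae_zero_of_profile_small (K := fun N => if 4 ≤ N then K N else 0)
    hg.locallyIntegrable (b := b) ha hp0 ?_ ?_ ?_
  · filter_upwards [key, ae_restrict_mem measurableSet_Ioo] with s hs hsm
    have : s ∈ Icc (a / 4) (4 * b) := ⟨by linarith [hsm.1], by linarith [hsm.1, hsm.2]⟩
    simpa [g, this] using hs
  · intro N hN s hs
    have hN4 : (4 : ℝ) ≤ N := by exact_mod_cast hN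
    have hs0 : 0 < s := ha.trans hs.1
    simp only [hN, if_true, hKdef]
    rw [hKeq N hN s hs0, profile_eq_integral_radialDensity hΦ hN4 (by positivity)]
    congr 1
    rw [← integral_indicator measurableSet_Ioi]
    congr 1 with r
    by_cases hz : lineBump (N * s * r⁻¹ - N) = 0
    · simp [hz, indicator]
    · obtain ⟨hr, -, hr2, hr3⟩ := lineBump_support hs0 hN4 hz
      rw [indicator_of_mem (show r ∈ Ioi (0 : ℝ) from hr)]
      have hrI : r ∈ Icc (a / 4) (4 * b) := ⟨by linarith [hs.1], by linarith [hs.2]⟩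
      simp only [g, indicator_of_mem hrI]
  · intro N
    split_ifs with hN
    · exact ((hcont N hN).mono hsubset).aestronglyMeasurable measurableSet_Ioo
    · exact aestronglyMeasurable_zero
  · have hlim : Tendsto (fun N : ℕ => V⁻¹ * (ENNReal.ofReal ((N : ℝ) ^ (p - 1)) * C ^ p)) atTop
        (𝓝 0) := by
      have h1 : Tendsto (fun N : ℕ => ENNReal.ofReal ((N : ℝ) ^ (p - 1))) atTop (𝓝 0) := by
        have := (tendsto_rpow_neg_atTop (show 0 < 1 - p by linarith)).comp
          tendsto_natCast_atTop_atTop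
        rw [← ENNReal.ofReal_zero]
        refine ENNReal.tendsto_ofReal (this.congr fun N => ?_)
        simp
      have h2 := ENNReal.Tendsto.const_mul (a := V⁻¹) (ENNReal.Tendsto.mul_const (b := C ^ p) h1
        (Or.inr (ENNReal.rpow_ne_top_of_nonneg hp0.le hC))) (Or.inr (ENNReal.inv_ne_top.2 hVpos))
      simpa using h2
    refine tendsto_of_tendsto_of_tendsto_of_le_of_le' tendsto_const_nhds hlim
      (Eventually.of_forall fun _ => zero_le) ?_
    filter_upwards [eventually_ge_atTop 4] with N hN
    simp only [hN, if_true]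
    have := hbound N hN
    rw [mul_comm V, ← ENNReal.le_div_iff_mul_le (Or.inl hVpos) (Or.inl hVtop),
      ENNReal.div_eq_inv_mul] at this
    exact this

/-! ### Decay of Schwartz functions -/

theorem exists_decay_iteratedFDeriv {n : ℕ} (ψ : 𝓢(E n, ℂ)) (k l : ℕ) :
    ∃ C, 0 ≤ C ∧ ∀ x, (1 + ‖x‖) ^ k * ‖iteratedFDeriv ℝ l ψ x‖ ≤ C :=
  ⟨_, by positivity, fun x => one_add_le_sup_seminorm_apply (𝕜 := ℂ) (m := (k, l)) le_rfl le_rfl ψ x⟩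

theorem exists_decay {n : ℕ} (ψ : 𝓢(E n, ℂ)) (k : ℕ) :
    ∃ C, 0 ≤ C ∧ ∀ x, (1 + ‖x‖) ^ k * ‖ψ x‖ ≤ C := by
  obtain ⟨C, hC, h⟩ := exists_decay_iteratedFDeriv ψ k 0
  exact ⟨C, hC, fun x => by simpa using h x⟩

theorem integrable_one_add_norm_pow_mul {n : ℕ} (ψ : 𝓢(E n, ℂ)) (k : ℕ) :
    Integrable fun x => (1 + ‖x‖) ^ k * ‖ψ x‖ := by
  have h : ∀ x : E n, (1 + ‖x‖) ^ k * ‖ψ x‖ =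
      ∑ i ∈ Finset.range (k + 1), (k.choose i : ℝ) * (‖x‖ ^ i * ‖ψ x‖) := by
    intro x
    rw [add_comm, add_pow, Finset.sum_mul]
    refine Finset.sum_congr rfl fun i _ => ?_
    rw [one_pow]
    ring
  simp only [h]
  exact integrable_finsetSum _ fun i _ => (ψ.integrable_pow_mul volume i).const_mul _

/-- Peetre's inequality: polynomial weights are moved between a point and its translate at the cost
of the weight of the shift. -/
theorem one_add_norm_le_mul {n : ℕ} (x y : E n) : 1 + ‖y‖ ≤ (1 + ‖x‖) * (1 + ‖x - y‖) := by
  have : ‖y‖ ≤ ‖x‖ + ‖x - y‖ := by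
    have := norm_sub_le x (x - y)
    simpa using this
  nlinarith [norm_nonneg x, norm_nonneg (x - y)]

/-! ### Translations in the Schwartz space -/

theorem norm_iteratedFDeriv_reflectAt {n : ℕ} (ψ : 𝓢(E n, ℂ)) (l : ℕ) (x y : E n) :
    ‖iteratedFDeriv ℝ l (reflectAt ψ x) y‖ = ‖iteratedFDeriv ℝ l ψ (x - y)‖ := by
  have h : (reflectAt ψ x : E n → ℂ) = fun y => (ψ ∘ LinearIsometryEquiv.neg ℝ) (y - x) := by
    ext y
    simp [reflectAt_apply]
  rw [h, iteratedFDeriv_comp_sub, LinearIsometryEquiv.norm_iteratedFDeriv_comp_right]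
  simp

theorem exists_seminorm_reflectAt_le {n : ℕ} (ψ : 𝓢(E n, ℂ)) (k l : ℕ) :
    ∃ C, 0 ≤ C ∧ ∀ x, SchwartzMap.seminorm ℂ k l (reflectAt ψ x) ≤ C * (1 + ‖x‖) ^ k := by
  obtain ⟨C, hC, h⟩ := exists_decay_iteratedFDeriv ψ k l
  refine ⟨C, hC, fun x => seminorm_le_bound ℂ k l _ (by positivity) fun y => ?_⟩
  rw [norm_iteratedFDeriv_reflectAt]
  have h1 : ‖y‖ ≤ (1 + ‖x‖) * (1 + ‖x - y‖) := by linarith [one_add_norm_le_mul x y]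
  calc ‖y‖ ^ k * ‖iteratedFDeriv ℝ l ψ (x - y)‖
      ≤ ((1 + ‖x‖) * (1 + ‖x - y‖)) ^ k * ‖iteratedFDeriv ℝ l ψ (x - y)‖ := by gcongr
    _ = (1 + ‖x‖) ^ k * ((1 + ‖x - y‖) ^ k * ‖iteratedFDeriv ℝ l ψ (x - y)‖) := by
        rw [mul_pow]; ring
    _ ≤ (1 + ‖x‖) ^ k * C := by gcongr; exact h _
    _ = _ := mul_comm _ _

/-- Mean value inequality on the unit ball about `z`, where the weight varies by a factor at most
`2`. -/
theorem exists_norm_iteratedFDeriv_sub_le {n : ℕ} (ψ : 𝓢(E n, ℂ)) (k l : ℕ) :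
    ∃ C, 0 ≤ C ∧ ∀ z w : E n, ‖w - z‖ ≤ 1 →
      (1 + ‖z‖) ^ k * ‖iteratedFDeriv ℝ l ψ w - iteratedFDeriv ℝ l ψ z‖ ≤ C * ‖w - z‖ := by
  obtain ⟨C, hC, h⟩ := exists_decay_iteratedFDeriv ψ k (l + 1)
  refine ⟨2 ^ k * C, by positivity, fun z w hzw => ?_⟩
  have hb : ∀ v ∈ Metric.closedBall z 1,
      ‖fderiv ℝ (iteratedFDeriv ℝ l ψ) v‖ ≤ 2 ^ k * C / (1 + ‖z‖) ^ k := by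
    intro v hv
    rw [norm_fderiv_iteratedFDeriv, le_div_iff₀ (by positivity)]
    have h1 : 1 + ‖z‖ ≤ 2 * (1 + ‖v‖) := by
      have h2 := one_add_norm_le_mul v z
      have h3 : ‖v - z‖ ≤ 1 := by simpa [dist_eq_norm] using hv
      nlinarith [norm_nonneg v]
    calc ‖iteratedFDeriv ℝ (l + 1) ψ v‖ * (1 + ‖z‖) ^ k
        ≤ ‖iteratedFDeriv ℝ (l + 1) ψ v‖ * (2 * (1 + ‖v‖)) ^ k := by gcongr
      _ = 2 ^ k * ((1 + ‖v‖) ^ k * ‖iteratedFDeriv ℝ (l + 1) ψ v‖) := by rw [mul_pow]; ring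
      _ ≤ 2 ^ k * C := by gcongr; exact h v
  have hd : ∀ v ∈ Metric.closedBall z 1, DifferentiableAt ℝ (iteratedFDeriv ℝ l ψ) v := fun v _ =>
    (ψ.smooth ⊤).contDiffAt.differentiableAt_iteratedFDeriv (by exact_mod_cast WithTop.coe_lt_top l)
  have hmv := (convex_closedBall z 1).norm_image_sub_le_of_norm_fderiv_le hd hb
    (Metric.mem_closedBall_self zero_le_one) (show w ∈ Metric.closedBall z 1 by
      simpa [dist_eq_norm] using hzw)
  calc (1 + ‖z‖) ^ k * ‖iteratedFDeriv ℝ l ψ w - iteratedFDeriv ℝ l ψ z‖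
      ≤ (1 + ‖z‖) ^ k * (2 ^ k * C / (1 + ‖z‖) ^ k * ‖w - z‖) := by gcongr
    _ = 2 ^ k * C * ‖w - z‖ := by
        have : (1 + ‖z‖) ^ k ≠ 0 := by positivity
        field_simp

/-- Translations act continuously on `𝓢`. Hence convolutions with a distribution are continuous
functions, and integrals of translates have measurable integrands. -/
theorem continuous_reflectAt {n : ℕ} (ψ : 𝓢(E n, ℂ)) : Continuous (reflectAt ψ) := by
  rw [continuous_iff_continuousAt]
  intro x₀
  rw [ContinuousAt, (schwartz_withSeminorms ℂ (E n) ℂ).tendsto_nhds]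
  rintro ⟨k, l⟩ ε hε
  set ψ' : 𝓢(E n, ℂ) := compCLMOfContinuousLinearEquiv ℂ (ContinuousLinearEquiv.neg ℝ (M := E n)) ψ
  obtain ⟨C, hC, h⟩ := exists_norm_iteratedFDeriv_sub_le ψ' k l
  set A := (1 + ‖x₀‖) ^ k * C
  have hA : 0 ≤ A := by positivity
  have hδ : 0 < min 1 (ε / (A + 1)) := by positivity
  filter_upwards [Metric.ball_mem_nhds x₀ hδ] with x hx
  have hx1 : ‖x - x₀‖ < min 1 (ε / (A + 1)) := by simpa [dist_eq_norm] using hx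
  have hle : SchwartzMap.seminorm ℂ k l (reflectAt ψ x - reflectAt ψ x₀) ≤ A * ‖x - x₀‖ := by
    refine seminorm_le_bound ℂ k l _ (by positivity) fun y => ?_
    have hd : iteratedFDeriv ℝ l (reflectAt ψ x - reflectAt ψ x₀ : 𝓢(E n, ℂ)) y =
        iteratedFDeriv ℝ l ψ' (y - x) - iteratedFDeriv ℝ l ψ' (y - x₀) := by
      have e : ∀ z, (reflectAt ψ z : E n → ℂ) = fun y => ψ' (y - z) := fun z => rfl
      have : ((reflectAt ψ x - reflectAt ψ x₀ : 𝓢(E n, ℂ)) : E n → ℂ) =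
        (fun y => ψ' (y - x)) - fun y => ψ' (y - x₀) := rfl
      rw [this, iteratedFDeriv_sub_apply, iteratedFDeriv_comp_sub, iteratedFDeriv_comp_sub]
      · exact ((reflectAt ψ x).smooth l).contDiffAt
      · exact ((reflectAt ψ x₀).smooth l).contDiffAt
    rw [hd]
    have e1 : ‖(y - x) - (y - x₀)‖ = ‖x - x₀‖ := by
      rw [← norm_neg]; congr 1; abel
    have h1 := h (y - x₀) (y - x) (by rw [e1]; exact (hx1.trans_le (min_le_left _ _)).le)
    rw [e1] at h1
    have h2 : ‖y‖ ≤ (1 + ‖x₀‖) * (1 + ‖y - x₀‖) := by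
      rw [norm_sub_rev]; linarith [one_add_norm_le_mul x₀ y]
    calc ‖y‖ ^ k * ‖iteratedFDeriv ℝ l ψ' (y - x) - iteratedFDeriv ℝ l ψ' (y - x₀)‖
        ≤ ((1 + ‖x₀‖) * (1 + ‖y - x₀‖)) ^ k *
          ‖iteratedFDeriv ℝ l ψ' (y - x) - iteratedFDeriv ℝ l ψ' (y - x₀)‖ := by gcongr
      _ = (1 + ‖x₀‖) ^ k * ((1 + ‖y - x₀‖) ^ k *
          ‖iteratedFDeriv ℝ l ψ' (y - x) - iteratedFDeriv ℝ l ψ' (y - x₀)‖) := by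
          rw [mul_pow]; ring
      _ ≤ (1 + ‖x₀‖) ^ k * (C * ‖x - x₀‖) := by gcongr
      _ = A * ‖x - x₀‖ := by ring
  calc SchwartzMap.seminorm ℂ k l (reflectAt ψ x - reflectAt ψ x₀) ≤ A * ‖x - x₀‖ := hle
    _ ≤ A * (ε / (A + 1)) := by gcongr; exact (hx1.trans_le (min_le_right _ _)).le
    _ < ε := by
      rw [← mul_div_assoc, div_lt_iff₀ (by positivity)]
      nlinarith

/-! ### Convolution with a tempered distribution -/

theorem exists_bound_distribution {n : ℕ} (v : 𝓢'(E n, ℂ)) :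
    ∃ (s : Finset (ℕ × ℕ)) (C : ℝ), 0 ≤ C ∧ ∀ f : 𝓢(E n, ℂ),
      ‖v f‖ ≤ C * (s.sup (schwartzSeminormFamily ℂ (E n) ℂ)) f := by
  obtain ⟨s, C, -, h⟩ := Seminorm.bound_of_continuous (schwartz_withSeminorms ℂ (E n) ℂ)
    ((normSeminorm ℂ ℂ).comp (v : 𝓢(E n, ℂ) →ₗ[ℂ] ℂ)) (by
      exact continuous_norm.comp v.continuous)
  exact ⟨s, C, C.2, fun f => h f⟩

theorem exists_bound_distribution_sum {n : ℕ} (v : 𝓢'(E n, ℂ)) :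
    ∃ (s : Finset (ℕ × ℕ)) (C : ℝ), 0 ≤ C ∧ ∀ f : 𝓢(E n, ℂ),
      ‖v f‖ ≤ C * ∑ i ∈ s, SchwartzMap.seminorm ℂ i.1 i.2 f := by
  obtain ⟨s, C, hC, h⟩ := exists_bound_distribution v
  refine ⟨s, C, hC, fun f => (h f).trans ?_⟩
  gcongr
  have := Seminorm.finset_sup_le_sum (schwartzSeminormFamily ℂ (E n) ℂ) s f
  simpa only [FunLike.coe_sum, Finset.sum_apply, schwartzSeminormFamily] using this

theorem continuous_conv {n : ℕ} (ψ : 𝓢(E n, ℂ)) (v : 𝓢'(E n, ℂ)) : Continuous (conv ψ v) :=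
  v.continuous.comp (continuous_reflectAt ψ)

/-- The exponent depends only on the seminorms controlling `v`, not on `ψ`; this lets all frequency
pieces of `v` share one weight. -/
theorem exists_growth_conv {n : ℕ} (v : 𝓢'(E n, ℂ)) :
    ∃ N : ℕ, ∀ ψ : 𝓢(E n, ℂ), ∃ A, 0 ≤ A ∧ ∀ x, ‖conv ψ v x‖ ≤ A * (1 + ‖x‖) ^ N := by
  obtain ⟨s, C, hC, h⟩ := exists_bound_distribution_sum v
  refine ⟨s.sup Prod.fst, fun ψ => ?_⟩
  choose B hB0 hB using fun i : ℕ × ℕ => exists_seminorm_reflectAt_le ψ i.1 i.2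
  refine ⟨C * ∑ i ∈ s, B i, mul_nonneg hC (Finset.sum_nonneg fun i _ => hB0 i), fun x => ?_⟩
  refine (h _).trans ?_
  rw [mul_assoc, Finset.sum_mul]
  gcongr with i hi
  refine (hB i x).trans ?_
  have := hB0 i
  gcongr
  · linarith [norm_nonneg x]
  · exact Finset.le_sup (f := Prod.fst) hi

/-! ### Approximate identities -/

theorem approxId_apply {n : ℕ} (ψ : 𝓢(E n, ℂ)) {t : ℝ} (ht : 0 < t) (x : E n) :
    approxId ψ t ht x = (((t ^ n)⁻¹ : ℝ) : ℂ) * ψ (t⁻¹ • x) := rfl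

theorem norm_iteratedFDeriv_approxId {n : ℕ} (ψ : 𝓢(E n, ℂ)) {t : ℝ} (ht : 0 < t) (j : ℕ)
    (x : E n) : ‖iteratedFDeriv ℝ j (approxId ψ t ht) x‖ =
      (t ^ n)⁻¹ * ((t⁻¹) ^ j * ‖iteratedFDeriv ℝ j ψ (t⁻¹ • x)‖) := by
  have h : (approxId ψ t ht : E n → ℂ) = (((t ^ n)⁻¹ : ℝ) : ℂ) • fun x => ψ (t⁻¹ • x) := rfl
  have hs : ContDiff ℝ j fun x => ψ (t⁻¹ • x) := (ψ.smooth j).comp (contDiff_const_smul _)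
  rw [h, iteratedFDeriv_const_smul_apply hs.contDiffAt, norm_smul,
    iteratedFDeriv_comp_const_smul _ (ψ.smooth j), norm_smul, Complex.norm_real, norm_pow,
    Real.norm_of_nonneg (by positivity), Real.norm_of_nonneg (by positivity)]

/-- Differentiation and normalization cost `t^{-n-j}`, while Schwartz decay gains `(t / |z|)^A`;
with `A ≥ n + j + 1` one power of `t` survives. -/
theorem exists_norm_iteratedFDeriv_approxId_le {n : ℕ} (ψ : 𝓢(E n, ℂ)) (A j : ℕ)
    (hA : n + j + 1 ≤ A) : ∃ S, 0 ≤ S ∧ ∀ (t : ℝ) (ht : 0 < t), t ≤ 1 → ∀ z : E n, z ≠ 0 →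
      ‖iteratedFDeriv ℝ j (approxId ψ t ht) z‖ ≤ S * t * (‖z‖ ^ A)⁻¹ := by
  refine ⟨SchwartzMap.seminorm ℂ A j ψ, apply_nonneg _ _, fun t ht ht1 z hz => ?_⟩
  have h1 := le_seminorm ℂ A j ψ (t⁻¹ • z)
  rw [norm_smul, norm_inv, Real.norm_of_nonneg ht.le, mul_pow] at h1
  have hz0 : 0 < ‖z‖ := norm_pos_iff.2 hz
  rw [norm_iteratedFDeriv_approxId]
  set D := ‖iteratedFDeriv ℝ j ψ (t⁻¹ • z)‖
  set S := SchwartzMap.seminorm ℂ A j ψ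
  have hS : 0 ≤ S := apply_nonneg _ _
  have h2 : D ≤ S * t ^ A * (‖z‖ ^ A)⁻¹ := by
    rw [inv_pow] at h1
    have := mul_le_mul_of_nonneg_left h1 (show 0 ≤ t ^ A * (‖z‖ ^ A)⁻¹ by positivity)
    calc D = t ^ A * (‖z‖ ^ A)⁻¹ * ((t ^ A)⁻¹ * ‖z‖ ^ A * D) := by field_simp
      _ ≤ _ := this
      _ = _ := by ring
  have h3 : (t ^ n)⁻¹ * ((t⁻¹) ^ j * t ^ A) ≤ t := by
    obtain ⟨d, rfl⟩ := Nat.exists_eq_add_of_le hA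
    have : (t ^ n)⁻¹ * ((t⁻¹) ^ j * t ^ (n + j + 1 + d)) = t * t ^ d := by
      rw [pow_add, pow_add, pow_add, inv_pow]
      field_simp
    rw [this]
    exact mul_le_of_le_one_right ht.le (pow_le_one₀ ht.le ht1)
  calc (t ^ n)⁻¹ * ((t⁻¹) ^ j * D) ≤ (t ^ n)⁻¹ * ((t⁻¹) ^ j * (S * t ^ A * (‖z‖ ^ A)⁻¹)) := by gcongr
    _ = S * ((t ^ n)⁻¹ * ((t⁻¹) ^ j * t ^ A)) * (‖z‖ ^ A)⁻¹ := by ring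
    _ ≤ S * t * (‖z‖ ^ A)⁻¹ := by gcongr

/-- The part of `ψ_t(x₀ - ·)` away from `x₀` is `O(t)` in every Schwartz seminorm, hence invisible
to any tempered distribution in the limit. -/
theorem exists_seminorm_sub_smul_le {n : ℕ} (ψ χ : 𝓢(E n, ℂ)) (x₀ : E n) {ρ : ℝ} (hρ : 0 < ρ)
    (hχ : ∀ y ∈ Metric.ball x₀ ρ, χ y = 1) (k l : ℕ) :
    ∃ C, ∀ (t : ℝ) (ht : 0 < t), t ≤ 1 →
      SchwartzMap.seminorm ℂ k l (reflectAt (approxId ψ t ht) x₀ -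
        smulLeftCLM ℂ χ (reflectAt (approxId ψ t ht) x₀)) ≤ C * t := by
  -- `n + l + 1` powers of decay produce the factor `t` for all derivatives up to order `l`; the
  -- other `k` absorb the weight `|y|^k`.
  set A := n + l + 1 + k
  choose S hS0 hS using fun j : Fin (l + 1) =>
    exists_norm_iteratedFDeriv_approxId_le ψ A j (by omega)
  set T := ∑ j, S j
  have hT0 : 0 ≤ T := Finset.sum_nonneg fun j _ => hS0 j
  have hT : ∀ j ≤ l, ∀ (t : ℝ) (ht : 0 < t), t ≤ 1 → ∀ z : E n, z ≠ 0 →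
      ‖iteratedFDeriv ℝ j (approxId ψ t ht) z‖ ≤ T * t * (‖z‖ ^ A)⁻¹ := by
    intro j hj t ht ht1 z hz
    refine (hS ⟨j, by omega⟩ t ht ht1 z hz).trans ?_
    gcongr
    exact Finset.single_le_sum (f := S) (fun j _ => hS0 j) (Finset.mem_univ _)
  clear_value T
  set B := 1 + ∑ i ∈ Finset.range (l + 1), (l.choose i : ℝ) * SchwartzMap.seminorm ℂ 0 i χ
  have hB0 : 0 ≤ B := by positivity
  set M := (‖x₀‖ / ρ + 1) ^ k * (ρ ^ (n + l + 1))⁻¹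
  refine ⟨B * T * M, fun t ht ht1 => ?_⟩
  refine seminorm_le_bound ℂ k l _ (by positivity) fun y => ?_
  set F := reflectAt (approxId ψ t ht) x₀
  have hcoe : ((F - smulLeftCLM ℂ χ F : 𝓢(E n, ℂ)) : E n → ℂ) = ⇑F - fun y => χ y * F y := by
    ext z
    simp [smulLeftCLM_apply_apply χ.hasTemperateGrowth]
  by_cases hy : y ∈ Metric.ball x₀ ρ
  · have hz : iteratedFDeriv ℝ l (F - smulLeftCLM ℂ χ F : 𝓢(E n, ℂ)) y = 0 := by
      have hev : ((F - smulLeftCLM ℂ χ F : 𝓢(E n, ℂ)) : E n → ℂ) =ᶠ[𝓝 y] fun _ => 0 := by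
        filter_upwards [Metric.isOpen_ball.mem_nhds hy] with z hz
        rw [hcoe]
        simp [hχ z hz]
      rw [(hev.iteratedFDeriv ℝ l).eq_of_nhds]
      simp
    rw [hz]
    simp only [norm_zero, mul_zero]
    positivity
  · have hρy : ρ ≤ ‖x₀ - y‖ := by
      rw [norm_sub_rev]
      simpa [dist_eq_norm] using hy
    have hne : x₀ - y ≠ 0 := norm_pos_iff.1 (hρ.trans_le hρy)
    set q := ‖x₀ - y‖
    have hq : 0 < q := hρ.trans_le hρy
    have hF : ∀ j ≤ l, ‖iteratedFDeriv ℝ j F y‖ ≤ T * t * (q ^ A)⁻¹ := fun j hj => by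
      rw [norm_iteratedFDeriv_reflectAt]
      exact hT j hj t ht ht1 _ hne
    have hmain : ‖iteratedFDeriv ℝ l (F - smulLeftCLM ℂ χ F : 𝓢(E n, ℂ)) y‖ ≤
        B * (T * t * (q ^ A)⁻¹) := by
      rw [hcoe, iteratedFDeriv_sub_apply (F.smooth l).contDiffAt
        ((χ.smooth l).mul (F.smooth l)).contDiffAt]
      refine (norm_sub_le _ _).trans ?_
      rw [add_mul, one_mul, Finset.sum_mul]
      refine add_le_add (hF l le_rfl) ?_
      refine (norm_iteratedFDeriv_mul_le (χ.smooth l) (F.smooth l) y le_rfl).trans ?_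
      gcongr with i hi
      · exact norm_iteratedFDeriv_le_seminorm ℂ χ i y
      · exact hF _ (Nat.sub_le _ _)
    have hyk : ‖y‖ ^ k ≤ ((‖x₀‖ / ρ + 1) * q) ^ k := by
      gcongr
      have h1 : ‖y‖ ≤ ‖x₀‖ + q := by
        have := norm_sub_le x₀ (x₀ - y)
        simpa using this
      have h2 : ‖x₀‖ ≤ ‖x₀‖ / ρ * q := by
        rw [div_mul_eq_mul_div, le_div_iff₀ hρ]
        gcongr
      linarith
    calc ‖y‖ ^ k * ‖iteratedFDeriv ℝ l (F - smulLeftCLM ℂ χ F : 𝓢(E n, ℂ)) y‖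
        ≤ ((‖x₀‖ / ρ + 1) * q) ^ k * (B * (T * t * (q ^ A)⁻¹)) := by gcongr
      _ = B * T * ((‖x₀‖ / ρ + 1) ^ k * (q ^ (n + l + 1))⁻¹) * t := by
          simp only [A]
          rw [mul_pow, pow_add q (n + l + 1) k]
          field_simp
      _ ≤ B * T * M * t := by
          simp only [M]
          gcongr

/-- The distribution is known to be `g` only on compactly supported test functions, so `ψ_t(x₀ - ·)`
is split by a cutoff `χ` near `x₀`. The near part is a classical approximate identity acting on a
bounded function continuous at `x₀`; the far part tends to `0` in `𝓢`. -/
theorem tendsto_conv_approxId {n : ℕ} {g : E n → ℂ} {v : 𝓢'(E n, ℂ)} (hgv : Represents g v)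
    {x₀ : E n} (hg : ContinuousAt g x₀) (ψ : 𝓢(E n, ℂ)) {t : ℕ → ℝ} (ht : ∀ j, 0 < t j)
    (ht1 : ∀ j, t j ≤ 1) (hlim : Tendsto t atTop (𝓝 0)) :
    Tendsto (fun j => conv (approxId ψ (t j) (ht j)) v x₀) atTop (𝓝 ((∫ x, ψ x) * g x₀)) := by
  obtain ⟨δ, hδ, hball⟩ := Metric.mem_nhds_iff.1
    (hg.norm.eventually_lt_const (show ‖g x₀‖ < ‖g x₀‖ + 1 by linarith))
  let b : ContDiffBump x₀ := ⟨δ / 4, δ / 2, by positivity, by linarith⟩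
  have hbc : HasCompactSupport fun y => (b y : ℂ) :=
    b.hasCompactSupport.comp_left (g := fun r : ℝ => (r : ℂ)) Complex.ofReal_zero
  set χ : 𝓢(E n, ℂ) := hbc.toSchwartzMap (Complex.ofRealCLM.contDiff.comp b.contDiff)
  have hχ : ∀ y, χ y = (b y : ℂ) := fun y => rfl
  set G : E n → ℂ := fun y => g y * χ y with hG
  have hGi : Integrable G := by
    have := hgv.1.integrable_smul_left_of_hasCompactSupport χ.continuous hbc
    refine this.congr (Eventually.of_forall fun y => ?_)
    simp [hG, mul_comm]
  have hGb : ∀ y, ‖G y‖ ≤ ‖g x₀‖ + 1 := by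
    intro y
    by_cases hy : y ∈ Metric.ball x₀ δ
    · have h1 : ‖g y‖ < ‖g x₀‖ + 1 := hball hy
      have h2 : ‖χ y‖ ≤ 1 := by
        rw [hχ, Complex.norm_real, Real.norm_of_nonneg b.nonneg]; exact b.le_one
      simp only [hG, norm_mul]
      nlinarith [norm_nonneg (g y), norm_nonneg (χ y)]
    · have : b y = 0 := b.zero_of_le_dist (by
        have : δ ≤ dist y x₀ := by simpa using hy
        change δ / 2 ≤ _
        linarith)
      simp only [hG, hχ, this]
      simp
      positivity
  have hG0 : G x₀ = g x₀ := by
    have : b x₀ = 1 := b.one_of_mem_closedBall (by simpa using b.rIn_pos.le)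
    simp [hG, hχ, this]
  have hGc : ContinuousAt G x₀ := hg.mul χ.continuous.continuousAt
  have hsplit : ∀ j, conv (approxId ψ (t j) (ht j)) v x₀ =
      (∫ z, G (x₀ - t j • z) * ψ z) + v (reflectAt (approxId ψ (t j) (ht j)) x₀ -
        smulLeftCLM ℂ χ (reflectAt (approxId ψ (t j) (ht j)) x₀)) := by
    intro j
    set F := reflectAt (approxId ψ (t j) (ht j)) x₀
    have h1 : v (smulLeftCLM ℂ χ F) = ∫ z, G (x₀ - t j • z) * ψ z := by
      rw [hgv.2]
      · have e1 : ∀ y, g y * smulLeftCLM ℂ χ F y = G y * F y := fun y => by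
          rw [smulLeftCLM_apply_apply χ.hasTemperateGrowth]
          simp only [hG, smul_eq_mul, mul_assoc]
        simp only [e1]
        rw [← integral_sub_left_eq_self _ volume x₀]
        have h2 := Measure.integral_comp_smul (volume : Measure (E n))
          (fun y => G (x₀ - y) * F (x₀ - y)) (t j)
        have hne : ((t j ^ n : ℝ) : ℂ) ≠ 0 := by
          exact_mod_cast (pow_pos (ht j) n).ne'
        have h3 : ∀ z, G (x₀ - t j • z) * F (x₀ - t j • z) =
            (((t j ^ n)⁻¹ : ℝ) : ℂ) * (G (x₀ - t j • z) * ψ z) := fun z => by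
          simp only [F]
          rw [reflectAt_apply, approxId_apply, sub_sub_cancel, smul_smul,
            inv_mul_cancel₀ (ht j).ne', one_smul]
          ring
        simp only [h3, integral_const_mul] at h2
        rw [finrank_euclideanSpace, Fintype.card_fin,
          abs_of_pos (inv_pos.2 (pow_pos (ht j) n)), Complex.real_smul] at h2
        exact (mul_left_cancel₀ (by
          rw [Complex.ofReal_inv]; exact inv_ne_zero hne) h2).symm
      · refine hbc.mono fun y hy => ?_
        rw [Function.mem_support, smulLeftCLM_apply_apply χ.hasTemperateGrowth] at hy
        intro h0
        exact hy (by rw [show χ y = 0 from h0, zero_smul])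
    rw [← h1, ← map_add, add_sub_cancel]
    rfl
  have hA : Tendsto (fun j => ∫ z, G (x₀ - t j • z) * ψ z) atTop (𝓝 (∫ z, g x₀ * ψ z)) := by
    refine tendsto_integral_of_dominated_convergence (fun z => (‖g x₀‖ + 1) * ‖ψ z‖) ?_
      (ψ.integrable.norm.const_mul _) ?_ ?_
    · intro j
      have := (hGi.comp_sub_left x₀).comp_smul (ht j).ne'
      exact this.aestronglyMeasurable.mul ψ.continuous.aestronglyMeasurable
    · intro j
      refine Eventually.of_forall fun z => ?_
      rw [norm_mul]
      gcongr
      exact hGb _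
    · refine Eventually.of_forall fun z => Tendsto.mul_const _ ?_
      rw [← hG0]
      refine hGc.tendsto.comp ?_
      have := (hlim.smul_const z).const_sub x₀
      simpa using this
  have hB : Tendsto (fun j => v (reflectAt (approxId ψ (t j) (ht j)) x₀ -
      smulLeftCLM ℂ χ (reflectAt (approxId ψ (t j) (ht j)) x₀))) atTop (𝓝 0) := by
    rw [← map_zero v]
    refine (v.continuous.tendsto 0).comp ?_
    rw [(schwartz_withSeminorms ℂ (E n) ℂ).tendsto_nhds]
    rintro ⟨k, l⟩ ε hε
    obtain ⟨C, hC⟩ := exists_seminorm_sub_smul_le ψ χ x₀ (ρ := δ / 4) (by positivity) (fun y hy => by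
      rw [hχ, b.one_of_mem_closedBall (Metric.ball_subset_closedBall hy), Complex.ofReal_one]) k l
    have h1 : Tendsto (fun j => C * t j) atTop (𝓝 0) := by simpa using hlim.const_mul C
    filter_upwards [h1.eventually_lt_const hε] with j hj
    rw [sub_zero]
    exact (hC (t j) (ht j) (ht1 j)).trans_lt hj
  simp only [hsplit]
  have := hA.add hB
  rwa [integral_const_mul, add_zero, mul_comm] at this

/-! ### Convolutions of Schwartz functions paired with a distribution -/

/-- The index set for the quantities `|x|^k D^l f(x)(m₁, …, m_l)`, where `(k, l)` runs through a
finite set; it carries the discrete topology. -/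
def DerivIndex (n : ℕ) (s : Finset (ℕ × ℕ)) : Type :=
  Σ i : s, E n × (Fin i.1.2 → E n)

instance (n : ℕ) (s : Finset (ℕ × ℕ)) : TopologicalSpace (DerivIndex n s) := ⊥

instance (n : ℕ) (s : Finset (ℕ × ℕ)) : DiscreteTopology (DerivIndex n s) := ⟨rfl⟩

/-- The number `|x|^k D^l f(x)(m₁, …, m_l) / (|m₁| ⋯ |m_l|)`. -/
def derivValue {n : ℕ} {s : Finset (ℕ × ℕ)} (f : 𝓢(E n, ℂ)) (q : DerivIndex n s) : ℂ :=
  (((∏ j, ‖q.2.2 j‖)⁻¹ * ‖q.2.1‖ ^ q.1.1.1 : ℝ) : ℂ) *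
    iteratedFDeriv ℝ q.1.1.2 f q.2.1 q.2.2

theorem norm_derivValue_le {n : ℕ} {s : Finset (ℕ × ℕ)} (f : 𝓢(E n, ℂ)) (q : DerivIndex n s) :
    ‖derivValue f q‖ ≤ SchwartzMap.seminorm ℂ q.1.1.1 q.1.1.2 f := by
  refine le_trans ?_ (le_seminorm ℂ q.1.1.1 q.1.1.2 f q.2.1)
  have h := (iteratedFDeriv ℝ q.1.1.2 f q.2.1).le_opNorm q.2.2
  have hP : 0 ≤ ∏ j, ‖q.2.2 j‖ := Finset.prod_nonneg fun j _ => norm_nonneg _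
  rw [derivValue, norm_mul, Complex.norm_real, Real.norm_of_nonneg (by positivity)]
  set D := ‖iteratedFDeriv ℝ q.1.1.2 f q.2.1‖
  set P := ∏ j, ‖q.2.2 j‖
  calc P⁻¹ * ‖q.2.1‖ ^ q.1.1.1 * ‖iteratedFDeriv ℝ q.1.1.2 f q.2.1 q.2.2‖
      ≤ P⁻¹ * ‖q.2.1‖ ^ q.1.1.1 * (D * P) := by gcongr
    _ = ‖q.2.1‖ ^ q.1.1.1 * D * (P⁻¹ * P) := by ring
    _ ≤ ‖q.2.1‖ ^ q.1.1.1 * D * 1 := by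
        gcongr
        exact inv_mul_le_one
    _ = _ := mul_one _

theorem norm_derivValue_le_sup {n : ℕ} {s : Finset (ℕ × ℕ)} (f : 𝓢(E n, ℂ))
    (q : DerivIndex n s) :
    ‖derivValue f q‖ ≤ s.sup (schwartzSeminormFamily ℂ (E n) ℂ) f :=
  (norm_derivValue_le f q).trans
    (Seminorm.le_finset_sup_apply (p := schwartzSeminormFamily ℂ (E n) ℂ) q.1.2)

/-- The map `f ↦ derivValue f` into a space of bounded functions. -/
def derivValues (n : ℕ) (s : Finset (ℕ × ℕ)) : 𝓢(E n, ℂ) →L[ℂ] (DerivIndex n s →ᵇ ℂ) :=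
  mkCLMtoNormedSpace (σ := RingHom.id ℂ)
    (fun f => BoundedContinuousFunction.ofNormedAddCommGroupDiscrete (derivValue f)
      (s.sup (schwartzSeminormFamily ℂ (E n) ℂ) f) (norm_derivValue_le_sup f))
    (fun f g => by
      ext q
      have : iteratedFDeriv ℝ q.1.1.2 (f + g : 𝓢(E n, ℂ)) q.2.1 =
          iteratedFDeriv ℝ q.1.1.2 f q.2.1 + iteratedFDeriv ℝ q.1.1.2 g q.2.1 :=
        iteratedFDeriv_add_apply (f.smooth _).contDiffAt (g.smooth _).contDiffAt
      change derivValue (f + g) q = derivValue f q + derivValue g q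
      rw [derivValue, this, add_apply, mul_add]
      rfl)
    (fun a f => by
      ext q
      have : iteratedFDeriv ℝ q.1.1.2 (a • f : 𝓢(E n, ℂ)) q.2.1 =
          a • iteratedFDeriv ℝ q.1.1.2 f q.2.1 :=
        iteratedFDeriv_const_smul_apply (f.smooth _).contDiffAt
      change derivValue (a • f) q = a * derivValue f q
      rw [derivValue, this, smul_apply, smul_eq_mul, mul_left_comm]
      rfl)
    ⟨s, 1, zero_le_one, fun f => by
      rw [one_mul]
      exact (BoundedContinuousFunction.norm_le (apply_nonneg _ _)).2 (norm_derivValue_le_sup f)⟩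

theorem derivValues_apply {n : ℕ} {s : Finset (ℕ × ℕ)} (f : 𝓢(E n, ℂ)) (q : DerivIndex n s) :
    derivValues n s f q = derivValue f q := rfl

theorem norm_derivValues_le {n : ℕ} {s : Finset (ℕ × ℕ)} (f : 𝓢(E n, ℂ)) :
    ‖derivValues n s f‖ ≤ s.sup (schwartzSeminormFamily ℂ (E n) ℂ) f :=
  (BoundedContinuousFunction.norm_le (apply_nonneg _ _)).2 (norm_derivValue_le_sup f)

/-- The operator norm of a multilinear map is the supremum of its normalized values, so the sup norm
of the recorded values recovers the seminorms exactly. -/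
theorem sup_seminorm_le_norm_derivValues {n : ℕ} (s : Finset (ℕ × ℕ)) (f : 𝓢(E n, ℂ)) :
    s.sup (schwartzSeminormFamily ℂ (E n) ℂ) f ≤ ‖derivValues n s f‖ := by
  refine Seminorm.finset_sup_apply_le (norm_nonneg _) fun i hi => ?_
  refine seminorm_le_bound ℂ i.1 i.2 f (norm_nonneg _) fun x => ?_
  have hnn : ‖x‖ ^ i.1 = ‖((‖x‖ ^ i.1 : ℝ) : ℂ)‖ := by
    rw [Complex.norm_real, Real.norm_of_nonneg (by positivity)]
  rw [hnn, ← norm_smul]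
  refine ContinuousMultilinearMap.opNorm_le_bound (norm_nonneg _) fun m => ?_
  rw [smul_apply]
  -- If some `m j = 0`, the normalization degenerates, but then the multilinear value is `0` anyway.
  rcases (Finset.prod_nonneg fun j (_ : j ∈ Finset.univ) => norm_nonneg (m j)).eq_or_lt with hP | hP
  · have h := (iteratedFDeriv ℝ i.2 f x).le_opNorm m
    rw [← hP, mul_zero] at h
    rw [norm_le_zero_iff.1 h, smul_zero, norm_zero]
    positivity
  · have h := (derivValues n s f).norm_coe_le_norm (show DerivIndex n s from ⟨⟨i, hi⟩, x, m⟩)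
    change ‖(((∏ j, ‖m j‖)⁻¹ * ‖x‖ ^ i.1 : ℝ) : ℂ) * iteratedFDeriv ℝ i.2 f x m‖ ≤ _ at h
    rw [Complex.ofReal_mul, mul_assoc, norm_mul, Complex.norm_real, norm_inv,
      Real.norm_of_nonneg hP.le, inv_mul_le_iff₀ hP] at h
    rwa [smul_eq_mul, mul_comm ‖derivValues n s f‖]

/-- Finitely many seminorms control `v`, so it descends to the image of `𝓢` in a Banach space of
bounded functions and extends by Hahn–Banach. There Bochner integrals commute with continuous
functionals. -/
theorem exists_factorization {n : ℕ} (v : 𝓢'(E n, ℂ)) :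
    ∃ (s : Finset (ℕ × ℕ)) (G : (DerivIndex n s →ᵇ ℂ) →L[ℂ] ℂ), ∀ f, v f = G (derivValues n s f) := by
  obtain ⟨s, C, hC, h⟩ := exists_bound_distribution v
  let ι : 𝓢(E n, ℂ) →ₗ[ℂ] (DerivIndex n s →ᵇ ℂ) := (derivValues n s : 𝓢(E n, ℂ) →ₗ[ℂ] _)
  have hι : ∀ f, ‖v f‖ ≤ C * ‖ι f‖ := fun f => by
    refine (h f).trans ?_
    gcongr
    exact sup_seminorm_le_norm_derivValues s f
  let L : 𝓢(E n, ℂ) →ₗ[ℂ] ℂ := v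
  have hker : ι.ker ≤ L.ker := fun f hf => by
    have h1 : ι f = 0 := hf
    have h2 := hι f
    rw [h1, norm_zero, mul_zero] at h2
    exact norm_le_zero_iff.1 h2
  let g₀ : ι.range →ₗ[ℂ] ℂ := (ι.ker.liftQ L hker).comp ι.quotKerEquivRange.symm.toLinearMap
  have hg₀ : ∀ f, g₀ ⟨ι f, f, rfl⟩ = v f := fun f => by
    have : ι.quotKerEquivRange.symm ⟨ι f, f, rfl⟩ = ι.ker.mkQ f := by
      rw [LinearEquiv.symm_apply_eq]
      rfl
    simp only [g₀, LinearMap.comp_apply, LinearEquiv.coe_coe, this]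
    rfl
  let g : ι.range →L[ℂ] ℂ := g₀.mkContinuous C (by
    rintro ⟨_, f, rfl⟩
    rw [hg₀]
    exact hι f)
  obtain ⟨G, hG, -⟩ := exists_extension_norm_eq ι.range g
  refine ⟨s, G, fun f => ?_⟩
  have := hG ⟨ι f, f, rfl⟩
  rw [← hg₀ f]
  exact this.symm

/-- After the Fourier transform both sides are products with the same linear symbol. -/
theorem lineDerivOp_convolution {n : ℕ} (κ κ' : 𝓢(E n, ℂ)) (m : E n) :
    ∂_{m} (convolution (ContinuousLinearMap.mul ℂ ℂ) κ κ') =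
      convolution (ContinuousLinearMap.mul ℂ ℂ) κ (∂_{m} κ') := by
  have h : 𝓕 (∂_{m} (convolution (ContinuousLinearMap.mul ℂ ℂ) κ κ')) =
      𝓕 (convolution (ContinuousLinearMap.mul ℂ ℂ) κ (∂_{m} κ')) := by
    have ht : (inner ℝ · m : E n → ℝ).HasTemperateGrowth := by fun_prop
    rw [fourier_lineDerivOp_eq, fourier_convolution, fourier_convolution, fourier_lineDerivOp_eq]
    ext ξ
    simp [pairing_apply_apply, smulLeftCLM_apply_apply ht]
    ring
  have := congrArg (fun f : 𝓢(E n, ℂ) => 𝓕⁻ f) h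
  simpa using this

theorem iteratedFDeriv_convolution {n : ℕ} (κ κ' : 𝓢(E n, ℂ)) (l : ℕ) (x : E n)
    (m : Fin l → E n) :
    iteratedFDeriv ℝ l (convolution (ContinuousLinearMap.mul ℂ ℂ) κ κ') x m =
      ∫ y, κ y * iteratedFDeriv ℝ l κ' (x - y) m := by
  have h : ∂^{m} (convolution (ContinuousLinearMap.mul ℂ ℂ) κ κ') =
      convolution (ContinuousLinearMap.mul ℂ ℂ) κ (∂^{m} κ') := by
    induction l with
    | zero => simp
    | succ l ih =>
      rw [LineDeriv.iteratedLineDerivOp_succ_left, LineDeriv.iteratedLineDerivOp_succ_left, ih,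
        lineDerivOp_convolution]
  rw [← iteratedLineDerivOp_eq_iteratedFDeriv, h, convolution_apply]
  simp only [← iteratedLineDerivOp_eq_iteratedFDeriv]
  rfl

/-- `κ ∗ κ'` is the superposition `∫ κ(y) κ'(· - y) dy`. It is realized as a Bochner integral in the
Banach space of `exists_factorization`, checked coordinate by coordinate, and the functional is then
taken inside. -/
theorem apply_convolution {n : ℕ} (v : 𝓢'(E n, ℂ)) (κ κ' : 𝓢(E n, ℂ)) :
    v (convolution (ContinuousLinearMap.mul ℂ ℂ) κ κ') =
      ∫ y, κ y * v (compSubConstCLM ℂ y κ') := by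
  obtain ⟨s, G, hG⟩ := exists_factorization v
  set κ'' : 𝓢(E n, ℂ) :=
    compCLMOfContinuousLinearEquiv ℂ (ContinuousLinearEquiv.neg ℝ (M := E n)) κ'
  have hτ : ∀ y, compSubConstCLM ℂ y κ' = reflectAt κ'' y := fun y => by
    ext z
    rw [reflectAt_apply, compSubConstCLM_apply]
    change _ = κ' (-(y - z))
    rw [neg_sub]
  choose B hB0 hB using fun i : ℕ × ℕ => exists_seminorm_reflectAt_le κ'' i.1 i.2
  set A := ∑ i ∈ s, B i
  set N := s.sup Prod.fst
  have hA0 : 0 ≤ A := Finset.sum_nonneg fun i _ => hB0 i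
  have hbd : ∀ y, ‖derivValues n s (reflectAt κ'' y)‖ ≤ A * (1 + ‖y‖) ^ N := fun y => by
    refine (norm_derivValues_le _).trans ?_
    refine Seminorm.finset_sup_apply_le (by positivity) fun i hi => (hB i y).trans ?_
    have := hB0 i
    gcongr
    · exact Finset.single_le_sum (f := B) (fun i _ => hB0 i) hi
    · linarith [norm_nonneg y]
    · exact Finset.le_sup (f := Prod.fst) hi
  have hint : Integrable fun y => κ y • derivValues n s (reflectAt κ'' y) := by
    refine Integrable.mono' ((integrable_one_add_norm_pow_mul κ N).const_mul A) ?_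
      (Eventually.of_forall fun y => ?_)
    · exact (κ.continuous.smul ((derivValues n s).continuous.comp
        (continuous_reflectAt κ''))).aestronglyMeasurable
    · rw [norm_smul]
      calc ‖κ y‖ * ‖derivValues n s (reflectAt κ'' y)‖ ≤ ‖κ y‖ * (A * (1 + ‖y‖) ^ N) := by
            gcongr; exact hbd y
        _ = _ := by ring
  have hW : derivValues n s (convolution (ContinuousLinearMap.mul ℂ ℂ) κ κ') =
      ∫ y, κ y • derivValues n s (reflectAt κ'' y) := by
    ext q
    let P : (DerivIndex n s →ᵇ ℂ) →L[ℂ] ℂ := BoundedContinuousFunction.evalCLM ℂ q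
    have hP := P.integral_comp_comm hint
    change _ = P (∫ y, κ y • derivValues n s (reflectAt κ'' y))
    rw [← hP, derivValues_apply, derivValue, iteratedFDeriv_convolution, ← integral_const_mul]
    congr 1 with y
    rw [← hτ]
    change _ = κ y * derivValue (compSubConstCLM ℂ y κ') q
    have : (compSubConstCLM ℂ y κ' : E n → ℂ) = fun z => κ' (z - y) := rfl
    rw [derivValue, this, iteratedFDeriv_comp_sub]
    ring
  rw [hG, hW, ← G.integral_comp_comm hint]
  congr 1 with y
  rw [map_smul, hτ, hG, smul_eq_mul]

/-- Associativity `(κ ∗ κ') ∗ v = κ ∗ (κ' ∗ v)`, from `apply_convolution` for `v` composed with the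
reflection about `x`. -/
theorem conv_convolution {n : ℕ} (v : 𝓢'(E n, ℂ)) (κ κ' : 𝓢(E n, ℂ)) (x : E n) :
    conv (convolution (ContinuousLinearMap.mul ℂ ℂ) κ κ') v x =
      ∫ y, κ y * conv κ' v (x - y) := by
  let R : 𝓢(E n, ℂ) →L[ℂ] 𝓢(E n, ℂ) := (compSubConstCLM ℂ x).comp
    (compCLMOfContinuousLinearEquiv ℂ (ContinuousLinearEquiv.neg ℝ (M := E n)))
  let v' : 𝓢'(E n, ℂ) := PointwiseConvergenceCLM.precomp ℂ R v
  have hv' : ∀ f, v' f = v (reflectAt f x) := fun f => rfl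
  have h := apply_convolution v' κ κ'
  rw [hv'] at h
  refine h.trans ?_
  congr 1 with y
  rw [hv', conv]
  congr 2
  ext z
  rw [reflectAt_apply, reflectAt_apply, compSubConstCLM_apply]
  congr 1
  abel

/-- The product of two symbols. -/
def symbolMul {n : ℕ} (m m' : 𝓢(E n, ℂ)) : 𝓢(E n, ℂ) :=
  pairing (ContinuousLinearMap.mul ℂ ℂ) m m'

theorem symbolMul_apply {n : ℕ} (m m' : 𝓢(E n, ℂ)) (ξ : E n) :
    symbolMul m m' ξ = m ξ * m' ξ := rfl

theorem multiplier_symbolMul {n : ℕ} (v : 𝓢'(E n, ℂ)) (m m' : 𝓢(E n, ℂ)) (x : E n) :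
    multiplier (symbolMul m m') v x = ∫ y, (𝓕⁻ m) y * multiplier m' v (x - y) := by
  have h : 𝓕⁻ (symbolMul m m') =
      SchwartzMap.convolution (ContinuousLinearMap.mul ℂ ℂ) (𝓕⁻ m) (𝓕⁻ m') := by
    simp [symbolMul, SchwartzMap.convolution]
  rw [multiplier, h, conv_convolution]
  rfl

/-! ### Quasi-norm inequalities -/

theorem rpow_sum_le_sum_rpow {ι : Type*} {p : ℝ} (hp0 : 0 < p) (hp1 : p ≤ 1) (s : Finset ι)
    (a : ι → ℝ≥0∞) : (∑ i ∈ s, a i) ^ p ≤ ∑ i ∈ s, a i ^ p := by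
  classical
  induction s using Finset.induction_on with
  | empty => simp [hp0]
  | insert i s hi ih =>
    rw [Finset.sum_insert hi, Finset.sum_insert hi]
    exact (ENNReal.rpow_add_le_add_rpow _ _ hp0.le hp1).trans (add_le_add_right ih _)

/-- The embedding `ℓ^p ⊂ ℓ^1` with constant `1`, from subadditivity of `a ↦ a^p`. -/
theorem tsum_le_tsum_rpow {ι : Type*} {p : ℝ} (hp0 : 0 < p) (hp1 : p ≤ 1) (a : ι → ℝ≥0∞) :
    ∑' i, a i ≤ (∑' i, a i ^ p) ^ (1 / p) := by
  rw [ENNReal.tsum_eq_iSup_sum]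
  refine iSup_le fun s => ?_
  rw [one_div, ENNReal.le_rpow_inv_iff hp0]
  exact (rpow_sum_le_sum_rpow hp0 hp1 s a).trans (ENNReal.sum_le_tsum s)

theorem eLpNorm_ofReal_eq {α ε : Type*} [MeasurableSpace α] [ENorm ε] {μ : Measure α}
    {p : ℝ} (hp0 : 0 < p) (f : α → ε) :
    eLpNorm f (ENNReal.ofReal p) μ = (∫⁻ x, ‖f x‖ₑ ^ p ∂μ) ^ (1 / p) := by
  rw [eLpNorm_eq_lintegral_rpow_enorm_toReal (by simpa using hp0) (by simp),
    ENNReal.toReal_ofReal hp0.le]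

theorem eLpNorm_ofReal_rpow {α ε : Type*} [MeasurableSpace α] [ENorm ε] {μ : Measure α}
    {p : ℝ} (hp0 : 0 < p) (f : α → ε) :
    eLpNorm f (ENNReal.ofReal p) μ ^ p = ∫⁻ x, ‖f x‖ₑ ^ p ∂μ := by
  rw [eLpNorm_ofReal_eq hp0, ← ENNReal.rpow_mul, one_div, inv_mul_cancel₀ hp0.ne',
    ENNReal.rpow_one]

theorem ae_ne_zero {n : ℕ} [Nontrivial (E n)] : ∀ᵐ x : E n, x ≠ 0 := by
  rw [ae_iff]
  simp

theorem eLpNorm_le_of_enorm_le_tsum {n : ℕ} [Nontrivial (E n)] {ι : Type*} [Countable ι] {p : ℝ}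
    (hp0 : 0 < p) (hp1 : p ≤ 1) {g : E n → ℂ} {b : ι → E n → ℂ} (hb : ∀ i, Continuous (b i))
    (h : ∀ x, x ≠ 0 → ‖g x‖ₑ ≤ ∑' i, ‖b i x‖ₑ) :
    eLpNorm g (ENNReal.ofReal p) volume ≤
      (∑' i, eLpNorm (b i) (ENNReal.ofReal p) volume ^ p) ^ (1 / p) := by
  rw [eLpNorm_ofReal_eq hp0]
  gcongr
  simp only [eLpNorm_ofReal_rpow hp0]
  rw [← lintegral_tsum fun i => ((hb i).measurable.enorm.pow_const p).aemeasurable]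
  refine lintegral_mono_ae ?_
  filter_upwards [ae_ne_zero] with x hx
  rw [← ENNReal.le_rpow_inv_iff hp0, ← one_div]
  exact (h x hx).trans (tsum_le_tsum_rpow hp0 hp1 _)

/-! ### Fourier multipliers -/

theorem multiplier_add {n : ℕ} (m m' : 𝓢(E n, ℂ)) (v : 𝓢'(E n, ℂ)) (x : E n) :
    multiplier (m + m') v x = multiplier m v x + multiplier m' v x := by
  simp only [multiplier, conv]
  rw [← map_add]
  congr 1
  rw [FourierTransform.fourierInv_add]
  ext y
  simp [reflectAt_apply]

theorem multiplier_zero {n : ℕ} (v : 𝓢'(E n, ℂ)) (x : E n) :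
    multiplier (0 : 𝓢(E n, ℂ)) v x = 0 := by
  have := multiplier_add (0 : 𝓢(E n, ℂ)) 0 v x
  simpa using this

theorem multiplier_sum {n : ℕ} {ι : Type*} (s : Finset ι) (m : ι → 𝓢(E n, ℂ)) (v : 𝓢'(E n, ℂ))
    (x : E n) : multiplier (∑ i ∈ s, m i) v x = ∑ i ∈ s, multiplier (m i) v x := by
  classical
  induction s using Finset.induction_on with
  | empty => simp [multiplier_zero]
  | insert i s hi ih => rw [Finset.sum_insert hi, Finset.sum_insert hi, multiplier_add, ih]

theorem continuous_multiplier {n : ℕ} (m : 𝓢(E n, ℂ)) (v : 𝓢'(E n, ℂ)) :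
    Continuous (multiplier m v) := continuous_conv _ _

theorem fourierInv_scale {n : ℕ} (m : 𝓢(E n, ℂ)) {t : ℝ} (ht : 0 < t) :
    𝓕⁻ (scale t ht.ne' m) = approxId (𝓕⁻ m) t ht := by
  ext x
  rw [approxId_apply, fourierInv_coe, fourierInv_coe, Real.fourierInv_eq', Real.fourierInv_eq']
  have h := Measure.integral_comp_smul (volume : Measure (E n))
    (fun v => Complex.exp (↑(2 * Real.pi * inner ℝ v (t⁻¹ • x)) * Complex.I) • m v) t
  rw [finrank_euclideanSpace, Fintype.card_fin, abs_of_pos (inv_pos.2 (pow_pos ht n)),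
    Complex.real_smul] at h
  rw [← h]
  congr 1 with v
  rw [scale_apply, real_inner_smul_left, real_inner_smul_right, mul_inv_cancel_left₀ ht.ne']

theorem integral_fourierInv {n : ℕ} (m : 𝓢(E n, ℂ)) : ∫ x, (𝓕⁻ m) x = m 0 := by
  have h : 𝓕 (𝓕⁻ m) = m := by simp
  have h2 : (𝓕 (𝓕⁻ m)) (0 : E n) = m 0 := by rw [h]
  rw [fourier_coe, Real.fourier_eq] at h2
  simpa using h2

theorem fourierInv_translate {n : ℕ} (m : 𝓢(E n, ℂ)) (a x : E n) :
    (𝓕⁻ (compSubConstCLM ℂ a m)) x =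
      Complex.exp (↑(2 * Real.pi * inner ℝ a x) * Complex.I) * (𝓕⁻ m) x := by
  rw [fourierInv_coe, fourierInv_coe, Real.fourierInv_eq', Real.fourierInv_eq',
    ← integral_const_mul]
  conv_rhs => rw [← integral_sub_right_eq_self _ a]
  congr 1 with v
  rw [compSubConstCLM_apply, smul_eq_mul, smul_eq_mul, ← mul_assoc, ← Complex.exp_add, inner_sub_left]
  congr 2
  push_cast
  ring

theorem norm_fourierInv_translate {n : ℕ} (m : 𝓢(E n, ℂ)) (a x : E n) :
    ‖(𝓕⁻ (compSubConstCLM ℂ a m)) x‖ = ‖(𝓕⁻ m) x‖ := by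
  rw [fourierInv_translate, norm_mul, Complex.norm_exp_ofReal_mul_I, one_mul]

theorem enorm_fourierInv_translate {n : ℕ} (m : 𝓢(E n, ℂ)) (a x : E n) :
    ‖(𝓕⁻ (compSubConstCLM ℂ a m)) x‖ₑ = ‖(𝓕⁻ m) x‖ₑ :=
  enorm_eq_iff_norm_eq.2 (norm_fourierInv_translate m a x)

theorem integral_approxId_mul {n : ℕ} (ψ : 𝓢(E n, ℂ)) {t : ℝ} (ht : 0 < t) (F : E n → ℂ) :
    ∫ y, approxId ψ t ht y * F y = ∫ z, ψ z * F (t • z) := by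
  have h2 := Measure.integral_comp_smul (volume : Measure (E n))
    (fun y => approxId ψ t ht y * F y) t
  have hne : (((t ^ n)⁻¹ : ℝ) : ℂ) ≠ 0 := by
    exact_mod_cast (inv_pos.2 (pow_pos ht n)).ne'
  have h3 : ∀ z, approxId ψ t ht (t • z) * F (t • z) =
      (((t ^ n)⁻¹ : ℝ) : ℂ) * (ψ z * F (t • z)) := fun z => by
    rw [approxId_apply, smul_smul, inv_mul_cancel₀ ht.ne', one_smul, mul_assoc]
  simp only [h3, integral_const_mul] at h2
  rw [finrank_euclideanSpace, Fintype.card_fin,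
    abs_of_pos (inv_pos.2 (pow_pos ht n)), Complex.real_smul] at h2
  exact (mul_left_cancel₀ hne h2).symm

theorem tendsto_two_pow_inv : Tendsto (fun j : ℕ => ((2 : ℝ) ^ j)⁻¹) atTop (𝓝 0) :=
  tendsto_inv_atTop_zero.comp (tendsto_pow_atTop_atTop_of_one_lt one_lt_two)

theorem two_pow_inv_le_one (j : ℕ) : ((2 : ℝ) ^ j)⁻¹ ≤ 1 :=
  inv_le_one_of_one_le₀ (one_le_pow₀ one_le_two)

/-! ### The quasi-norms dominate the `L^p` quasi-norm -/

theorem eLpNorm_le_localHardyNorm {n : ℕ} [Nontrivial (E n)] (ψ : 𝓢(E n, ℂ))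
    (hψ : (∫ x, ψ x) ≠ 0) (p : ℝ) {g : E n → ℂ} {v : 𝓢'(E n, ℂ)} (hgv : Represents g v)
    (hg : ∀ x, x ≠ 0 → ContinuousAt g x) :
    eLpNorm g (ENNReal.ofReal p) volume ≤ ‖∫ x, ψ x‖ₑ⁻¹ * localHardyNorm ψ p v := by
  have h1 : eLpNorm ((∫ x, ψ x) • g) (ENNReal.ofReal p) volume ≤ localHardyNorm ψ p v := by
    refine eLpNorm_mono_enorm_ae ?_
    filter_upwards [ae_ne_zero] with x hx
    -- The shift `j + 1` keeps the scales strictly below `1`, inside the range of the supremum.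
    have ht : ∀ j : ℕ, 0 < ((2 : ℝ) ^ (j + 1))⁻¹ := fun j => by positivity
    have hlim := tendsto_conv_approxId hgv (hg x hx) ψ ht (fun j => two_pow_inv_le_one _)
      (tendsto_two_pow_inv.comp (tendsto_add_atTop_nat 1))
    refine le_of_tendsto hlim.enorm (Eventually.of_forall fun j => ?_)
    have hj : ((2 : ℝ) ^ (j + 1))⁻¹ ∈ Ioo (0 : ℝ) 1 :=
      ⟨ht j, inv_lt_one_of_one_lt₀ (one_lt_pow₀ one_lt_two (by simp))⟩
    rw [enorm_eq_self]
    exact le_iSup (fun t : Ioo (0 : ℝ) 1 => ‖conv (approxId ψ t t.2.1) v x‖ₑ) ⟨_, hj⟩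
  rw [eLpNorm_const_smul] at h1
  rw [← ENNReal.div_eq_inv_mul, ENNReal.le_div_iff_mul_le (by simp [hψ]) (by simp), mul_comm]
  exact h1

theorem DyadicCutoff.sum_piece {n : ℕ} (φ : DyadicCutoff n) (J : ℕ) :
    ∑ j ∈ Finset.range (J + 1), φ.piece j =
      scale ((2 : ℝ) ^ J)⁻¹ (by positivity) φ.toSchwartz := by
  induction J with
  | zero =>
    ext x
    simp [piece, scale_apply]
  | succ J ih =>
    rw [Finset.sum_range_succ, ih]
    ext x
    simp only [piece, Nat.add_eq_zero_iff, one_ne_zero, and_false, if_false]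
    have : 2 * ((2 : ℝ) ^ (J + 1))⁻¹ = ((2 : ℝ) ^ J)⁻¹ := by
      rw [pow_succ]
      field_simp
    simp [scale_apply, this]

/-- The partial sums telescope to `𝓕⁻¹ φ(2⁻ᴶ ·) 𝓕 v`, an approximate identity of total mass `φ(0) =
1`, so they converge to `g(x)`. -/
theorem DyadicCutoff.enorm_le_tsum_block {n : ℕ} (φ : DyadicCutoff n) {g : E n → ℂ}
    {v : 𝓢'(E n, ℂ)} (hgv : Represents g v) {x : E n} (hg : ContinuousAt g x) :
    ‖g x‖ₑ ≤ ∑' j, ‖φ.block j v x‖ₑ := by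
  have ht : ∀ j : ℕ, 0 < ((2 : ℝ) ^ j)⁻¹ := fun j => by positivity
  have hlim := tendsto_conv_approxId hgv hg (𝓕⁻ φ.toSchwartz) ht two_pow_inv_le_one
    tendsto_two_pow_inv
  have h0 : φ.toSchwartz 0 = 1 := by
    change ((φ.toFun 0 : ℝ) : ℂ) = 1
    rw [φ.eq_one 0 (by norm_num), Complex.ofReal_one]
  rw [integral_fourierInv, h0, one_mul] at hlim
  refine le_of_tendsto hlim.enorm (Eventually.of_forall fun J => ?_)
  have : conv (approxId (𝓕⁻ φ.toSchwartz) ((2 : ℝ) ^ J)⁻¹ (ht J)) v x =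
      ∑ j ∈ Finset.range (J + 1), φ.block j v x := by
    simp only [block]
    rw [← multiplier_sum, φ.sum_piece, multiplier, fourierInv_scale]
  rw [this]
  exact (enorm_sum_le _ _).trans (ENNReal.sum_le_tsum _)

theorem eLpNorm_le_besovNorm {n : ℕ} [Nontrivial (E n)] (φ : DyadicCutoff n) {p : ℝ}
    (hp0 : 0 < p) (hp1 : p ≤ 1) {g : E n → ℂ} {v : 𝓢'(E n, ℂ)} (hgv : Represents g v)
    (hg : ∀ x, x ≠ 0 → ContinuousAt g x) :
    eLpNorm g (ENNReal.ofReal p) volume ≤ besovNorm φ p p v :=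
  eLpNorm_le_of_enorm_le_tsum hp0 hp1 (fun _ => continuous_multiplier _ v)
    fun x hx => φ.enorm_le_tsum_block hgv (hg x hx)

theorem eLpNorm_le_triebelLizorkinNorm {n : ℕ} [Nontrivial (E n)] (φ : DyadicCutoff n) {p : ℝ}
    (hp0 : 0 < p) (hp1 : p ≤ 1) {g : E n → ℂ} {v : 𝓢'(E n, ℂ)} (hgv : Represents g v)
    (hg : ∀ x, x ≠ 0 → ContinuousAt g x) :
    eLpNorm g (ENNReal.ofReal p) volume ≤ triebelLizorkinNorm φ p p v := by
  refine eLpNorm_mono_enorm_ae ?_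
  filter_upwards [ae_ne_zero] with x hx
  rw [enorm_eq_self]
  exact (φ.enorm_le_tsum_block hgv (hg x hx)).trans (tsum_le_tsum_rpow hp0 hp1 _)

/-! ### A pointwise bound for functions that reproduce themselves by convolution -/

theorem one_add_norm_sub_le {n : ℕ} (x y : E n) : 1 + ‖x - y‖ ≤ (1 + ‖x‖) * (1 + ‖y‖) := by
  have := norm_sub_le x y
  nlinarith [norm_nonneg x, norm_nonneg y]

/-- A self-improving Nikolskii inequality. Let `M = sup |h| / w` with `w` the polynomial weight. In
the reproducing integral write `|h| = |h|^{1-p} |h|^p` and bound the first factor by `(M w)^{1-p}`;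
this gives `M ≤ M^{1-p} D ‖h‖_p^p`, hence `M^p ≤ D ‖h‖_p^p`. -/
theorem enorm_le_of_reproducing {n : ℕ} {p : ℝ} (hp0 : 0 < p) (hp1 : p < 1) {h : E n → ℂ} {N : ℕ}
    {A : ℝ} (hA : 0 ≤ A) (hgrow : ∀ x, ‖h x‖ ≤ A * (1 + ‖x‖) ^ N) {K : E n → ℝ≥0∞} {D : ℝ≥0∞}
    (hK : ∀ y, ENNReal.ofReal ((1 + ‖y‖) ^ N) * K y ≤ D) (hD : D ≠ ⊤)
    (hrep : ∀ x, ‖h x‖ₑ ≤ ∫⁻ y, K y * ‖h (x - y)‖ₑ) (x : E n) :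
    ‖h x‖ₑ ≤ ENNReal.ofReal ((1 + ‖x‖) ^ N) *
      (D ^ (1 / p) * eLpNorm h (ENNReal.ofReal p) volume) := by
  set w : E n → ℝ≥0∞ := fun x => ENNReal.ofReal ((1 + ‖x‖) ^ N) with hw
  have hw1 : ∀ x, 1 ≤ w x := fun x => by
    rw [hw, ENNReal.one_le_ofReal]
    exact one_le_pow₀ (by linarith [norm_nonneg x])
  have hw0 : ∀ x, w x ≠ 0 := fun x => (zero_lt_one.trans_le (hw1 x)).ne'
  have hwt : ∀ x, w x ≠ ⊤ := fun x => ENNReal.ofReal_ne_top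
  have hwsub : ∀ x y, w (x - y) ≤ w x * w y := fun x y => by
    rw [hw, ← ENNReal.ofReal_mul (by positivity), ← mul_pow]
    exact ENNReal.ofReal_le_ofReal (pow_le_pow_left₀ (by positivity) (one_add_norm_sub_le x y) N)
  set M : ℝ≥0∞ := ⨆ x, ‖h x‖ₑ / w x with hM
  have hle : ∀ x, ‖h x‖ₑ ≤ M * w x := fun x => by
    rw [← ENNReal.div_le_iff (hw0 x) (hwt x)]
    exact le_iSup (fun x => ‖h x‖ₑ / w x) x
  -- The a priori growth of `h` enters only here: `M` must be finite in order to divide by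
  -- `M^{1-p}`.
  have hMtop : M ≠ ⊤ := by
    refine ne_top_of_le_ne_top (b := ENNReal.ofReal A) ENNReal.ofReal_ne_top (iSup_le fun x => ?_)
    rw [ENNReal.div_le_iff (hw0 x) (hwt x), hw, ← ENNReal.ofReal_mul hA, ← ofReal_norm]
    exact ENNReal.ofReal_le_ofReal (hgrow x)
  set I : ℝ≥0∞ := ∫⁻ z, ‖h z‖ₑ ^ p with hI
  have hpt : ∀ x, ‖h x‖ₑ ≤ M ^ (1 - p) * D * I * w x := by
    intro x
    refine (hrep x).trans ?_
    have hb : ∀ y, K y * ‖h (x - y)‖ₑ ≤ (M ^ (1 - p) * w x * D) * ‖h (x - y)‖ₑ ^ p := by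
      intro y
      have e1 : ‖h (x - y)‖ₑ = ‖h (x - y)‖ₑ ^ (1 - p) * ‖h (x - y)‖ₑ ^ p := by
        rw [← ENNReal.rpow_add_of_nonneg _ _ (by linarith) hp0.le]
        simp
      have e2 : ‖h (x - y)‖ₑ ^ (1 - p) ≤ M ^ (1 - p) * (w x * w y) := by
        calc ‖h (x - y)‖ₑ ^ (1 - p) ≤ (M * w (x - y)) ^ (1 - p) :=
              ENNReal.rpow_le_rpow (hle _) (by linarith)
          _ = M ^ (1 - p) * w (x - y) ^ (1 - p) := ENNReal.mul_rpow_of_nonneg _ _ (by linarith)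
          _ ≤ M ^ (1 - p) * w (x - y) ^ (1 : ℝ) := by
              gcongr
              · exact hw1 _
              · linarith
          _ ≤ M ^ (1 - p) * (w x * w y) := by
              rw [ENNReal.rpow_one]
              gcongr
              exact hwsub x y
      calc K y * ‖h (x - y)‖ₑ = K y * (‖h (x - y)‖ₑ ^ (1 - p) * ‖h (x - y)‖ₑ ^ p) := by rw [← e1]
        _ ≤ K y * (M ^ (1 - p) * (w x * w y) * ‖h (x - y)‖ₑ ^ p) := by gcongr
        _ = (M ^ (1 - p) * w x * (w y * K y)) * ‖h (x - y)‖ₑ ^ p := by ring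
        _ ≤ _ := by gcongr; exact hK y
    refine (lintegral_mono hb).trans ?_
    rw [lintegral_const_mul', lintegral_sub_left_eq_self (fun z => ‖h z‖ₑ ^ p) x]
    · exact le_of_eq (by ring)
    · exact ENNReal.mul_ne_top (ENNReal.mul_ne_top
        (ENNReal.rpow_ne_top_of_nonneg (by linarith) hMtop) (hwt x)) hD
  have hMle : M ≤ M ^ (1 - p) * D * I := iSup_le fun x => by
    rw [ENNReal.div_le_iff (hw0 x) (hwt x)]
    exact hpt x
  have hfin : M ≤ D ^ (1 / p) * eLpNorm h (ENNReal.ofReal p) volume := by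
    rw [eLpNorm_ofReal_eq hp0, ← ENNReal.mul_rpow_of_nonneg _ _ (by positivity), one_div,
      ENNReal.le_rpow_inv_iff hp0]
    by_cases hM0 : M = 0
    · rw [hM0, ENNReal.zero_rpow_of_pos hp0]
      exact zero_le
    · have h1 : M ^ p = M * M ^ (p - 1) := by
        nth_rewrite 2 [← ENNReal.rpow_one M]
        rw [← ENNReal.rpow_add _ _ hM0 hMtop]
        congr 1
        ring
      have h2 : M ^ (1 - p) * M ^ (p - 1) = 1 := by
        rw [← ENNReal.rpow_add _ _ hM0 hMtop]
        simp
      calc M ^ p = M * M ^ (p - 1) := h1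
        _ ≤ (M ^ (1 - p) * D * I) * M ^ (p - 1) := by gcongr
        _ = D * I * (M ^ (1 - p) * M ^ (p - 1)) := by ring
        _ = D * I := by rw [h2, mul_one]
  calc ‖h x‖ₑ ≤ M * w x := hle x
    _ ≤ (D ^ (1 / p) * eLpNorm h (ENNReal.ofReal p) volume) * w x := by gcongr
    _ = _ := mul_comm _ _

/-! ### The uniform decomposition -/

/-- A smooth cutoff `1` on the ball of radius `r`, as a Schwartz function. -/
theorem exists_schwartz_cutoff (n : ℕ) {r : ℝ} (hr : 0 < r) : ∃ m : 𝓢(E n, ℂ),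
    (∀ ξ, ‖ξ‖ ≤ r → m ξ = 1) ∧ ∀ ξ, r + 1 ≤ ‖ξ‖ → m ξ = 0 := by
  let b : ContDiffBump (0 : E n) := ⟨r, r + 1, hr, by linarith⟩
  refine ⟨HasCompactSupport.toSchwartzMap (f := fun ξ => (b ξ : ℂ))
    (b.hasCompactSupport.comp_left (g := fun r : ℝ => (r : ℂ)) Complex.ofReal_zero)
    (Complex.ofRealCLM.contDiff.comp b.contDiff), fun ξ hξ => ?_, fun ξ hξ => ?_⟩
  · change ((b ξ : ℝ) : ℂ) = 1
    rw [b.one_of_mem_closedBall (by simpa [b] using hξ), Complex.ofReal_one]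
  · change ((b ξ : ℝ) : ℂ) = 0
    rw [b.zero_of_le_dist (by simpa [b] using hξ), Complex.ofReal_zero]

namespace UniformCutoff

variable {n : ℕ} (η : UniformCutoff n)

theorem piece_apply (k : Fin n → ℤ) (ξ : E n) :
    η.piece k ξ = ((η.window (ξ - latticePoint k) : ℝ) : ℂ) := rfl

theorem latticePoint_add (k l : Fin n → ℤ) :
    latticePoint (k + l) = latticePoint k + latticePoint l := by
  ext i
  simp [latticePoint]

theorem total_sub_latticePoint (ξ : E n) (k : Fin n → ℤ) :
    η.total (ξ - latticePoint k) = η.total ξ := by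
  rw [total, total, ← (Equiv.addLeft k).tsum_eq fun l => η.toFun (ξ - latticePoint l)]
  congr 1 with l
  rw [Equiv.coe_addLeft, latticePoint_add, sub_add_eq_sub_sub]

theorem window_ne_zero {ξ : E n} (h : η.window ξ ≠ 0) (i : Fin n) : |ξ i| < 3 / 4 := by
  by_contra hc
  exact h (by rw [window, η.eq_zero ξ ⟨i, not_lt.1 hc⟩, zero_div])

theorem tsum_window (ξ : E n) : ∑' k : Fin n → ℤ, η.window (ξ - latticePoint k) = 1 := by
  simp only [window, total_sub_latticePoint]
  rw [tsum_div_const]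
  change η.total ξ / η.total ξ = 1
  exact div_self (by linarith [η.one_le_total ξ])

/-- A symbol with bounded support is a finite sum of its localizations. -/
theorem exists_finset_symbolMul (m : 𝓢(E n, ℂ)) {r : ℝ} (hm : ∀ ξ, r ≤ ‖ξ‖ → m ξ = 0) :
    ∃ F : Finset (Fin n → ℤ), (∀ k ∉ F, symbolMul m (η.piece k) = 0) ∧
      ∑ k ∈ F, symbolMul m (η.piece k) = m := by
  set K : ℤ := ⌈r + 1⌉
  set F : Finset (Fin n → ℤ) := Fintype.piFinset fun _ => Finset.Icc (-K) K
  have hF : ∀ k ∉ F, ∀ ξ, m ξ * η.piece k ξ = 0 := by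
    intro k hk ξ
    by_contra hne
    have h1 : ‖ξ‖ < r := by
      by_contra hc
      exact hne (by rw [hm ξ (not_lt.1 hc), zero_mul])
    have h2 : η.window (ξ - latticePoint k) ≠ 0 := by
      intro hc
      exact hne (by rw [piece_apply, hc, Complex.ofReal_zero, mul_zero])
    apply hk
    simp only [F, Fintype.mem_piFinset, Finset.mem_Icc]
    intro i
    have h3 := η.window_ne_zero h2 i
    have h4 : |ξ i| ≤ ‖ξ‖ := by simpa using PiLp.norm_apply_le ξ i
    have h5 : (ξ - latticePoint k) i = ξ i - k i := by simp [latticePoint]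
    rw [h5, abs_lt] at h3
    have h6 := abs_le.1 h4
    have h7 : r + 1 ≤ K := Int.le_ceil _
    constructor
    · have : (-K : ℝ) ≤ k i := by linarith
      exact_mod_cast this
    · have : (k i : ℝ) ≤ K := by linarith
      exact_mod_cast this
  refine ⟨F, fun k hk => ?_, ?_⟩
  · ext ξ
    exact hF k hk ξ
  · ext ξ
    have h1 : (∑ k ∈ F, symbolMul m (η.piece k)) ξ = m ξ * ∑ k ∈ F, η.piece k ξ := by
      rw [Finset.mul_sum]
      simp [symbolMul_apply]
    rw [h1]
    by_cases hz : m ξ = 0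
    · rw [hz, zero_mul]
    · have h2 : ∑ k ∈ F, η.piece k ξ = 1 := by
        have h3 : ∑ k ∈ F, η.window (ξ - latticePoint k) = 1 := by
          rw [← η.tsum_window ξ]
          refine (tsum_eq_sum fun k hk => ?_).symm
          have := (mul_eq_zero.1 (hF k hk ξ)).resolve_left hz
          rw [piece_apply] at this
          exact_mod_cast this
        simp only [piece_apply]
        exact_mod_cast h3
      rw [h2, mul_one]

/-- The localized pieces of a distribution satisfy a pointwise bound by their `L^p` quasi-norms,
uniformly in the frequency. -/
theorem exists_norm_block_le {p : ℝ} (hp0 : 0 < p) (hp1 : p < 1) (v : 𝓢'(E n, ℂ)) :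
    ∃ (N : ℕ) (D : ℝ), 0 ≤ D ∧ ∀ k, eLpNorm (η.block k v) (ENNReal.ofReal p) volume ≠ ⊤ → ∀ x,
      ‖η.block k v x‖ ≤
        D * (1 + ‖x‖) ^ N * (eLpNorm (η.block k v) (ENNReal.ofReal p) volume).toReal := by
  obtain ⟨N, hN⟩ := exists_growth_conv v
  obtain ⟨r, hr⟩ := η.hasCompactSupport_window.isBounded.exists_norm_le
  -- `m` is `1` on the support of the window, so its translate to `k` reproduces the piece `k`.
  -- Translating the symbol only modulates the kernel, whose modulus is therefore the same for all
  -- `k`.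
  obtain ⟨m, hm1, -⟩ := exists_schwartz_cutoff n (r := |r| + 1) (by positivity)
  obtain ⟨D, hD0, hD⟩ := exists_decay (𝓕⁻ m) N
  refine ⟨N, D ^ (1 / p), by positivity, fun k hk x => ?_⟩
  set h := η.block k v
  obtain ⟨A, hA, hgrow⟩ := hN (𝓕⁻ (η.piece k))
  have hsym : symbolMul (compSubConstCLM ℂ (latticePoint k) m) (η.piece k) = η.piece k := by
    ext ξ
    rw [symbolMul_apply, compSubConstCLM_apply]
    by_cases hz : η.window (ξ - latticePoint k) = 0
    · rw [piece_apply, hz, Complex.ofReal_zero, mul_zero]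
    · rw [hm1, one_mul]
      have := hr _ (subset_tsupport _ hz)
      linarith [le_abs_self r]
  have hrep : ∀ x, ‖h x‖ₑ ≤ ∫⁻ y, ‖(𝓕⁻ m) y‖ₑ * ‖h (x - y)‖ₑ := by
    intro x
    have h1 := multiplier_symbolMul v (compSubConstCLM ℂ (latticePoint k) m) (η.piece k) x
    rw [hsym] at h1
    change h x = ∫ y, _ * h (x - y) at h1
    calc ‖h x‖ₑ = ‖∫ y, (𝓕⁻ (compSubConstCLM ℂ (latticePoint k) m)) y * h (x - y)‖ₑ := by rw [← h1]
      _ ≤ ∫⁻ y, ‖(𝓕⁻ (compSubConstCLM ℂ (latticePoint k) m)) y * h (x - y)‖ₑ :=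
          enorm_integral_le_lintegral_enorm _
      _ = _ := by
          congr 1 with y
          rw [enorm_mul, enorm_fourierInv_translate]
  have hmain := enorm_le_of_reproducing hp0 hp1 (h := h) hA hgrow
    (K := fun y => ‖(𝓕⁻ m) y‖ₑ) (D := ENNReal.ofReal D) (fun y => by
      rw [← ofReal_norm, ← ENNReal.ofReal_mul (by positivity)]
      exact ENNReal.ofReal_le_ofReal (hD y)) ENNReal.ofReal_ne_top hrep x
  rw [ENNReal.ofReal_rpow_of_nonneg hD0 (by positivity), ← mul_assoc,
    ← ENNReal.ofReal_mul (by positivity), ← ENNReal.ofReal_toReal hk,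
    ← ENNReal.ofReal_mul (by positivity), ← ofReal_norm,
    ENNReal.ofReal_le_ofReal_iff (by positivity)] at hmain
  linarith

/-- Insert a cutoff `m(t ξ)` with `m(0) = 1`. For each `t` only finitely many pieces remain and
their sum is an approximate identity applied to `v`, tending to `g(x)`. Each term tends to `□_k
v(x)` and is dominated by a multiple of `‖□_k v‖_p`, summable in `k` since `ℓ^p ⊂ ℓ^1`. So `g(x) = ∑
□_k v(x)`. -/
theorem enorm_le_tsum_block {p : ℝ} (hp0 : 0 < p) (hp1 : p < 1) {g : E n → ℂ}
    {v : 𝓢'(E n, ℂ)} (hgv : Represents g v) {x : E n} (hg : ContinuousAt g x)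
    (hfin : ∑' k, eLpNorm (η.block k v) (ENNReal.ofReal p) volume ^ p ≠ ⊤) :
    ‖g x‖ₑ ≤ ∑' k, ‖η.block k v x‖ₑ := by
  obtain ⟨N, D, hD0, hD⟩ := η.exists_norm_block_le hp0 hp1 v
  set I : (Fin n → ℤ) → ℝ≥0∞ := fun k => eLpNorm (η.block k v) (ENNReal.ofReal p) volume
  have hItop : ∀ k, I k ≠ ⊤ := fun k hk => by
    refine ENNReal.ne_top_of_tsum_ne_top hfin k ?_
    change I k ^ p = ⊤
    rw [hk, ENNReal.top_rpow_of_pos hp0]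
  have hIsum : ∑' k, I k ≠ ⊤ :=
    ne_top_of_le_ne_top (ENNReal.rpow_ne_top_of_nonneg (by positivity) hfin)
      (tsum_le_tsum_rpow hp0 hp1.le I)
  have hIs : Summable fun k => (I k).toReal := ENNReal.summable_toReal hIsum
  obtain ⟨m, hm1, hm0⟩ := exists_schwartz_cutoff n one_pos
  set t : ℕ → ℝ := fun j => ((2 : ℝ) ^ j)⁻¹
  have ht : ∀ j, 0 < t j := fun j => by positivity
  have hlim := tendsto_conv_approxId hgv hg (𝓕⁻ m) ht two_pow_inv_le_one tendsto_two_pow_inv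
  rw [integral_fourierInv, hm1 0 (by simp), one_mul] at hlim
  set a : ℕ → (Fin n → ℤ) → ℂ := fun j k =>
    multiplier (symbolMul (scale (t j) (ht j).ne' m) (η.piece k)) v x with ha
  have hsum : ∀ j, conv (approxId (𝓕⁻ m) (t j) (ht j)) v x = ∑' k, a j k := by
    intro j
    obtain ⟨F, hF0, hF⟩ := η.exists_finset_symbolMul (scale (t j) (ht j).ne' m)
      (r := 2 / t j) (fun ξ hξ => by
        rw [scale_apply]
        refine hm0 _ ?_
        rw [norm_smul, Real.norm_of_nonneg (ht j).le]
        rw [div_le_iff₀ (ht j)] at hξ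
        linarith)
    rw [tsum_eq_sum (s := F) fun k hk => by simp only [ha, hF0 k hk, multiplier_zero]]
    simp only [ha]
    rw [← multiplier_sum, hF, multiplier, fourierInv_scale]
  have hform : ∀ j k, a j k = ∫ z, (𝓕⁻ m) z * η.block k v (x - t j • z) := by
    intro j k
    simp only [ha]
    rw [multiplier_symbolMul, fourierInv_scale m (ht j)]
    rw [integral_approxId_mul (𝓕⁻ m) (ht j) fun y => multiplier (η.piece k) v (x - y)]
    rfl
  set Q : ℝ := ∫ z, (1 + ‖z‖) ^ N * ‖(𝓕⁻ m) z‖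
  have hpt : ∀ j k z, ‖(𝓕⁻ m) z * η.block k v (x - t j • z)‖ ≤
      (D * (1 + ‖x‖) ^ N * (I k).toReal) * ((1 + ‖z‖) ^ N * ‖(𝓕⁻ m) z‖) := by
    intro j k z
    have h1 := hD k (hItop k) (x - t j • z)
    have h2 : 1 + ‖x - t j • z‖ ≤ (1 + ‖x‖) * (1 + ‖z‖) := by
      refine (one_add_norm_sub_le x _).trans ?_
      gcongr
      rw [norm_smul, Real.norm_of_nonneg (ht j).le]
      exact mul_le_of_le_one_left (norm_nonneg _) (two_pow_inv_le_one j)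
    rw [norm_mul]
    calc ‖(𝓕⁻ m) z‖ * ‖η.block k v (x - t j • z)‖
        ≤ ‖(𝓕⁻ m) z‖ * (D * (1 + ‖x - t j • z‖) ^ N * (I k).toReal) := by gcongr
      _ ≤ ‖(𝓕⁻ m) z‖ * (D * ((1 + ‖x‖) * (1 + ‖z‖)) ^ N * (I k).toReal) := by gcongr
      _ = _ := by rw [mul_pow]; ring
  have hint := integrable_one_add_norm_pow_mul (𝓕⁻ m) N
  have hterm : ∀ k, Tendsto (fun j => a j k) atTop (𝓝 (η.block k v x)) := by
    intro k
    simp only [hform]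
    have h1 : Tendsto (fun j => ∫ z, (𝓕⁻ m) z * η.block k v (x - t j • z)) atTop
        (𝓝 (∫ z, (𝓕⁻ m) z * η.block k v x)) := by
      refine tendsto_integral_of_dominated_convergence _ ?_ (hint.const_mul _)
        (fun j => Eventually.of_forall (hpt j k)) ?_
      · intro j
        refine Continuous.aestronglyMeasurable ((𝓕⁻ m).continuous.mul ?_)
        exact (continuous_multiplier _ v).comp (by fun_prop)
      · refine Eventually.of_forall fun z => Tendsto.const_mul _ ?_
        refine ((continuous_multiplier (η.piece k) v).tendsto x).comp ?_
        have := (tendsto_two_pow_inv.smul_const z).const_sub x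
        simpa using this
    rwa [integral_mul_const, integral_fourierInv, hm1 0 (by simp), one_mul] at h1
  have hbound : ∀ j k, ‖a j k‖ ≤ (D * (1 + ‖x‖) ^ N * Q) * (I k).toReal := by
    intro j k
    rw [hform]
    refine (norm_integral_le_of_norm_le (hint.const_mul _)
      (Eventually.of_forall (hpt j k))).trans ?_
    rw [integral_const_mul]
    exact le_of_eq (by ring)
  have hT := tendsto_tsum_of_dominated_convergence (hIs.mul_left _) hterm
    (Eventually.of_forall hbound)
  simp only [hsum] at hlim
  rw [tendsto_nhds_unique hlim hT]
  -- In the non-summable case the sum has the default value `0`, and the inequality is trivial.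
  by_cases hs : Summable fun k => η.block k v x
  · exact enorm_tsum_le_tsum_enorm
  · rw [tsum_eq_zero_of_not_summable hs]
    simp

end UniformCutoff

theorem eLpNorm_le_modulationNorm {n : ℕ} [Nontrivial (E n)] (η : UniformCutoff n) {p : ℝ}
    (hp0 : 0 < p) (hp1 : p < 1) {g : E n → ℂ} {v : 𝓢'(E n, ℂ)} (hgv : Represents g v)
    (hg : ∀ x, x ≠ 0 → ContinuousAt g x) :
    eLpNorm g (ENNReal.ofReal p) volume ≤ modulationNorm η p p v := by
  by_cases hfin : ∑' k, eLpNorm (η.block k v) (ENNReal.ofReal p) volume ^ p = ⊤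
  · rw [modulationNorm, hfin, ENNReal.top_rpow_of_pos (by positivity)]
    exact le_top
  · exact eLpNorm_le_of_enorm_le_tsum hp0 hp1.le (fun _ => continuous_multiplier _ v)
      fun x hx => η.enorm_le_tsum_block hp0 hp1 hgv (hg x hx) hfin

/-! ### Schwartz functions as distributions -/

theorem represents_coe {n : ℕ} (b : 𝓢(E n, ℂ)) : Represents b (b : 𝓢'(E n, ℂ)) := by
  refine ⟨b.continuous.locallyIntegrable, fun χ _ => ?_⟩
  rw [SchwartzMap.coe_apply]
  simp only [smul_eq_mul, mul_comm]

theorem conv_coe {n : ℕ} (ψ b : 𝓢(E n, ℂ)) (x : E n) :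
    conv ψ (b : 𝓢'(E n, ℂ)) x = ∫ z, ψ z * b (x - z) := by
  rw [conv, SchwartzMap.coe_apply,
    ← integral_sub_left_eq_self (fun y => reflectAt ψ x y • b y) volume x]
  simp only [reflectAt_apply, sub_sub_cancel, smul_eq_mul]

theorem conv_approxId_coe {n : ℕ} (ψ b : 𝓢(E n, ℂ)) {t : ℝ} (ht : 0 < t) (x : E n) :
    conv (approxId ψ t ht) (b : 𝓢'(E n, ℂ)) x = ∫ z, ψ z * b (x - t • z) := by
  rw [conv_coe, integral_approxId_mul ψ ht fun z => b (x - z)]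

theorem conv_translate {n : ℕ} (ψ b : 𝓢(E n, ℂ)) (a x : E n) :
    conv ψ (compSubConstCLM ℂ a b : 𝓢'(E n, ℂ)) x = conv ψ (b : 𝓢'(E n, ℂ)) (x - a) := by
  rw [conv_coe, conv_coe]
  simp only [compSubConstCLM_apply, sub_right_comm]

/-! ### Translation invariance of the quasi-norms -/

theorem eLpNorm_comp_sub {n : ℕ} {ε : Type*} [ENorm ε] {p : ℝ} (hp0 : 0 < p) (f : E n → ε)
    (a : E n) : eLpNorm (fun x => f (x - a)) (ENNReal.ofReal p) volume =
      eLpNorm f (ENNReal.ofReal p) volume := by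
  rw [eLpNorm_ofReal_eq hp0, eLpNorm_ofReal_eq hp0,
    lintegral_sub_right_eq_self (fun x => ‖f x‖ₑ ^ p) a]

theorem localHardyNorm_translate {n : ℕ} (ψ b : 𝓢(E n, ℂ)) {p : ℝ} (hp0 : 0 < p) (a : E n) :
    localHardyNorm ψ p (compSubConstCLM ℂ a b : 𝓢'(E n, ℂ)) =
      localHardyNorm ψ p (b : 𝓢'(E n, ℂ)) := by
  simp only [localHardyNorm, conv_translate]
  exact eLpNorm_comp_sub hp0
    (fun x => ⨆ t : Ioo (0 : ℝ) 1, ‖conv (approxId ψ t t.2.1) (b : 𝓢'(E n, ℂ)) x‖ₑ) a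

theorem besovNorm_translate {n : ℕ} (φ : DyadicCutoff n) (b : 𝓢(E n, ℂ)) {p : ℝ} (hp0 : 0 < p)
    (q : ℝ) (a : E n) : besovNorm φ p q (compSubConstCLM ℂ a b : 𝓢'(E n, ℂ)) =
      besovNorm φ p q (b : 𝓢'(E n, ℂ)) := by
  have h : ∀ j, φ.block j (compSubConstCLM ℂ a b : 𝓢'(E n, ℂ)) =
      fun x => φ.block j (b : 𝓢'(E n, ℂ)) (x - a) := fun j => funext fun x => conv_translate _ b a x
  simp only [besovNorm, h, eLpNorm_comp_sub hp0]

theorem triebelLizorkinNorm_translate {n : ℕ} (φ : DyadicCutoff n) (b : 𝓢(E n, ℂ)) {p : ℝ}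
    (hp0 : 0 < p) (q : ℝ) (a : E n) :
    triebelLizorkinNorm φ p q (compSubConstCLM ℂ a b : 𝓢'(E n, ℂ)) =
      triebelLizorkinNorm φ p q (b : 𝓢'(E n, ℂ)) := by
  have h : ∀ j x, φ.block j (compSubConstCLM ℂ a b : 𝓢'(E n, ℂ)) x =
      φ.block j (b : 𝓢'(E n, ℂ)) (x - a) := fun j x => conv_translate _ b a x
  simp only [triebelLizorkinNorm, h]
  exact eLpNorm_comp_sub hp0
    (fun x => (∑' j : ℕ, ‖φ.block j (b : 𝓢'(E n, ℂ)) x‖ₑ ^ q) ^ (1 / q)) a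

theorem modulationNorm_translate {n : ℕ} (η : UniformCutoff n) (b : 𝓢(E n, ℂ)) {p : ℝ}
    (hp0 : 0 < p) (q : ℝ) (a : E n) :
    modulationNorm η p q (compSubConstCLM ℂ a b : 𝓢'(E n, ℂ)) =
      modulationNorm η p q (b : 𝓢'(E n, ℂ)) := by
  have h : ∀ k, η.block k (compSubConstCLM ℂ a b : 𝓢'(E n, ℂ)) =
      fun x => η.block k (b : 𝓢'(E n, ℂ)) (x - a) := fun k => funext fun x => conv_translate _ b a x
  simp only [modulationNorm, h, eLpNorm_comp_sub hp0]

/-! ### Schwartz functions have finite quasi-norms -/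

/-- Any `M > n / p` makes `(1 + |x|)^{-M p}` integrable. `M` and `J` do not depend on `F`, so the
estimate can be summed over frequency pieces. -/
theorem exists_lintegral_rpow_le (n : ℕ) {p : ℝ} (hp0 : 0 < p) :
    ∃ (M : ℕ) (J : ℝ≥0∞), J ≠ ⊤ ∧ ∀ (C : ℝ) (F : E n → ℝ≥0∞), 0 ≤ C →
      (∀ x, F x ≤ ENNReal.ofReal (C / (1 + ‖x‖) ^ M)) →
      ∫⁻ x, F x ^ p ≤ ENNReal.ofReal (C ^ p) * J := by
  obtain ⟨M, hM⟩ := exists_nat_gt ((n : ℝ) / p)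
  rw [div_lt_iff₀ hp0] at hM
  refine ⟨M, ∫⁻ x : E n, ENNReal.ofReal ((1 + ‖x‖) ^ (-(M * p))),
    (finite_integral_one_add_norm (by simpa using hM)).ne, fun C F hC hF => ?_⟩
  rw [← lintegral_const_mul' _ _ ENNReal.ofReal_ne_top]
  refine lintegral_mono fun x => ?_
  refine (ENNReal.rpow_le_rpow (hF x) hp0.le).trans ?_
  have h1 : 0 ≤ 1 + ‖x‖ := by positivity
  rw [ENNReal.ofReal_rpow_of_nonneg (by positivity) hp0.le, ← ENNReal.ofReal_mul (by positivity),
    Real.div_rpow hC (by positivity), Real.rpow_neg h1, Real.rpow_mul h1, Real.rpow_natCast,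
    div_eq_mul_inv]

theorem exists_decay_sub {n : ℕ} (b : 𝓢(E n, ℂ)) (M l : ℕ) :
    ∃ C, 0 ≤ C ∧ ∀ x y, (1 + ‖x‖) ^ M * ‖iteratedFDeriv ℝ l b (x - y)‖ ≤ C * (1 + ‖y‖) ^ M := by
  obtain ⟨C, hC, h⟩ := exists_decay_iteratedFDeriv b M l
  refine ⟨C, hC, fun x y => ?_⟩
  have h1 := one_add_norm_le_mul y x
  rw [norm_sub_rev] at h1
  calc (1 + ‖x‖) ^ M * ‖iteratedFDeriv ℝ l b (x - y)‖
      ≤ ((1 + ‖y‖) * (1 + ‖x - y‖)) ^ M * ‖iteratedFDeriv ℝ l b (x - y)‖ := by gcongr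
    _ = (1 + ‖y‖) ^ M * ((1 + ‖x - y‖) ^ M * ‖iteratedFDeriv ℝ l b (x - y)‖) := by
        rw [mul_pow]; ring
    _ ≤ (1 + ‖y‖) ^ M * C := by gcongr; exact h _
    _ = _ := mul_comm _ _

theorem norm_smul_le_of_le_one {n : ℕ} {t : ℝ} (ht : 0 < t) (ht1 : t ≤ 1) (z : E n) :
    ‖t • z‖ ≤ ‖z‖ := by
  rw [norm_smul, Real.norm_of_nonneg ht.le]
  exact mul_le_of_le_one_left (norm_nonneg _) ht1

theorem norm_integral_mul_le {n : ℕ} (ψ : 𝓢(E n, ℂ)) {G : E n → ℂ} {A : ℝ} {N : ℕ}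
    (h : ∀ z, ‖G z‖ ≤ A * (1 + ‖z‖) ^ N) :
    ‖∫ z, ψ z * G z‖ ≤ A * ∫ z, (1 + ‖z‖) ^ N * ‖ψ z‖ := by
  rw [← integral_const_mul]
  refine norm_integral_le_of_norm_le ((integrable_one_add_norm_pow_mul ψ N).const_mul A)
    (Eventually.of_forall fun z => ?_)
  rw [norm_mul]
  calc ‖ψ z‖ * ‖G z‖ ≤ ‖ψ z‖ * (A * (1 + ‖z‖) ^ N) := by gcongr; exact h z
    _ = _ := by ring

theorem exists_norm_conv_approxId_le {n : ℕ} (ψ b : 𝓢(E n, ℂ)) (M : ℕ) :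
    ∃ C, 0 ≤ C ∧ ∀ t (ht : 0 < t), t ≤ 1 → ∀ x,
      ‖conv (approxId ψ t ht) (b : 𝓢'(E n, ℂ)) x‖ ≤ C / (1 + ‖x‖) ^ M := by
  obtain ⟨C, hC, h⟩ := exists_decay_sub b M 0
  refine ⟨C * ∫ z, (1 + ‖z‖) ^ M * ‖ψ z‖, by positivity, fun t ht ht1 x => ?_⟩
  rw [conv_approxId_coe, mul_div_right_comm]
  refine norm_integral_mul_le ψ fun z => ?_
  have h1 := h x (t • z)
  rw [norm_iteratedFDeriv_zero] at h1
  rw [div_mul_eq_mul_div, le_div_iff₀ (by positivity), mul_comm]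
  refine h1.trans ?_
  gcongr
  exact norm_smul_le_of_le_one ht ht1 z

theorem localHardyNorm_coe_lt_top {n : ℕ} (ψ b : 𝓢(E n, ℂ)) {p : ℝ} (hp0 : 0 < p) :
    localHardyNorm ψ p (b : 𝓢'(E n, ℂ)) < ⊤ := by
  obtain ⟨M, J, hJ, h⟩ := exists_lintegral_rpow_le n hp0
  obtain ⟨C, hC, hb⟩ := exists_norm_conv_approxId_le ψ b M
  rw [localHardyNorm, eLpNorm_ofReal_eq hp0]
  refine ENNReal.rpow_lt_top_of_nonneg (by positivity) (ne_top_of_le_ne_top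
    (ENNReal.mul_ne_top ENNReal.ofReal_ne_top hJ) (h C _ hC fun x => ?_))
  rw [enorm_eq_self]
  refine iSup_le fun t => ?_
  rw [← ofReal_norm]
  exact ENNReal.ofReal_le_ofReal (hb t t.2.1 t.2.2.le x)

/-- Both points lie in the ball of radius `|z|` about `x` and are `s |z|` apart. The factor `s`
becomes the geometric decay `2⁻ʲ` of the blocks, which is summable after raising to any power `p >
0`. -/
theorem exists_norm_sub_le {n : ℕ} (b : 𝓢(E n, ℂ)) (M : ℕ) :
    ∃ C, 0 ≤ C ∧ ∀ x z (s : ℝ), 0 < s → 2 * s ≤ 1 →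
      ‖b (x - s • z) - b (x - (2 * s) • z)‖ ≤ C * s / (1 + ‖x‖) ^ M * (1 + ‖z‖) ^ (M + 1) := by
  obtain ⟨C, hC, h⟩ := exists_decay_sub b M 1
  refine ⟨C, hC, fun x z s hs hs1 => ?_⟩
  have hb : ∀ v ∈ Metric.closedBall x ‖z‖,
      ‖fderiv ℝ b v‖ ≤ C * (1 + ‖z‖) ^ M / (1 + ‖x‖) ^ M := by
    intro v hv
    have h1 := h x (x - v)
    rw [sub_sub_cancel, norm_iteratedFDeriv_one] at h1
    rw [le_div_iff₀ (by positivity), mul_comm]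
    refine h1.trans ?_
    gcongr
    rw [norm_sub_rev]
    simpa [dist_eq_norm] using hv
  have hmv := (convex_closedBall x ‖z‖).norm_image_sub_le_of_norm_fderiv_le
    (fun v _ => b.differentiableAt) hb
    (show x - (2 * s) • z ∈ Metric.closedBall x ‖z‖ by
      simpa [dist_eq_norm] using norm_smul_le_of_le_one (by positivity) hs1 z)
    (show x - s • z ∈ Metric.closedBall x ‖z‖ by
      simpa [dist_eq_norm] using norm_smul_le_of_le_one hs (by linarith) z)
  have he : ‖x - s • z - (x - (2 * s) • z)‖ = s * ‖z‖ := by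
    rw [show x - s • z - (x - (2 * s) • z) = s • z by module, norm_smul,
      Real.norm_of_nonneg hs.le]
  rw [he] at hmv
  refine hmv.trans ?_
  calc C * (1 + ‖z‖) ^ M / (1 + ‖x‖) ^ M * (s * ‖z‖)
      ≤ C * (1 + ‖z‖) ^ M / (1 + ‖x‖) ^ M * (s * (1 + ‖z‖)) := by gcongr; linarith
    _ = _ := by rw [pow_succ]; ring

namespace DyadicCutoff

variable {n : ℕ} (φ : DyadicCutoff n)

/-- With `θ = 𝓕⁻¹ φ` and `s = 2⁻ʲ`, the kernel of `Δ_j` for `j ≥ 1` is `θ_s - θ_{2s}`, so the block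
averages `b(x - s z) - b(x - 2 s z)` against `θ`. -/
theorem exists_norm_block_le (b : 𝓢(E n, ℂ)) (M : ℕ) :
    ∃ C, 0 ≤ C ∧ ∀ j x,
      ‖φ.block j (b : 𝓢'(E n, ℂ)) x‖ ≤ C * ((2 : ℝ) ^ j)⁻¹ / (1 + ‖x‖) ^ M := by
  set θ := 𝓕⁻ φ.toSchwartz
  obtain ⟨C₀, hC₀, h₀⟩ := exists_norm_conv_approxId_le θ b M
  obtain ⟨C₁, hC₁, h₁⟩ := exists_norm_sub_le b M
  set Q : ℝ := ∫ z, (1 + ‖z‖) ^ (M + 1) * ‖θ z‖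
  have hQ : 0 ≤ Q := by positivity
  refine ⟨C₀ + C₁ * Q, by positivity, fun j x => ?_⟩
  rcases Nat.eq_zero_or_pos j with rfl | hj
  · have h2 : φ.block 0 (b : 𝓢'(E n, ℂ)) x = conv (approxId θ 1 one_pos) b x := by
      have : approxId θ 1 one_pos = θ := by
        ext y
        simp [approxId_apply]
      rw [this, block, multiplier, piece, if_pos rfl]
    rw [h2]
    refine (h₀ 1 one_pos le_rfl x).trans ?_
    rw [pow_zero, inv_one, mul_one]
    gcongr
    nlinarith
  · set s : ℝ := ((2 : ℝ) ^ j)⁻¹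
    have hs : 0 < s := by positivity
    have hs1 : 2 * s ≤ 1 := by
      have h2 : (2 : ℝ) ^ 1 ≤ 2 ^ j := pow_le_pow_right₀ one_le_two hj
      rw [pow_one] at h2
      rw [← div_eq_mul_inv]
      exact div_le_one_of_le₀ h2 (by positivity)
    have hcont : ∀ c : ℝ, Integrable fun z => θ z * b (x - c • z) := fun c => by
      obtain ⟨B, hB0, hB⟩ := exists_decay b 0
      refine ((integrable_one_add_norm_pow_mul θ 0).const_mul B).mono'
        (Continuous.aestronglyMeasurable (θ.continuous.mul (b.continuous.comp (by fun_prop))))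
        (Eventually.of_forall fun z => ?_)
      have h3 := hB (x - c • z)
      rw [pow_zero, one_mul] at h3 ⊢
      rw [norm_mul, mul_comm]
      gcongr
    have h2 : φ.block j (b : 𝓢'(E n, ℂ)) x =
        ∫ z, θ z * (b (x - s • z) - b (x - (2 * s) • z)) := by
      have h3 : φ.block j (b : 𝓢'(E n, ℂ)) x = conv (approxId θ s hs) b x -
          conv (approxId θ (2 * s) (by positivity)) b x := by
        rw [block, multiplier, piece, if_neg hj.ne', ← fourierInvCLM_apply (R := ℂ), map_sub,
          fourierInvCLM_apply, fourierInvCLM_apply, fourierInv_scale _ hs,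
          fourierInv_scale _ (mul_pos two_pos hs), conv, conv, conv, ← map_sub]
        congr 1
      rw [h3, conv_approxId_coe, conv_approxId_coe, ← integral_sub (hcont _) (hcont _)]
      simp only [mul_sub]
    rw [h2]
    refine (norm_integral_mul_le θ fun z => h₁ x z s hs hs1).trans ?_
    calc C₁ * s / (1 + ‖x‖) ^ M * Q = (C₁ * Q) * s / (1 + ‖x‖) ^ M := by ring
      _ ≤ _ := by
        gcongr
        linarith

theorem tsum_lintegral_block_ne_top (b : 𝓢(E n, ℂ)) {p : ℝ} (hp0 : 0 < p) :
    ∑' j, ∫⁻ x, ‖φ.block j (b : 𝓢'(E n, ℂ)) x‖ₑ ^ p ≠ ⊤ := by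
  obtain ⟨M, J, hJ, h⟩ := exists_lintegral_rpow_le n hp0
  obtain ⟨C, hC, hb⟩ := φ.exists_norm_block_le b M
  have h1 : ∀ j, ∫⁻ x, ‖φ.block j (b : 𝓢'(E n, ℂ)) x‖ₑ ^ p ≤
      ENNReal.ofReal ((C * ((2 : ℝ) ^ j)⁻¹) ^ p) * J := fun j =>
    h _ _ (by positivity) fun x => by
      rw [← ofReal_norm]
      exact ENNReal.ofReal_le_ofReal (hb j x)
  refine ne_top_of_le_ne_top ?_ (ENNReal.tsum_le_tsum h1)
  rw [ENNReal.tsum_mul_right]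
  refine ENNReal.mul_ne_top (Summable.tsum_ofReal_ne_top ?_) hJ
  have h2 : ∀ j : ℕ, (C * ((2 : ℝ) ^ j)⁻¹) ^ p = C ^ p * (((2 : ℝ)⁻¹) ^ p) ^ j := fun j => by
    rw [Real.mul_rpow hC (by positivity), ← inv_pow, ← Real.rpow_natCast,
      ← Real.rpow_natCast (_ ^ p), ← Real.rpow_mul (by positivity), ← Real.rpow_mul (by positivity),
      mul_comm p]
  simp only [h2]
  exact (summable_geometric_of_lt_one (by positivity)
    (Real.rpow_lt_one (by norm_num) (by norm_num) hp0)).mul_left _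

end DyadicCutoff

theorem besovNorm_coe_lt_top {n : ℕ} (φ : DyadicCutoff n) (b : 𝓢(E n, ℂ)) {p : ℝ} (hp0 : 0 < p) :
    besovNorm φ p p (b : 𝓢'(E n, ℂ)) < ⊤ := by
  simp only [besovNorm, eLpNorm_ofReal_rpow hp0]
  exact ENNReal.rpow_lt_top_of_nonneg (by positivity) (φ.tsum_lintegral_block_ne_top b hp0)

theorem triebelLizorkinNorm_coe_lt_top {n : ℕ} (φ : DyadicCutoff n) (b : 𝓢(E n, ℂ)) {p : ℝ}
    (hp0 : 0 < p) : triebelLizorkinNorm φ p p (b : 𝓢'(E n, ℂ)) < ⊤ := by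
  rw [triebelLizorkinNorm, eLpNorm_ofReal_eq hp0]
  refine ENNReal.rpow_lt_top_of_nonneg (by positivity) ?_
  simp only [enorm_eq_self, ← ENNReal.rpow_mul, one_div, inv_mul_cancel₀ hp0.ne', ENNReal.rpow_one]
  rw [lintegral_tsum fun j => (Measurable.pow_const (Measurable.enorm
    (show Continuous (φ.block j (b : 𝓢'(E n, ℂ))) from continuous_multiplier _ _).measurable)
    p).aemeasurable]
  exact φ.tsum_lintegral_block_ne_top b hp0

/-! ### Finiteness of the modulation quasi-norm -/

/-- In `κ(x - y) b(y)` either `y` or `x - y` is large when `x` is; the Leibniz rule and Peetre's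
inequality make this decay quantitative. -/
theorem exists_seminorm_mul_reflectAt_le {n : ℕ} (κ b : 𝓢(E n, ℂ)) (M a l : ℕ) :
    ∃ C, 0 ≤ C ∧ ∀ x,
      SchwartzMap.seminorm ℂ a l (symbolMul (reflectAt κ x) b) ≤ C / (1 + ‖x‖) ^ M := by
  choose A hA0 hA using fun i => exists_decay_iteratedFDeriv κ M i
  choose B hB0 hB using fun i => exists_decay_iteratedFDeriv b (a + M) i
  have hnn : 0 ≤ ∑ i ∈ Finset.range (l + 1), (l.choose i : ℝ) * (A i * B (l - i)) :=
    Finset.sum_nonneg fun i _ => mul_nonneg (by positivity) (mul_nonneg (hA0 _) (hB0 _))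
  refine ⟨_, hnn, fun x => seminorm_le_bound ℂ a l _ (div_nonneg hnn (by positivity)) fun y => ?_⟩
  have h1 := norm_iteratedFDeriv_mul_le (𝕜 := ℝ) ((reflectAt κ x).smooth ⊤) (b.smooth ⊤) y
    (n := l) (by exact_mod_cast le_top)
  change ‖y‖ ^ a * ‖iteratedFDeriv ℝ l (fun y => reflectAt κ x y * b y) y‖ ≤ _
  rw [le_div_iff₀ (by positivity)]
  have h2 := one_add_norm_le_mul y x
  rw [norm_sub_rev] at h2
  have h3 : ‖y‖ ≤ 1 + ‖y‖ := by linarith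
  calc ‖y‖ ^ a * ‖iteratedFDeriv ℝ l (fun y => reflectAt κ x y * b y) y‖ * (1 + ‖x‖) ^ M
      ≤ (1 + ‖y‖) ^ a * (∑ i ∈ Finset.range (l + 1), (l.choose i : ℝ) *
          ‖iteratedFDeriv ℝ i (reflectAt κ x) y‖ * ‖iteratedFDeriv ℝ (l - i) b y‖) *
          ((1 + ‖y‖) * (1 + ‖x - y‖)) ^ M := by gcongr
    _ = ∑ i ∈ Finset.range (l + 1), (l.choose i : ℝ) *
          (((1 + ‖x - y‖) ^ M * ‖iteratedFDeriv ℝ i κ (x - y)‖) *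
            ((1 + ‖y‖) ^ (a + M) * ‖iteratedFDeriv ℝ (l - i) b y‖)) := by
        rw [Finset.mul_sum, Finset.sum_mul]
        refine Finset.sum_congr rfl fun i _ => ?_
        rw [norm_iteratedFDeriv_reflectAt, mul_pow, pow_add]
        ring
    _ ≤ _ := by
        gcongr with i
        · exact hA0 i
        · exact hA i _
        · exact hB _ _

theorem exists_norm_fourier_le (n L : ℕ) : ∃ (s : Finset (ℕ × ℕ)) (C : ℝ), 0 ≤ C ∧
    ∀ (f : 𝓢(E n, ℂ)) (ξ : E n),
      (1 + ‖ξ‖) ^ L * ‖(𝓕 f) ξ‖ ≤ C * ∑ i ∈ s, SchwartzMap.seminorm ℂ i.1 i.2 f := by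
  obtain ⟨s, C, -, h⟩ := Seminorm.bound_of_continuous (schwartz_withSeminorms ℂ (E n) ℂ)
    (((Finset.Iic (L, 0)).sup (schwartzSeminormFamily ℂ (E n) ℂ)).comp
      (fourierCLM ℂ 𝓢(E n, ℂ) : 𝓢(E n, ℂ) →ₗ[ℂ] 𝓢(E n, ℂ))) (by
      exact ((schwartz_withSeminorms ℂ (E n) ℂ).finset_sups.continuous_seminorm _).comp
        (fourierCLM ℂ 𝓢(E n, ℂ)).continuous)
  refine ⟨s, 2 ^ L * C, by positivity, fun f ξ => ?_⟩
  have h1 := one_add_le_sup_seminorm_apply (𝕜 := ℂ) (m := (L, 0)) le_rfl le_rfl (𝓕 f) ξ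
  rw [norm_iteratedFDeriv_zero] at h1
  have h2 := Seminorm.finset_sup_le_sum (schwartzSeminormFamily ℂ (E n) ℂ) s f
  simp only [FunLike.coe_sum, Finset.sum_apply, schwartzSeminormFamily] at h2
  calc (1 + ‖ξ‖) ^ L * ‖(𝓕 f) ξ‖
      ≤ 2 ^ L * (Finset.Iic (L, 0)).sup (schwartzSeminormFamily ℂ (E n) ℂ) (𝓕 f) := h1
    _ ≤ 2 ^ L * (C * (s.sup (schwartzSeminormFamily ℂ (E n) ℂ)) f) := by
        gcongr
        exact h f
    _ ≤ 2 ^ L * (C * ∑ i ∈ s, SchwartzMap.seminorm ℂ i.1 i.2 f) := by gcongr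
    _ = _ := by ring

theorem latticePoint_injective (n : ℕ) : Function.Injective (latticePoint (n := n)) := by
  intro k l h
  ext i
  have := congrArg (fun v : E n => v i) h
  simpa [latticePoint] using this

/-- Away from `k = 0`, compare with the lattice sum `∑ |z|^{-r}`, which converges for `r` above the
rank. -/
theorem summable_latticePoint (n : ℕ) {r : ℝ} (hr : (n : ℝ) < r) :
    Summable fun k : Fin n → ℤ => (1 + ‖latticePoint k‖) ^ (-r) := by
  set L := Submodule.span ℤ (Set.range (EuclideanSpace.basisFun (Fin n) ℝ).toBasis)
  have hmem : ∀ k : Fin n → ℤ, latticePoint k ∈ L := fun k => by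
    rw [Module.Basis.mem_span_iff_repr_mem]
    intro i
    exact ⟨k i, by simp [latticePoint]⟩
  have h1 : Summable fun z : L => ‖z‖ ^ (-r) := by
    refine ZLattice.summable_norm_rpow L (-r) ?_
    rw [ZLattice.rank ℝ, finrank_euclideanSpace, Fintype.card_fin]
    linarith
  have h2 := h1.comp_injective (i := fun k : Fin n → ℤ => (⟨latticePoint k, hmem k⟩ : L))
    fun k l h => latticePoint_injective n (congrArg Subtype.val h)
  refine Summable.of_norm_bounded_eventually h2 ?_
  have h3 : ({0}ᶜ : Set (Fin n → ℤ)) ∈ cofinite := (finite_singleton 0).compl_mem_cofinite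
  filter_upwards [h3] with k hk
  have hk0 : 0 < ‖latticePoint k‖ := norm_pos_iff.2 fun h0 => hk
    (latticePoint_injective n (h0.trans (by ext i; simp [latticePoint])))
  rw [Real.norm_of_nonneg (by positivity)]
  change _ ≤ ‖latticePoint k‖ ^ (-r)
  exact Real.rpow_le_rpow_of_nonpos hk0 (by linarith) (by
    have : (0 : ℝ) ≤ n := n.cast_nonneg
    linarith)

namespace UniformCutoff

variable {n : ℕ} (η : UniformCutoff n)

/-- Up to a phase, `□_k b(x)` is a short-time Fourier transform: the transform at `k` of `b` times a
window centred at `x`. Rapid decay in both `k` and `x` follows. -/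
theorem norm_block_coe (b : 𝓢(E n, ℂ)) (k : Fin n → ℤ) (x : E n) :
    ‖η.block k (b : 𝓢'(E n, ℂ)) x‖ =
      ‖(𝓕 (symbolMul (reflectAt (𝓕⁻ η.windowSchwartz) x) b)) (latticePoint k)‖ := by
  have h : η.block k (b : 𝓢'(E n, ℂ)) x =
      Complex.exp (↑(2 * Real.pi * inner ℝ (latticePoint k) x) * Complex.I) *
        (𝓕 (symbolMul (reflectAt (𝓕⁻ η.windowSchwartz) x) b)) (latticePoint k) := by
    rw [block, multiplier, conv, SchwartzMap.coe_apply, fourier_coe, Real.fourier_eq',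
      ← integral_const_mul]
    congr 1 with y
    rw [reflectAt_apply, piece, fourierInv_translate, symbolMul_apply, reflectAt_apply,
      smul_eq_mul, smul_eq_mul, ← mul_assoc, ← mul_assoc, ← Complex.exp_add, inner_sub_right,
      real_inner_comm y]
    congr 3
    push_cast
    ring
  rw [h, norm_mul, Complex.norm_exp_ofReal_mul_I, one_mul]

theorem exists_norm_block_coe_le (b : 𝓢(E n, ℂ)) (M L : ℕ) :
    ∃ C, 0 ≤ C ∧ ∀ k x, ‖η.block k (b : 𝓢'(E n, ℂ)) x‖ ≤
      C / (1 + ‖latticePoint k‖) ^ L / (1 + ‖x‖) ^ M := by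
  obtain ⟨s, C, hC, h⟩ := exists_norm_fourier_le n L
  choose B hB0 hB using fun i : ℕ × ℕ =>
    exists_seminorm_mul_reflectAt_le (𝓕⁻ η.windowSchwartz) b M i.1 i.2
  refine ⟨C * ∑ i ∈ s, B i, mul_nonneg hC (Finset.sum_nonneg fun i _ => hB0 i), fun k x => ?_⟩
  rw [norm_block_coe, div_right_comm, le_div_iff₀ (by positivity), mul_comm]
  refine (h _ _).trans ?_
  rw [mul_div_assoc, Finset.sum_div]
  gcongr with i
  exact hB i x

end UniformCutoff

theorem modulationNorm_coe_lt_top {n : ℕ} (η : UniformCutoff n) (b : 𝓢(E n, ℂ)) {p : ℝ}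
    (hp0 : 0 < p) : modulationNorm η p p (b : 𝓢'(E n, ℂ)) < ⊤ := by
  obtain ⟨M, J, hJ, h⟩ := exists_lintegral_rpow_le n hp0
  obtain ⟨L, hL⟩ := exists_nat_gt ((n : ℝ) / p)
  rw [div_lt_iff₀ hp0] at hL
  obtain ⟨C, hC, hb⟩ := η.exists_norm_block_coe_le b M L
  simp only [modulationNorm, eLpNorm_ofReal_rpow hp0]
  refine ENNReal.rpow_lt_top_of_nonneg (by positivity) ?_
  have h1 : ∀ k, ∫⁻ x, ‖η.block k (b : 𝓢'(E n, ℂ)) x‖ₑ ^ p ≤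
      ENNReal.ofReal ((C / (1 + ‖latticePoint k‖) ^ L) ^ p) * J := fun k =>
    h _ _ (by positivity) fun x => by
      rw [← ofReal_norm]
      exact ENNReal.ofReal_le_ofReal (hb k x)
  refine ne_top_of_le_ne_top ?_ (ENNReal.tsum_le_tsum h1)
  rw [ENNReal.tsum_mul_right]
  refine ENNReal.mul_ne_top (Summable.tsum_ofReal_ne_top ?_) hJ
  have h2 : ∀ k : Fin n → ℤ, (C / (1 + ‖latticePoint k‖) ^ L) ^ p =
      C ^ p * (1 + ‖latticePoint k‖) ^ (-(L * p)) := fun k => by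
    have h3 : 0 ≤ 1 + ‖latticePoint k‖ := by positivity
    rw [Real.div_rpow hC (by positivity), Real.rpow_neg h3, Real.rpow_mul h3, Real.rpow_natCast,
      div_eq_mul_inv]
  simp only [h2]
  exact (summable_latticePoint n hL).mul_left _

/-! ### Bounded Hausdorff operators vanish -/

theorem boundedOn_of_isZeroOperator {n : ℕ} {N : 𝓢'(E n, ℂ) → ℝ≥0∞} (hN : N 0 = 0)
    {Φ : E n → ℂ} (hz : IsZeroOperator Φ) {𝒟 : Set (E n → ℂ)} (h𝒟 : 𝒟 ⊆ naturalDomain Φ) :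
    BoundedOn N Φ 𝒟 := by
  refine ⟨0, fun f hf u _ _ => ⟨0, ⟨?_, fun χ _ => ?_⟩, by simp [hN], by simp [hN]⟩⟩
  · exact locallyIntegrable_zero.congr (hz f (h𝒟 hf)).symm
  · rw [integral_eq_zero_of_ae]
    · rfl
    · filter_upwards [hz f (h𝒟 hf)] with x hx
      rw [hx]
      simp

/-- All bumps are translates of `boxBump`, so they share one finite quasi-norm; boundedness and the
embedding `hemb` then bound their images uniformly in `L^p`. -/
theorem isZeroOperator_of_boundedOn {m : ℕ} {p : ℝ} (hp0 : 0 < p) (hp1 : p < 1)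
    {Φ : E (m + 1) → ℂ} (hΦ : LocallyIntegrableOn Φ {0}ᶜ volume) {𝒟 : Set (E (m + 1) → ℂ)}
    (h𝒟 : testFunctions (m + 1) ⊆ 𝒟) {N : 𝓢'(E (m + 1), ℂ) → ℝ≥0∞} {A : ℝ≥0∞} (hA : A ≠ ⊤)
    (hemb : ∀ (g : E (m + 1) → ℂ) v, Represents g v → (∀ x, x ≠ 0 → ContinuousAt g x) →
      eLpNorm g (ENNReal.ofReal p) volume ≤ A * N v)
    (hfin : ∀ b : 𝓢(E (m + 1), ℂ), N b < ⊤)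
    (htrans : ∀ (b : 𝓢(E (m + 1), ℂ)) a, N (compSubConstCLM ℂ a b : 𝓢(E (m + 1), ℂ)) = N b)
    (hb : BoundedOn N Φ 𝒟) : IsZeroOperator Φ := by
  obtain ⟨C, hC⟩ := hb
  refine isZeroOperator_of_bumpAt_bounded hp0 hp1 hΦ (C := A * (C * N (boxBump (m + 1))))
    (ENNReal.mul_ne_top hA (ENNReal.mul_ne_top ENNReal.coe_ne_top (hfin _).ne)) fun R hR => ?_
  have hmem := bumpAt_mem_testFunctions m (R := R) (by exact_mod_cast hR)
  obtain ⟨v, hv, -, hle⟩ := hC _ (h𝒟 hmem) _ (represents_coe _) (hfin _)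
  refine (hemb _ v hv fun x hx => continuousAt_hausdorff hΦ hmem hx).trans ?_
  rw [bumpAt, htrans] at hle
  gcongr

theorem boundedOn_iff {m : ℕ} {p : ℝ} (hp0 : 0 < p) (hp1 : p < 1)
    {Φ : E (m + 1) → ℂ} (hΦ : LocallyIntegrableOn Φ {0}ᶜ volume) {𝒟 : Set (E (m + 1) → ℂ)}
    (h𝒟 : testFunctions (m + 1) ⊆ 𝒟) (h𝒟' : 𝒟 ⊆ naturalDomain Φ)
    {N : 𝓢'(E (m + 1), ℂ) → ℝ≥0∞} (hN : N 0 = 0) {A : ℝ≥0∞} (hA : A ≠ ⊤)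
    (hemb : ∀ (g : E (m + 1) → ℂ) v, Represents g v → (∀ x, x ≠ 0 → ContinuousAt g x) →
      eLpNorm g (ENNReal.ofReal p) volume ≤ A * N v)
    (hfin : ∀ b : 𝓢(E (m + 1), ℂ), N b < ⊤)
    (htrans : ∀ (b : 𝓢(E (m + 1), ℂ)) a, N (compSubConstCLM ℂ a b : 𝓢(E (m + 1), ℂ)) = N b) :
    BoundedOn N Φ 𝒟 ↔ IsZeroOperator Φ :=
  ⟨isZeroOperator_of_boundedOn hp0 hp1 hΦ h𝒟 hA hemb hfin htrans,
    fun hz => boundedOn_of_isZeroOperator hN hz h𝒟'⟩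

theorem boundedOnLp_iff {m : ℕ} {p : ℝ} (hp0 : 0 < p) (hp1 : p < 1)
    {Φ : E (m + 1) → ℂ} (hΦ : LocallyIntegrableOn Φ {0}ᶜ volume) {𝒟 : Set (E (m + 1) → ℂ)}
    (h𝒟 : testFunctions (m + 1) ⊆ 𝒟) (h𝒟' : 𝒟 ⊆ naturalDomain Φ) :
    BoundedOnLp p Φ 𝒟 ↔ IsZeroOperator Φ := by
  constructor
  · rintro ⟨C, hC⟩
    have hmemLp : ∀ b : 𝓢(E (m + 1), ℂ), MemLp b (ENNReal.ofReal p) volume :=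
      fun b => b.memLp _ _
    refine isZeroOperator_of_bumpAt_bounded hp0 hp1 hΦ
      (C := C * eLpNorm (boxBump (m + 1)) (ENNReal.ofReal p) volume)
      (ENNReal.mul_ne_top ENNReal.coe_ne_top (hmemLp _).2.ne) fun R hR => ?_
    refine (hC _ (h𝒟 (bumpAt_mem_testFunctions m (R := R) (by exact_mod_cast hR)))
      (hmemLp _)).2.trans (le_of_eq ?_)
    congr 1
    exact eLpNorm_comp_sub hp0 (boxBump (m + 1)) _
  · intro hz
    refine ⟨0, fun f hf _ => ⟨?_, ?_⟩⟩
    · exact MemLp.zero.ae_eq (hz f (h𝒟' hf)).symm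
    · rw [eLpNorm_congr_ae (hz f (h𝒟' hf))]
      simp

/-! ### The quasi-norms of the zero distribution. -/

theorem conv_zero_right {n : ℕ} (ψ : 𝓢(E n, ℂ)) (x : E n) : conv ψ (0 : 𝓢'(E n, ℂ)) x = 0 := rfl

theorem localHardyNorm_zero {n : ℕ} (ψ : 𝓢(E n, ℂ)) (p : ℝ) :
    localHardyNorm ψ p (0 : 𝓢'(E n, ℂ)) = 0 := by
  simp only [localHardyNorm, conv_zero_right, enorm_zero, ← bot_eq_zero, iSup_bot]
  simp only [bot_eq_zero]
  exact eLpNorm_zero' (ε := ℝ≥0∞)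

theorem besovNorm_zero {n : ℕ} (φ : DyadicCutoff n) {p : ℝ} (hp0 : 0 < p) :
    besovNorm φ p p (0 : 𝓢'(E n, ℂ)) = 0 := by
  have h : ∀ j, φ.block j (0 : 𝓢'(E n, ℂ)) = 0 := fun j => rfl
  simp [besovNorm, h, hp0]

theorem triebelLizorkinNorm_zero {n : ℕ} (φ : DyadicCutoff n) {p : ℝ} (hp0 : 0 < p) :
    triebelLizorkinNorm φ p p (0 : 𝓢'(E n, ℂ)) = 0 := by
  have h : ∀ j, φ.block j (0 : 𝓢'(E n, ℂ)) = 0 := fun j => rfl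
  simp [triebelLizorkinNorm, h, hp0]

theorem modulationNorm_zero {n : ℕ} (η : UniformCutoff n) {p : ℝ} (hp0 : 0 < p) :
    modulationNorm η p p (0 : 𝓢'(E n, ℂ)) = 0 := by
  have h : ∀ k, η.block k (0 : 𝓢'(E n, ℂ)) = 0 := fun k => rfl
  simp [modulationNorm, h, hp0]

end Hausdorff

end

/-! ### The five equivalences. -/

theorem mainTheorem4 (n : ℕ) (hn : 1 ≤ n) (p : ℝ) (hp0 : 0 < p) (hp1 : p < 1)
    (Φ : Hausdorff.E n → ℂ) (hΦ : LocallyIntegrableOn Φ {0}ᶜ volume)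
    (𝒟 : Set (Hausdorff.E n → ℂ)) (h𝒟 : Hausdorff.testFunctions n ⊆ 𝒟)
    (h𝒟' : 𝒟 ⊆ Hausdorff.naturalDomain Φ)
    (ψ : 𝓢(Hausdorff.E n, ℂ)) (hψ : (∫ x, ψ x) ≠ 0)
    (φ : Hausdorff.DyadicCutoff n) (η : Hausdorff.UniformCutoff n) :
    (Hausdorff.BoundedOnLp p Φ 𝒟 ↔ Hausdorff.IsZeroOperator Φ) ∧
    (Hausdorff.BoundedOn (Hausdorff.localHardyNorm ψ p) Φ 𝒟 ↔ Hausdorff.IsZeroOperator Φ) ∧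
    (Hausdorff.BoundedOn (Hausdorff.modulationNorm η p p) Φ 𝒟 ↔ Hausdorff.IsZeroOperator Φ) ∧
    (Hausdorff.BoundedOn (Hausdorff.besovNorm φ p p) Φ 𝒟 ↔ Hausdorff.IsZeroOperator Φ) ∧
    (Hausdorff.BoundedOn (Hausdorff.triebelLizorkinNorm φ p p) Φ 𝒟 ↔
      Hausdorff.IsZeroOperator Φ) := by
  -- Writing `n = m + 1` singles out the coordinate along which the bumps move; the `m` transverse
  -- ones form the cross-section of the box.
  obtain ⟨m, rfl⟩ : ∃ m, n = m + 1 := ⟨n - 1, by omega⟩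
  refine ⟨Hausdorff.boundedOnLp_iff hp0 hp1 hΦ h𝒟 h𝒟',
    Hausdorff.boundedOn_iff hp0 hp1 hΦ h𝒟 h𝒟' (Hausdorff.localHardyNorm_zero ψ p)
      (A := ‖∫ x, ψ x‖ₑ⁻¹) (by simpa using hψ)
      (fun _ _ hgv hg => Hausdorff.eLpNorm_le_localHardyNorm ψ hψ p hgv hg)
      (fun b => Hausdorff.localHardyNorm_coe_lt_top ψ b hp0)
      (fun b a => Hausdorff.localHardyNorm_translate ψ b hp0 a),
    Hausdorff.boundedOn_iff hp0 hp1 hΦ h𝒟 h𝒟' (Hausdorff.modulationNorm_zero η hp0)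
      ENNReal.one_ne_top
      (fun _ _ hgv hg => (Hausdorff.eLpNorm_le_modulationNorm η hp0 hp1 hgv hg).trans
        (one_mul _).ge)
      (fun b => Hausdorff.modulationNorm_coe_lt_top η b hp0)
      (fun b a => Hausdorff.modulationNorm_translate η b hp0 p a),
    Hausdorff.boundedOn_iff hp0 hp1 hΦ h𝒟 h𝒟' (Hausdorff.besovNorm_zero φ hp0)
      ENNReal.one_ne_top
      (fun _ _ hgv hg => (Hausdorff.eLpNorm_le_besovNorm φ hp0 hp1.le hgv hg).trans
        (one_mul _).ge)
      (fun b => Hausdorff.besovNorm_coe_lt_top φ b hp0)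
      (fun b a => Hausdorff.besovNorm_translate φ b hp0 p a),
    Hausdorff.boundedOn_iff hp0 hp1 hΦ h𝒟 h𝒟' (Hausdorff.triebelLizorkinNorm_zero φ hp0)
      ENNReal.one_ne_top
      (fun _ _ hgv hg => (Hausdorff.eLpNorm_le_triebelLizorkinNorm φ hp0 hp1.le hgv hg).trans
        (one_mul _).ge)
      (fun b => Hausdorff.triebelLizorkinNorm_coe_lt_top φ b hp0)
      (fun b a => Hausdorff.triebelLizorkinNorm_translate φ b hp0 p a)⟩
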